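/- Let $V$ be a smooth Hausdorff manifold of dimension $m\ge 2$ (for a Lorentz spacetime, $m=4$) and let $TV$ be its tangent bundle, a manifold of dimension $n=2m$ with local coordinates $u=(x^i,y^a)$. Geometric data $(\mathbf N,\mathbf g)$ on $TV$ consist of an N-connection, i.e. a smooth splitting $TTV=hTV\oplus vTV$ with $vTV$ the vertical distribution (N-adapted frame $\mathbf e_i=\partial_{x^i}-N_i^a\partial_{y^a}$, $e_a=\partial_{y^a}$), and a d-metric, i.e. a smooth pseudo-Riemannian metric $\mathbf g$ on $TV$ (of arbitrary signature, e.g. $(+++-;+++-)$) for which $hTV\perp vTV$. A d-connection is a smooth linear connection $\mathbf D$ on $TV$ preserving the splitting; it is metric compatible if $\mathbf D\mathbf g=0$. For a linear connection $\mathbf D$ put $\mathcal R(X,Y)=\mathbf D_X\mathbf D_Y-\mathbf D_Y\mathbf D_X-\mathbf D_{[X,Y]}$, $\mathcal T(X,Y)=\mathbf D_XY-\mathbf D_YX-[X,Y]$, and let $\mathbf R_{\alpha\beta}[\mathbf D]=\mathbf R^\tau{}_{\alpha\beta\tau}$ be the contraction of the endomorphism $X\mapsto\mathcal R(X,e_\beta)e_\alpha$.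 Let $\nabla$ be the Levi-Civita connection of $\mathbf g$. The canonical d-connection $\widehat{\mathbf D}$ of $(\mathbf N,\mathbf g)$ is the metric compatible d-connection with $\widehat T^i{}_{jk}=0$, $\widehat T^a{}_{bc}=0$ and $$\widehat L^a_{bk}=e_bN^a_k+\tfrac12 g^{ac}(\mathbf e_kg_{bc}-g_{dc}e_bN^d_k-g_{db}e_cN^d_k),\qquad \widehat C^i_{jc}=\tfrac12 g^{ik}e_cg_{jk}.$$ For linear connections $\mathbf D$ and $\mathbf D+\mathbf Z$, with distortion tensor $\mathbf Z$, let $\mathrm{Zic}[\mathbf D;\mathbf Z]_{\alpha\beta}$ be the contraction, as for the Ricci tensor, of $$(\mathbf D_X\mathbf Z)(Y,W)-(\mathbf D_Y\mathbf Z)(X,W)+\mathbf Z(\mathcal T(X,Y),W)+\mathbf Z(X,\mathbf Z(Y,W))-\mathbf Z(Y,\mathbf Z(X,W)).$$ A Lagrange density $L$ assigns to $(\mathbf N,\mathbf g)$ a function on $TV$ (other fields being kept fixed). A symmetric smooth tensor $\mathbf T_{\alpha\beta}$ is its energy-momentum d-tensor at $(\mathbf N,\mathbf g)$ if $\mathbf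 T_{\alpha\beta}=-\frac{2}{\sqrt{|\mathbf g|}}\frac{\delta(\sqrt{|\mathbf g|}L)}{\delta\mathbf g^{\alpha\beta}}$, i.e. $\delta\!\int\!\sqrt{|\mathbf g|}\,L\,du=-\frac12\int\!\sqrt{|\mathbf g|}\,\mathbf T_{\alpha\beta}\,\delta\mathbf g^{\alpha\beta}\,du$ for all smooth variations of $(\mathbf N,\mathbf g)$ (independent variations of $N_i^a$, $g_{ij}$, $g_{ab}$) with compact support in a coordinate domain. Fix $\varkappa\ne0$, a rule $(\mathbf N,\mathbf g)\mapsto\mathbf D[\mathbf N,\mathbf g]$ assigning to all geometric data a metric compatible d-connection, and a matter Lagrange density ${}^mL$ whose values are continuous functions. At given $(\mathbf N,\mathbf g)$ write $\mathbf D=\nabla+\mathbf Z$, and suppose that ${}^mL$ and the distortion density ${}^zL=\frac1{2\varkappa}\mathbf g^{\alpha\beta}\mathrm{Zic}[\nabla;\mathbf Z]_{\alpha\beta}$ have energy-momentum d-tensors ${}^m\mathbf T$ and ${}^z\mathbf T$; put $\mathbf T={}^m\mathbf T+{}^z\mathbf T$, $T=\mathbf g^{\alpha\beta}\mathbf T_{\alpha\beta}$.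 Define the effective sources $$\Upsilon^0_{\alpha\beta}=\varkappa\Big(\mathbf T_{\alpha\beta}-\tfrac1{n-2}\mathbf g_{\alpha\beta}T\Big),\qquad \Upsilon_{\alpha\beta}=\Upsilon^0_{\alpha\beta}+\mathrm{Zic}[\nabla;\mathbf Z]_{\alpha\beta},\qquad \widehat\Upsilon_{\alpha\beta}=\Upsilon_{\alpha\beta}+\mathrm{Zic}[\mathbf D;\widehat{\mathbf D}-\mathbf D]_{\alpha\beta}.$$ Then: 1. $\nabla$ and $\widehat{\mathbf D}$ exist for all data $(\mathbf N,\mathbf g)$. 2. $(\mathbf N,\mathbf g)$ is a stationary point of the action $\int\sqrt{|\mathbf g|}\,\big(\frac1{2\varkappa}\mathbf g^{\alpha\beta}\mathbf R_{\alpha\beta}[\mathbf D]+{}^mL\big)du$ under all such variations (with $\mathbf D=\mathbf D[\mathbf N,\mathbf g]$ varied accordingly) if and only if the modified Einstein equations $\mathbf R_{\alpha\beta}[\mathbf D]=\Upsilon_{\alpha\beta}$ hold on $TV$. 3. These equations are equivalent to $\widehat{\mathbf R}_{\alpha\beta}[\widehat{\mathbf D}]=\widehat\Upsilon_{\alpha\beta}$.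 4. $\widehat{\mathcal T}=0$ if and only if $\widehat{\mathbf D}=\nabla$. If $\widehat{\mathcal T}=0$, then $\widehat\Upsilon_{\alpha\beta}=\Upsilon^0_{\alpha\beta}$, and the equations of item 3 are equivalent to the Einstein equations $R_{\alpha\beta}[\nabla]=\Upsilon^0_{\alpha\beta}$ of the Levi-Civita connection. -/

import Mathlib

open scoped Manifold ContDiff Topology
open MeasureTheory

namespace PhaseGravity

noncomputable section

section Basic

variable (m : ℕ) (V : Type*) [TopologicalSpace V] [ChartedSpace (EuclideanSpace ℝ (Fin m)) V]

/-- The phase space: the total space `TV` of the tangent bundle of an `m`-dimensional manifold `V`,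
itself a manifold of dimension `2m` with local coordinates `u = (x, y)`. -/
abbrev Phase : Type _ := TangentBundle (𝓡 m) V

/-- The model vector space of the phase space. -/
abbrev Model : Type := EuclideanSpace ℝ (Fin m) × EuclideanSpace ℝ (Fin m)

variable [IsManifold (𝓡 m) ∞ V]

/-- Vector fields (with no regularity imposed) on the phase space. -/
abbrev VField : Type _ := Π p : Phase m V, TangentSpace (𝓡 m).tangent p

/-- Covariant 2-tensor fields (with no regularity imposed) on the phase space. -/
abbrev Tensor2 : Type _ :=
  Π p : Phase m V, TangentSpace (𝓡 m).tangent p →L[ℝ] TangentSpace (𝓡 m).tangent p →L[ℝ] ℝ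

/-- The type of (1,2)-tensor fields `Z` on the phase space. The argument order is that of
Mathlib's covariant derivatives: `Z p Y X` is what is usually written `Z(X, Y)` or `Z_X Y`. -/
abbrev Tensor12 : Type _ :=
  Π p : Phase m V, TangentSpace (𝓡 m).tangent p →L[ℝ]
    TangentSpace (𝓡 m).tangent p →L[ℝ] TangentSpace (𝓡 m).tangent p

/-- Smooth linear connections on the phase space: `D.cov Y p (X p)` is `(D_X Y)(p)`. -/
structure LinearConnection where
  /-- the covariant derivative -/
  cov : CovariantDerivative (𝓡 m).tangent (Model m)
    (TangentSpace (𝓡 m).tangent : Phase m V → Type _)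
  smooth : cov.ContMDiffCovariantDerivative ∞

end Basic

section Geometry

variable {m : ℕ} {V : Type*} [TopologicalSpace V] [ChartedSpace (EuclideanSpace ℝ (Fin m)) V]
  [IsManifold (𝓡 m) ∞ V]

/-- Smoothness of a vector field at a point. -/
def SmoothFieldAt (X : VField m V) (p : Phase m V) : Prop :=
  ContMDiffAt (𝓡 m).tangent ((𝓡 m).tangent.prod 𝓘(ℝ, Model m)) ∞ (T% X) p

/-- Differentiability of a vector field at a point. -/
def DiffFieldAt (X : VField m V) (p : Phase m V) : Prop :=
  MDifferentiableAt (𝓡 m).tangent ((𝓡 m).tangent.prod 𝓘(ℝ, Model m)) (T% X) p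

/-- A tangent vector of `TV` is vertical when the differential of the projection `TV → V`
annihilates it. -/
def IsVertical {p : Phase m V} (X : TangentSpace (𝓡 m).tangent p) : Prop :=
  mfderiv (𝓡 m).tangent (𝓡 m) (fun q : Phase m V => q.proj) p X = 0

variable (m V) in
/-- The geometric data `(N, g)` on `TV`.

* The N-connection is a smooth splitting `T TV = hTV ⊕ vTV`, where `vTV` is the vertical
  distribution. It is given by its horizontal projector `h`, a field of idempotents whose kernel
  is `vTV`; in coordinates `h ∂/∂xⁱ = eᵢ = ∂/∂xⁱ - Nᵢᵃ ∂/∂yᵃ`.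
* The d-metric is a smooth pseudo-Riemannian metric `g` on `TV` (of any signature) for which
  `hTV` and `vTV` are orthogonal: `g = g_ij eⁱ ⊗ eʲ + g_ab eᵃ ⊗ eᵇ` in N-adapted coframes. -/
structure PhaseGeometry where
  /-- horizontal projector of the N-connection -/
  h : Π p : Phase m V, TangentSpace (𝓡 m).tangent p →L[ℝ] TangentSpace (𝓡 m).tangent p
  /-- the d-metric -/
  g : Tensor2 m V
  h_idem : ∀ p X, h p (h p X) = h p X
  h_ker : ∀ p X, h p X = 0 ↔ IsVertical X
  g_symm : ∀ p X Y, g p X Y = g p Y X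
  g_nondeg : ∀ p X, (∀ Y, g p X Y = 0) → X = 0
  g_adapted : ∀ p X Y, IsVertical Y → g p (h p X) Y = 0
  g_smooth : ∀ p X Y, SmoothFieldAt X p → SmoothFieldAt Y p →
    ContMDiffAt (𝓡 m).tangent 𝓘(ℝ, ℝ) ∞ (fun q => g q (X q) (Y q)) p
  h_smooth : ∀ p X, SmoothFieldAt X p → SmoothFieldAt (fun q => h q (X q)) p

namespace PhaseGeometry

variable (P : PhaseGeometry m V)

/-- Horizontal part of a vector field. -/
def hor (X : VField m V) : VField m V := fun q => P.h q (X q)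

/-- Vertical part of a vector field. -/
def ver (X : VField m V) : VField m V := fun q => X q - P.h q (X q)

end PhaseGeometry

/-- `D` is a d-connection: it preserves the N-connection splitting under parallelism,
`D_W (hY) = h (D_W Y)`. -/
def IsDConnection (P : PhaseGeometry m V) (D : LinearConnection m V) : Prop :=
  ∀ (p : Phase m V) (Y : VField m V) (w : TangentSpace (𝓡 m).tangent p), DiffFieldAt Y p →
    D.cov (P.hor Y) p w = P.h p (D.cov Y p w)

/-- Metric compatibility `D g = 0`. -/
def IsMetricCompatible (P : PhaseGeometry m V) (D : LinearConnection m V) : Prop :=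
  ∀ (p : Phase m V) (Y Z : VField m V) (w : TangentSpace (𝓡 m).tangent p),
    DiffFieldAt Y p → DiffFieldAt Z p →
    mvfderiv (𝓡 m).tangent (fun q => P.g q (Y q) (Z q)) p w =
      P.g p (D.cov Y p w) (Z p) + P.g p (Y p) (D.cov Z p w)

/-- `D` is a Levi-Civita connection of `g`: metric compatible with zero torsion. -/
def IsLeviCivita (P : PhaseGeometry m V) (D : LinearConnection m V) : Prop :=
  IsMetricCompatible P D ∧ D.cov.torsion = 0

/-- `D` is a canonical d-connection of `(N, g)`: a metric compatible d-connection whose horizontal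
torsion `T^i_{jk}` and vertical torsion `T^a_{bc}` vanish, with the mixed coefficients
`L^a_{bk} = e_b(N_k^a) + ½ g^{ac} (e_k g_{bc} - g_{dc} e_b(N_k^d) - g_{db} e_c(N_k^d))` and
`C^i_{jc} = ½ g^{ik} e_c g_{jk}`, written here without frames: take `X = e_k`, `Y = e_b`, `Z = e_c`
and `[e_k, e_b] = e_b(N_k^a) e_a` in `mixed_hv`, and `X = e_c`, `Y = e_j`, `Z = e_k` (where
`[e_c, e_j]` is vertical) in `mixed_vh`. Then also
`L^i_{jk} = ½ g^{ir} (e_k g_{jr} + e_j g_{kr} - e_r g_{jk})` and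
`C^a_{bc} = ½ g^{ad} (e_c g_{bd} + e_b g_{cd} - e_d g_{bc})`. -/
structure IsCanonical (P : PhaseGeometry m V) (D : LinearConnection m V) : Prop where
  dconnection : IsDConnection P D
  metric : IsMetricCompatible P D
  torsion_h : ∀ p X Y, P.h p (D.cov.torsion p (P.h p X) (P.h p Y)) = 0
  torsion_v : ∀ p (X Y : TangentSpace (𝓡 m).tangent p), IsVertical X → IsVertical Y →
    D.cov.torsion p X Y = P.h p (D.cov.torsion p X Y)
  mixed_hv : ∀ (p : Phase m V) (X Y Z : VField m V),
    DiffFieldAt X p → DiffFieldAt Y p → DiffFieldAt Z p →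
    2 * P.g p (D.cov (P.ver Y) p (P.hor X p)) (P.ver Z p) =
      mvfderiv (𝓡 m).tangent (fun q => P.g q (P.ver Y q) (P.ver Z q)) p (P.hor X p)
      + P.g p (VectorField.mlieBracket (𝓡 m).tangent (P.hor X) (P.ver Y) p) (P.ver Z p)
      - P.g p (P.ver Y p) (VectorField.mlieBracket (𝓡 m).tangent (P.hor X) (P.ver Z) p)
  mixed_vh : ∀ (p : Phase m V) (X Y Z : VField m V),
    DiffFieldAt X p → DiffFieldAt Y p → DiffFieldAt Z p →
    2 * P.g p (D.cov (P.hor Y) p (P.ver X p)) (P.hor Z p) =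
      mvfderiv (𝓡 m).tangent (fun q => P.g q (P.hor Y q) (P.hor Z q)) p (P.ver X p)
      + P.g p (VectorField.mlieBracket (𝓡 m).tangent (P.ver X) (P.hor Y) p) (P.hor Z p)
      - P.g p (P.hor Y p) (VectorField.mlieBracket (𝓡 m).tangent (P.ver X) (P.hor Z) p)

/-! ### Frames, traces, curvature -/

variable (m) in
/-- The standard basis of the model space: `inl i` for `∂/∂xⁱ`, `inr a` for `∂/∂yᵃ`. -/
def modelBasis : Module.Basis (Fin m ⊕ Fin m) ℝ (Model m) :=
  (EuclideanSpace.basisFun (Fin m) ℝ).toBasis.prod (EuclideanSpace.basisFun (Fin m) ℝ).toBasis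

/-- A basis of the tangent space at `p` (`TangentSpace` is the model space by definition). -/
def frame (p : Phase m V) (α : Fin m ⊕ Fin m) : TangentSpace (𝓡 m).tangent p := modelBasis m α

/-- The coefficients of a tangent vector in the basis `frame p`. -/
def coframe (p : Phase m V) (α : Fin m ⊕ Fin m) (X : TangentSpace (𝓡 m).tangent p) : ℝ :=
  (modelBasis m).repr X α

/-- The trace `g^{αβ} A_{αβ}`. -/
def metricTrace (P : PhaseGeometry m V) (p : Phase m V)
    (A : TangentSpace (𝓡 m).tangent p → TangentSpace (𝓡 m).tangent p → ℝ) : ℝ :=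
  ∑ α, ∑ β, (Matrix.of fun a b => P.g p (frame p a) (frame p b))⁻¹ α β *
    A (frame p α) (frame p β)

/-- The curvature `R(X, Y) W = D_X D_Y W - D_Y D_X W - D_{[X, Y]} W`. -/
def curvature (D : LinearConnection m V) (X Y W : VField m V) : VField m V := fun p =>
  D.cov (fun q => D.cov W q (Y q)) p (X p) - D.cov (fun q => D.cov W q (X q)) p (Y p)
    - D.cov W p (VectorField.mlieBracket (𝓡 m).tangent X Y p)

/-- Extension of a tangent vector at `p` to a vector field, smooth near `p`. -/
def extendVec {p : Phase m V} (v : TangentSpace (𝓡 m).tangent p) : VField m V :=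
  FiberBundle.extend (Model m) v

/-- The Ricci tensor `R_{αβ} = R^τ_{αβτ}`, that is `Ric(v, w) = tr (X ↦ R(X, w) v)`. -/
def ricci (D : LinearConnection m V) (p : Phase m V) (v w : TangentSpace (𝓡 m).tangent p) : ℝ :=
  ∑ τ, coframe p τ (curvature D (extendVec (frame p τ)) (extendVec w) (extendVec v) p)

/-- The scalar curvature `g^{αβ} R_{αβ}[D]`. -/
def scalarCurvature (P : PhaseGeometry m V) (D : LinearConnection m V) (p : Phase m V) : ℝ :=
  metricTrace P p (ricci D p)

/-! ### Distortions -/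

/-- The distortion tensor `Z = D' - D` of two linear connections. -/
def distortion (D' D : LinearConnection m V) : Tensor12 m V := D'.cov.difference D.cov

/-- `(D_X Z)(Y, W)`. -/
def covTensor (D : LinearConnection m V) (Z : Tensor12 m V) (X Y W : VField m V) : VField m V :=
  fun p => D.cov (fun q => Z q (W q) (Y q)) p (X p) - Z p (W p) (D.cov Y p (X p))
    - Z p (D.cov W p (X p)) (Y p)

/-- The distortion of the curvature under `D ↦ D + Z`:
`(D_X Z)(Y, W) - (D_Y Z)(X, W) + Z(T(X, Y), W) + Z(X, Z(Y, W)) - Z(Y, Z(X, W))`, where `T` is the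
torsion of `D`. -/
def distCurvature (D : LinearConnection m V) (Z : Tensor12 m V) (X Y W : VField m V) :
    VField m V := fun p =>
  covTensor D Z X Y W p - covTensor D Z Y X W p + Z p (W p) (D.cov.torsion p (X p) (Y p))
    + Z p (Z p (W p) (Y p)) (X p) - Z p (Z p (W p) (X p)) (Y p)

/-- The distortion of the Ricci tensor under `D ↦ D + Z`, the contraction of `distCurvature`. -/
def distRicci (D : LinearConnection m V) (Z : Tensor12 m V) (p : Phase m V)
    (v w : TangentSpace (𝓡 m).tangent p) : ℝ :=
  ∑ τ, coframe p τ (distCurvature D Z (extendVec (frame p τ)) (extendVec w) (extendVec v) p)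

/-! ### N-adapted variational calculus -/

/-- The coordinate vector `∂_α` at `p` of the chart of `TV` around `p₀`: `∂/∂xⁱ` or `∂/∂yᵃ`. -/
def coordVec (p₀ : Phase m V) (α : Fin m ⊕ Fin m) (p : Phase m V) :
    TangentSpace (𝓡 m).tangent p :=
  (trivializationAt (Model m) (TangentSpace (𝓡 m).tangent : Phase m V → Type _) p₀).symm p
    (modelBasis m α)

/-- The matrix `g_{αβ}` at `p` in the chart around `p₀`. -/
def metricMatrix (P : PhaseGeometry m V) (p₀ p : Phase m V) :
    Matrix (Fin m ⊕ Fin m) (Fin m ⊕ Fin m) ℝ :=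
  Matrix.of fun α β => P.g p (coordVec p₀ α p) (coordVec p₀ β p)

/-- The integral `∫_K f √|g| d^{2m}u` over a subset `K` of the chart domain around `p₀`. -/
def chartIntegral (P : PhaseGeometry m V) (p₀ : Phase m V) (K : Set (Phase m V))
    (f : Phase m V → ℝ) : ℝ :=
  ∫ u in (extChartAt (𝓡 m).tangent p₀) '' K,
    Real.sqrt |(metricMatrix P p₀ ((extChartAt (𝓡 m).tangent p₀).symm u)).det| *
      f ((extChartAt (𝓡 m).tangent p₀).symm u)

variable (m V) in
/-- Lagrange densities: functionals of the geometric data (and of any further fields, which are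
kept fixed when the geometric data are varied) with values in functions on phase space. -/
abbrev Lagrangian : Type _ := PhaseGeometry m V → Phase m V → ℝ

/-- The action of the Lagrange density `L` on `K`. -/
def actionOn (L : Lagrangian m V) (p₀ : Phase m V) (K : Set (Phase m V))
    (P : PhaseGeometry m V) : ℝ :=
  chartIntegral P p₀ K (L P)

/-- A smooth one-parameter variation `(N_t, g_t)` of `P = (N, g)` supported in `K`. It stays within
N-connections and d-metrics adapted to them; `g_ij`, `g_ab` and `N_i^a` vary independently. -/
structure Variation (P : PhaseGeometry m V) (K : Set (Phase m V)) where
  /-- the varied data -/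
  geom : ℝ → PhaseGeometry m V
  geom_zero : geom 0 = P
  g_eq : ∀ t, ∀ p ∉ K, (geom t).g p = P.g p
  h_eq : ∀ t, ∀ p ∉ K, (geom t).h p = P.h p
  g_smooth : ∀ t p X Y, SmoothFieldAt X p → SmoothFieldAt Y p →
    ContMDiffAt (𝓘(ℝ, ℝ).prod (𝓡 m).tangent) 𝓘(ℝ, ℝ) ∞
      (fun z : ℝ × Phase m V => (geom z.1).g z.2 (X z.2) (Y z.2)) (t, p)
  h_smooth : ∀ t p X Y, SmoothFieldAt X p → SmoothFieldAt Y p →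
    ContMDiffAt (𝓘(ℝ, ℝ).prod (𝓡 m).tangent) 𝓘(ℝ, ℝ) ∞
      (fun z : ℝ × Phase m V => P.g z.2 ((geom z.1).h z.2 (X z.2)) (Y z.2)) (t, p)

/-- The variation `δg^{αβ}` of the inverse metric at `p`, in the chart around `p₀`. -/
def deltaInv {P : PhaseGeometry m V} {K : Set (Phase m V)} (γ : Variation P K)
    (p₀ p : Phase m V) (α β : Fin m ⊕ Fin m) : ℝ :=
  deriv (fun t => (metricMatrix (γ.geom t) p₀ p)⁻¹ α β) 0

/-- `(N, g)` is a stationary point of the action of `L` under all compactly supported variations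
(supported in coordinate domains). -/
def IsActionStationary (L : Lagrangian m V) (P : PhaseGeometry m V) : Prop :=
  ∀ (p₀ : Phase m V) (K : Set (Phase m V)), IsCompact K →
    K ⊆ (extChartAt (𝓡 m).tangent p₀).source → ∀ γ : Variation P K,
      HasDerivAt (fun t => actionOn L p₀ K (γ.geom t)) 0 0

/-- `T` is the symmetric energy-momentum d-tensor of the Lagrange density `L` at `(N, g)`:
`T_{αβ} = - (2 / √|g|) δ(√|g| L) / δg^{αβ}`, that is
`δ ∫ √|g| L = - ½ ∫ √|g| T_{αβ} δg^{αβ}` for all compactly supported variations. -/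
structure IsEnergyMomentum (L : Lagrangian m V) (P : PhaseGeometry m V) (T : Tensor2 m V) :
    Prop where
  symm : ∀ p X Y, T p X Y = T p Y X
  smooth : ∀ p X Y, SmoothFieldAt X p → SmoothFieldAt Y p →
    ContMDiffAt (𝓡 m).tangent 𝓘(ℝ, ℝ) ∞ (fun q => T q (X q) (Y q)) p
  variation : ∀ (p₀ : Phase m V) (K : Set (Phase m V)), IsCompact K →
    K ⊆ (extChartAt (𝓡 m).tangent p₀).source → ∀ γ : Variation P K,
      HasDerivAt (fun t => actionOn L p₀ K (γ.geom t))
        (-(1 / 2) * chartIntegral P p₀ K fun p =>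
          ∑ α, ∑ β, T p (coordVec p₀ α p) (coordVec p₀ β p) * deltaInv γ p₀ p α β) 0

/-- The gravitational Lagrange density `(1 / 2ϰ) g^{αβ} R_{αβ}[D]` of a rule `D = D[N, g]`
plus the matter Lagrange density `Lm`. -/
def totalLagrangian (ϰ : ℝ) (D : PhaseGeometry m V → LinearConnection m V)
    (Lm : Lagrangian m V) : Lagrangian m V :=
  fun P p => 1 / (2 * ϰ) * scalarCurvature P (D P) p + Lm P p

/-- The effective matter Lagrange density of the distortion `D = ∇ + Z`: the distortion
`(1 / 2ϰ) g^{αβ} Zic_{αβ}` of the gravitational Lagrange density. -/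
def distLagrangian (ϰ : ℝ) (lc D : PhaseGeometry m V → LinearConnection m V) : Lagrangian m V :=
  fun P p => 1 / (2 * ϰ) * metricTrace P p (distRicci (lc P) (distortion (D P) (lc P)) p)

/-- The source `ϰ (T_{αβ} - g_{αβ} T / (n - 2))` of an energy-momentum tensor in total dimension
`n = 2m`. -/
def matterSource (ϰ : ℝ) (P : PhaseGeometry m V) (T : Tensor2 m V) (p : Phase m V)
    (v w : TangentSpace (𝓡 m).tangent p) : ℝ :=
  ϰ * (T p v w - 1 / (2 * (m : ℝ) - 2) * metricTrace P p (fun a b => T p a b) * P.g p v w)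

/-- The effective source of `D = D[N, g] = ∇ + Z` at `(N, g)`: the source of the total
energy-momentum d-tensor `T`, nonholonomically deformed by the distortion `Zic` of the Ricci
tensor. -/
def effectiveSource (ϰ : ℝ) (lc D : PhaseGeometry m V → LinearConnection m V)
    (P : PhaseGeometry m V) (T : Tensor2 m V) (p : Phase m V)
    (v w : TangentSpace (𝓡 m).tangent p) : ℝ :=
  matterSource ϰ P T p v w + distRicci (lc P) (distortion (D P) (lc P)) p v w

/-- The effective source redefined for a second connection `D'`. -/
def redefinedSource (D D' : LinearConnection m V)
    (Υ : Π p : Phase m V, TangentSpace (𝓡 m).tangent p → TangentSpace (𝓡 m).tangent p → ℝ)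
    (p : Phase m V) (v w : TangentSpace (𝓡 m).tangent p) : ℝ :=
  Υ p v w + distRicci D (distortion D' D) p v w

/-- The modified Einstein equations `R_{αβ}[D] = Υ_{αβ}` (all components). -/
def EinsteinEq (D : LinearConnection m V)
    (Υ : Π p : Phase m V, TangentSpace (𝓡 m).tangent p → TangentSpace (𝓡 m).tangent p → ℝ) :
    Prop :=
  ∀ p v w, ricci D p v w = Υ p v w

end Geometry

end

end PhaseGravity

open PhaseGravity

/-!
The field equations on the tangent bundle come from three independent facts.

*Existence of the connections.* A linear connection `D` is determined by the form
`Φ(X, Y, Z) = 2 g(D_X Y, Z)`, and conversely every `Φ` with the right linearity and Leibniz rules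
(`IsKoszulForm`) defines one by raising an index with the inverse metric matrix. The Koszul
expression yields the Levi-Civita connection (`isLeviCivita_koszul`). The canonical d-connection
comes from the Koszul expressions of the horizontal and of the vertical parts, completed by
`X g(Y, Z) + g([X, Y], Z) - g([X, Z], Y)` when `X` is of the type opposite to that of `Y` and `Z`
(`isCanonical_canonicalKoszul`).

*Change of the connection.* The Ricci tensors of `D` and `D + Z` differ exactly by `Zic[D; Z]`
(`ricci_eq_add_distRicci`). Hence adding distortion terms to both sides turns the equations for
`∇`, for `D` and for the canonical d-connection into one another, and the total Lagrangian is the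
sum of the Hilbert Lagrangian of `∇`, the distortion Lagrangian and the matter Lagrangian. If the
canonical d-connection has no torsion, it is metric and torsion-free, so it is `∇` by uniqueness,
and the distortion terms of the sources cancel.

*Variation.* The variations of the last two Lagrangians are given by their energy-momentum
tensors. For the first one, work in a chart: there `∇` is given by the Christoffel symbols
(`IsLeviCivita.chartSymbol_eq`), and by the Palatini identity (`palatini_algebra`) the variation of
`√|g| R` is `√|g| (R_{αβ} - ½ R g_{αβ}) δg^{αβ}` plus a divergence, which integrates to zero for a
variation with compact support (`hasDerivAt_integral_hilbertDensity`). So the first variation of the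
total action is the integral of `E_{αβ} δg^{αβ}`, where `E` is the Euler–Lagrange tensor
(`hasDerivAt_actionOn_totalLagrangian`), and the action is stationary if `E = 0`.

For the converse, variations of `N`, `g_{ij}`, `g_{ab}` are realized by pulling back the data along
the automorphisms `1 + s(t) ρ ∂_α ⊗ du^β` of the tangent spaces, with a cut-off function `ρ`; this
keeps the data admissible whenever the vertical distribution is preserved, that is, when `∂_α` is
vertical or `u^β` is a coordinate of the base (`deformVariation`). Such a variation of the inverse
metric pairs with a symmetric `E` to a multiple of `ρ (E g⁻¹)_α^β`, so these components vanish. The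
remaining components, with `∂_α` in a base direction and `u^β` a fibre coordinate, are those of a
vertical vector which is orthogonal to the vertical and to the horizontal space, hence zero
(`eq_zero_of_sum_mul_inv_eq_zero`). Finally, `E = 0` is the trace-reversed Einstein equation
`R_{αβ}[∇] = Υ⁰_{αβ}`, as the dimension `2m` is not `2` (`eulerLagrange_eq_zero_iff`).
-/

namespace PhaseGravity

noncomputable section

/-! ### Calculus of matrix-valued functions -/

section MatrixCalculus

variable {ι : Type*} [Fintype ι] [DecidableEq ι] {F : Type*} [NormedAddCommGroup F]
  [NormedSpace ℝ F] {A : F → Matrix ι ι ℝ} {x : F}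

lemma contDiffAt_det {n : WithTop ℕ∞} (hA : ∀ i j, ContDiffAt ℝ n (fun y => A y i j) x) :
    ContDiffAt ℝ n (fun y => (A y).det) x := by
  simp only [Matrix.det_apply']
  refine ContDiffAt.sum fun σ _ => contDiffAt_const.mul ?_
  exact contDiffAt_prod fun i _ => hA _ _

lemma contDiffAt_inv_apply {n : WithTop ℕ∞} (hA : ∀ i j, ContDiffAt ℝ n (fun y => A y i j) x)
    (hdet : (A x).det ≠ 0) (i j : ι) : ContDiffAt ℝ n (fun y => (A y)⁻¹ i j) x := by
  simp only [Matrix.inv_def, Ring.inverse_eq_inv', Matrix.smul_apply, smul_eq_mul,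
    Matrix.adjugate_apply]
  refine ((contDiffAt_det hA).inv hdet).mul (contDiffAt_det fun k l => ?_)
  rcases eq_or_ne k j with rfl | h
  · simp only [Matrix.updateRow_self]
    exact contDiffAt_const
  · simp only [Matrix.updateRow_ne h]
    exact hA k l

lemma continuousAt_det {X : Type*} [TopologicalSpace X] {A : X → Matrix ι ι ℝ} {x : X}
    (hA : ∀ i j, ContinuousAt (fun y => A y i j) x) : ContinuousAt (fun y => (A y).det) x := by
  simp only [Matrix.det_apply']
  exact tendsto_finsetSum _ fun σ _ =>
    tendsto_const_nhds.mul (tendsto_finsetProd _ fun i _ => hA (σ i) i)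

/-- Jacobi's formula for the derivative of a determinant. -/
lemma hasFDerivAt_det (hA : ∀ i j, DifferentiableAt ℝ (fun y => A y i j) x) :
    HasFDerivAt (fun y => (A y).det)
      (∑ i, ∑ j, (A x).adjugate i j • fderiv ℝ (fun y => A y j i) x) x := by
  have hdet : (fun y => (A y).det) =
      fun y => ∑ σ : Equiv.Perm ι, ((σ.sign : ℤ) : ℝ) * ∏ i, A y (σ i) i :=
    funext fun y => Matrix.det_apply' _
  rw [hdet]
  have h : ∀ σ : Equiv.Perm ι, HasFDerivAt (fun y => ((σ.sign : ℤ) : ℝ) * ∏ i, A y (σ i) i)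
      (((σ.sign : ℤ) : ℝ) • ∑ i, (∏ j ∈ Finset.univ.erase i, A x (σ j) j) •
        fderiv ℝ (fun y => A y (σ i) i) x) x := fun σ =>
    (HasFDerivAt.finsetProd fun i _ => (hA (σ i) i).hasFDerivAt).const_mul _
  refine (HasFDerivAt.fun_sum fun σ _ => h σ).congr_fderiv ?_
  ext v
  -- for each column `i`, the terms add up to a determinant with that column replaced
  have key : ∀ i : ι, ∑ j, (A x).adjugate i j * fderiv ℝ (fun y => A y j i) x v
      = ∑ σ : Equiv.Perm ι, ((σ.sign : ℤ) : ℝ) *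
        ((∏ j ∈ Finset.univ.erase i, A x (σ j) j) * fderiv ℝ (fun y => A y (σ i) i) x v) := by
    intro i
    have h1 := congrFun (Matrix.cramer_eq_adjugate_mulVec (A x)
      fun j => fderiv ℝ (fun y => A y j i) x v) i
    rw [Matrix.cramer_apply, Matrix.det_apply'] at h1
    simp only [Matrix.mulVec, dotProduct] at h1
    rw [← h1]
    refine Finset.sum_congr rfl fun σ _ => ?_
    congr 1
    rw [← Finset.prod_erase_mul _ _ (Finset.mem_univ i), Matrix.updateCol_self]
    congr 1
    refine Finset.prod_congr rfl fun j hj => ?_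
    rw [Matrix.updateCol_ne (Finset.ne_of_mem_erase hj)]
  simp only [FunLike.coe_sum, Finset.sum_apply, FunLike.coe_smul, Pi.smul_apply, smul_eq_mul, key,
    Finset.mul_sum]
  rw [Finset.sum_comm]

lemma fderiv_det_apply (hA : ∀ i j, DifferentiableAt ℝ (fun y => A y i j) x)
    (hdet : (A x).det ≠ 0) (v : F) :
    fderiv ℝ (fun y => (A y).det) x v =
      (A x).det * ∑ i, ∑ j, (A x)⁻¹ i j * fderiv ℝ (fun y => A y j i) x v := by
  rw [(hasFDerivAt_det hA).fderiv]
  simp only [FunLike.coe_sum, Finset.sum_apply, FunLike.coe_smul, Pi.smul_apply, smul_eq_mul,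
    Matrix.inv_def, Ring.inverse_eq_inv', Matrix.smul_apply, Finset.mul_sum]
  refine Finset.sum_congr rfl fun i _ => Finset.sum_congr rfl fun j _ => ?_
  field_simp

lemma fderiv_sqrt_abs_det_apply (hA : ∀ i j, DifferentiableAt ℝ (fun y => A y i j) x)
    (hdet : (A x).det ≠ 0) (v : F) :
    fderiv ℝ (fun y => √|(A y).det|) x v =
      1 / 2 * √|(A x).det| * ∑ i, ∑ j, (A x)⁻¹ i j * fderiv ℝ (fun y => A y j i) x v := by
  have h1 : HasDerivAt (fun r : ℝ => √|r|) (SignType.sign (A x).det / (2 * √|(A x).det|))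
      (A x).det := (hasDerivAt_abs hdet).sqrt (abs_ne_zero.2 hdet)
  have h2 := h1.comp_hasFDerivAt x (hasFDerivAt_det hA).differentiableAt.hasFDerivAt
  have h3 : fderiv ℝ (fun y => √|(A y).det|) x = _ := h2.fderiv
  rw [h3, FunLike.coe_smul, Pi.smul_apply, fderiv_det_apply hA hdet, smul_eq_mul, ← mul_assoc]
  congr 1
  have hpos : 0 < √|(A x).det| := Real.sqrt_pos.2 (abs_pos.2 hdet)
  rw [div_mul_eq_mul_div, sign_mul_self, div_eq_iff (by positivity)]
  nlinarith [Real.mul_self_sqrt (abs_nonneg (A x).det)]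

lemma contDiffAt_sqrt_abs_det {n : ℕ∞} (hA : ∀ i j, ContDiffAt ℝ n (fun y => A y i j) x)
    (hdet : (A x).det ≠ 0) : ContDiffAt ℝ n (fun y => √|(A y).det|) x :=
  ContDiffAt.sqrt (ContDiffAt.comp x (g := fun r : ℝ => |r|) (contDiffAt_abs hdet)
    (contDiffAt_det hA)) (abs_ne_zero.2 hdet)

lemma fderiv_inv_apply (hA : ∀ i j, ContDiffAt ℝ 1 (fun y => A y i j) x)
    (hdet : (A x).det ≠ 0) (v : F) (i j : ι) :
    fderiv ℝ (fun y => (A y)⁻¹ i j) x v =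
      -∑ k, ∑ l, (A x)⁻¹ i k * fderiv ℝ (fun y => A y k l) x v * (A x)⁻¹ l j := by
  have hd : ∀ i j, DifferentiableAt ℝ (fun y => A y i j) x :=
    fun i j => (hA i j).differentiableAt (by simp)
  have hdi : ∀ i j, DifferentiableAt ℝ (fun y => (A y)⁻¹ i j) x :=
    fun i j => (contDiffAt_inv_apply hA hdet i j).differentiableAt (by simp)
  have hev : ∀ᶠ y in 𝓝 x, (A y).det ≠ 0 :=
    (continuousAt_det fun i j => (hd i j).continuousAt).eventually_ne hdet
  let B : Matrix ι ι ℝ := Matrix.of fun i j => fderiv ℝ (fun y => A y i j) x v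
  let C : Matrix ι ι ℝ := Matrix.of fun i j => fderiv ℝ (fun y => (A y)⁻¹ i j) x v
  -- differentiate `A⁻¹ A = 1`
  have h1 : (A x)⁻¹ * B + C * A x = 0 := by
    ext a b
    have h2 : (fun y => ∑ k, (A y)⁻¹ a k * A y k b) =ᶠ[𝓝 x] fun _ => (1 : Matrix ι ι ℝ) a b := by
      filter_upwards [hev] with y hy
      rw [← Matrix.mul_apply, Matrix.nonsing_inv_mul _ (isUnit_iff_ne_zero.2 hy)]
    have h3 := h2.fderiv_eq (𝕜 := ℝ)
    rw [fderiv_fun_sum (fun k _ => (hdi a k).fun_mul (hd k b))] at h3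
    have h4 := congrArg (fun L => L v) h3
    simp only [FunLike.coe_sum, Finset.sum_apply, fderiv_fun_const] at h4
    rw [Finset.sum_congr rfl fun k _ => by rw [fderiv_fun_mul (hdi a k) (hd k b)]] at h4
    simp only [FunLike.coe_add, Pi.add_apply, FunLike.coe_smul, Pi.smul_apply, smul_eq_mul,
      Finset.sum_add_distrib] at h4
    simp only [Matrix.add_apply, Matrix.mul_apply, B, C, Matrix.of_apply, Matrix.zero_apply]
    refine Eq.trans ?_ h4
    congr 1
    exact Finset.sum_congr rfl fun k _ => mul_comm _ _
  have h5 : C = -((A x)⁻¹ * B * (A x)⁻¹) := by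
    have h6 := congrArg (· * (A x)⁻¹) h1
    simp only [add_mul, zero_mul, mul_assoc,
      Matrix.mul_nonsing_inv _ (isUnit_iff_ne_zero.2 hdet), mul_one] at h6
    rw [mul_assoc]
    exact eq_neg_of_add_eq_zero_right h6
  have h7 := congrFun (congrFun h5 i) j
  simp only [Matrix.neg_apply, Matrix.mul_apply, B, C, Matrix.of_apply, Finset.sum_mul] at h7
  rw [h7, Finset.sum_comm]

end MatrixCalculus

/-! ### The algebra of the Palatini identity -/

section Algebra

variable {ι : Type*} [Fintype ι]

lemma sum_reverse₃ (f : ι → ι → ι → ℝ) :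
    ∑ a, ∑ b, ∑ c, f a b c = ∑ c, ∑ b, ∑ a, f a b c := by
  rw [Finset.sum_comm, Finset.sum_congr rfl fun b _ => Finset.sum_comm, Finset.sum_comm]

lemma sum_swap_pairs (f : ι → ι → ι → ι → ℝ) :
    ∑ a, ∑ b, ∑ c, ∑ d, f a b c d = ∑ c, ∑ d, ∑ a, ∑ b, f a b c d := by
  rw [Finset.sum_congr rfl fun a _ => Finset.sum_comm, Finset.sum_comm]
  refine Finset.sum_congr rfl fun c _ => ?_
  rw [Finset.sum_congr rfl fun a _ => Finset.sum_comm, Finset.sum_comm]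

/-- The Palatini identity at a point: when `ds` and `dgi` are the derivatives of the density `s`
and of the inverse metric `gi` that express metric compatibility of the symmetric connection
coefficients `Γ`, the variation of the Ricci tensor under `δΓ = ζ`, contracted with `s gi`, is the
divergence of `V^τ = s (g^{αβ} ζ^τ_{αβ} - g^{ατ} ζ^σ_{ασ})`. Here `dζ σ τ α β` stands for
`∂_σ ζ^τ_{αβ}`. -/
lemma palatini_algebra (s : ℝ) (gi : Matrix ι ι ℝ) (Γ ζ : ι → ι → ι → ℝ) (dζ : ι → ι → ι → ι → ℝ)
    (ds : ι → ℝ) (dgi : ι → ι → ι → ℝ) (hgi : ∀ α β, gi α β = gi β α)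
    (hΓ : ∀ τ α β, Γ τ α β = Γ τ β α) (hζ : ∀ τ α β, ζ τ α β = ζ τ β α)
    (hds : ∀ σ, ds σ = s * ∑ κ, Γ κ σ κ)
    (hdgi : ∀ σ α β, dgi σ α β = -∑ κ, (Γ α κ σ * gi κ β + Γ β κ σ * gi κ α)) :
    ∑ τ, (ds τ * (∑ α, ∑ β, gi α β * ζ τ α β - ∑ α, gi α τ * ∑ σ, ζ σ α σ)
      + s * (∑ α, ∑ β, (dgi τ α β * ζ τ α β + gi α β * dζ τ τ α β)
        - ∑ α, (dgi τ α τ * ∑ σ, ζ σ α σ + gi α τ * ∑ σ, dζ τ σ α σ)))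
    = s * ∑ α, ∑ β, gi α β * ∑ τ, (dζ τ τ α β - dζ β τ α τ
        + ∑ κ, (ζ τ κ τ * Γ κ α β + Γ τ κ τ * ζ κ α β - ζ τ κ β * Γ κ α τ
          - Γ τ κ β * ζ κ α τ)) := by
  set c : ι → ℝ := fun τ => ∑ κ, Γ κ τ κ with hc
  set z : ι → ℝ := fun α => ∑ σ, ζ σ α σ with hz
  -- substitute metric compatibility into the two terms with the derivative of the inverse metric
  have e1 : ∀ τ, ∑ α, ∑ β, dgi τ α β * ζ τ α β =
      -2 * ∑ a, ∑ k, ∑ b, Γ a k τ * gi k b * ζ τ a b := by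
    intro τ
    have h1 : ∑ α, ∑ β, dgi τ α β * ζ τ α β =
        -(∑ α, ∑ β, ∑ κ, Γ α κ τ * gi κ β * ζ τ α β)
        - ∑ α, ∑ β, ∑ κ, Γ β κ τ * gi κ α * ζ τ α β := by
      simp only [hdgi, Finset.sum_add_distrib, neg_mul, add_mul, Finset.sum_mul, neg_add,
        Finset.sum_neg_distrib]
      ring
    have h2 : ∑ α, ∑ β, ∑ κ, Γ β κ τ * gi κ α * ζ τ α β =
        ∑ a, ∑ k, ∑ b, Γ a k τ * gi k b * ζ τ a b := by
      rw [Finset.sum_comm]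
      refine Finset.sum_congr rfl fun a _ => ?_
      rw [Finset.sum_comm]
      exact Finset.sum_congr rfl fun k _ => Finset.sum_congr rfl fun b _ => by rw [hζ τ b a]
    have h3 : ∑ α, ∑ β, ∑ κ, Γ α κ τ * gi κ β * ζ τ α β =
        ∑ a, ∑ k, ∑ b, Γ a k τ * gi k b * ζ τ a b :=
      Finset.sum_congr rfl fun a _ => Finset.sum_comm
    rw [h1, h2, h3]
    ring
  have e2 : ∀ τ, ∑ α, dgi τ α τ * z α =
      -(∑ α, ∑ κ, Γ α κ τ * gi κ τ * z α) - ∑ α, ∑ κ, Γ τ κ τ * gi κ α * z α := by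
    intro τ
    simp only [hdgi, Finset.sum_add_distrib, neg_mul, add_mul, Finset.sum_mul, neg_add,
      Finset.sum_neg_distrib]
    ring
  have e3 : ∑ τ, ∑ α, ∑ κ, Γ τ κ τ * gi κ α * z α = ∑ τ, c τ * ∑ α, gi α τ * z α := by
    simp only [hc, Finset.sum_mul, Finset.mul_sum]
    rw [sum_reverse₃]
    refine Finset.sum_congr rfl fun κ _ => Finset.sum_congr rfl fun α _ =>
      Finset.sum_congr rfl fun τ _ => by rw [hgi κ α, mul_assoc]
  -- the four terms `ζ Γ` of the variation of the Ricci tensor match the terms `Γ ζ` of the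
  -- divergence, after relabelling of indices; `r3` and `r4` give the same sum
  have r1 : ∑ α, ∑ β, gi α β * ∑ τ, ∑ κ, ζ τ κ τ * Γ κ α β =
      ∑ τ, ∑ α, ∑ κ, Γ α κ τ * gi κ τ * z α := by
    simp only [hz, Finset.mul_sum]
    rw [Finset.sum_comm]
    refine Finset.sum_congr rfl fun β _ => ?_
    rw [sum_reverse₃]
    conv_rhs => rw [Finset.sum_congr rfl fun α _ => Finset.sum_comm]
    refine Finset.sum_congr rfl fun κ _ => Finset.sum_congr rfl fun τ _ =>
      Finset.sum_congr rfl fun α _ => by ring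
  have r2 : ∑ α, ∑ β, gi α β * ∑ τ, ∑ κ, Γ τ κ τ * ζ κ α β =
      ∑ τ, c τ * ∑ α, ∑ β, gi α β * ζ τ α β := by
    simp only [hc, Finset.mul_sum, Finset.sum_mul]
    rw [sum_swap_pairs, Finset.sum_comm]
    refine Finset.sum_congr rfl fun κ _ => ?_
    rw [Finset.sum_comm]
    conv_rhs => rw [Finset.sum_congr rfl fun α _ => Finset.sum_comm]
    refine Finset.sum_congr rfl fun α _ => ?_
    rw [Finset.sum_comm]
    conv_rhs => rw [Finset.sum_comm]
    refine Finset.sum_congr rfl fun β _ => Finset.sum_congr rfl fun τ _ => by ring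
  have r3 : ∑ α, ∑ β, gi α β * ∑ τ, ∑ κ, ζ τ κ β * Γ κ α τ =
      ∑ τ, ∑ a, ∑ k, ∑ b, Γ a k τ * gi k b * ζ τ a b := by
    simp only [Finset.mul_sum]
    rw [sum_swap_pairs]
    refine Finset.sum_congr rfl fun τ _ => Finset.sum_congr rfl fun κ _ =>
      Finset.sum_congr rfl fun α _ => Finset.sum_congr rfl fun β _ => by ring
  have r4 : ∑ α, ∑ β, gi α β * ∑ τ, ∑ κ, Γ τ κ β * ζ κ α τ =
      ∑ τ, ∑ a, ∑ k, ∑ b, Γ a k τ * gi k b * ζ τ a b := by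
    simp only [Finset.mul_sum]
    rw [sum_swap_pairs, Finset.sum_comm]
    refine Finset.sum_congr rfl fun κ _ => Finset.sum_congr rfl fun τ _ => ?_
    rw [Finset.sum_comm]
    refine Finset.sum_congr rfl fun β _ => Finset.sum_congr rfl fun α _ => ?_
    rw [hΓ τ κ β, hgi α β, hζ κ α τ]
    ring
  have d1 : ∑ α, ∑ β, gi α β * ∑ τ, dζ τ τ α β = ∑ τ, ∑ α, ∑ β, gi α β * dζ τ τ α β := by
    simp only [Finset.mul_sum]
    rw [Finset.sum_congr rfl fun α _ => Finset.sum_comm, Finset.sum_comm]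
  have d2 : ∑ α, ∑ β, gi α β * ∑ τ, dζ β τ α τ = ∑ τ, ∑ α, gi α τ * ∑ σ, dζ τ σ α σ :=
    Finset.sum_comm
  -- distribute both sides over their terms
  have hR : ∑ α, ∑ β, gi α β * ∑ τ, (dζ τ τ α β - dζ β τ α τ
        + ∑ κ, (ζ τ κ τ * Γ κ α β + Γ τ κ τ * ζ κ α β - ζ τ κ β * Γ κ α τ - Γ τ κ β * ζ κ α τ))
      = (∑ α, ∑ β, gi α β * ∑ τ, dζ τ τ α β) - (∑ α, ∑ β, gi α β * ∑ τ, dζ β τ α τ)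
        + (∑ α, ∑ β, gi α β * ∑ τ, ∑ κ, ζ τ κ τ * Γ κ α β)
        + (∑ α, ∑ β, gi α β * ∑ τ, ∑ κ, Γ τ κ τ * ζ κ α β)
        - (∑ α, ∑ β, gi α β * ∑ τ, ∑ κ, ζ τ κ β * Γ κ α τ)
        - ∑ α, ∑ β, gi α β * ∑ τ, ∑ κ, Γ τ κ β * ζ κ α τ := by
    simp only [Finset.sum_add_distrib, Finset.sum_sub_distrib, mul_add, mul_sub]
    ring
  rw [hR, d1, d2, r1, r2, r3, r4]
  have hL : ∀ τ, ds τ * (∑ α, ∑ β, gi α β * ζ τ α β - ∑ α, gi α τ * z α)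
      + s * (∑ α, ∑ β, (dgi τ α β * ζ τ α β + gi α β * dζ τ τ α β)
        - ∑ α, (dgi τ α τ * z α + gi α τ * ∑ σ, dζ τ σ α σ))
      = s * (c τ * ∑ α, ∑ β, gi α β * ζ τ α β - c τ * ∑ α, gi α τ * z α
        - 2 * (∑ a, ∑ k, ∑ b, Γ a k τ * gi k b * ζ τ a b)
        + (∑ α, ∑ β, gi α β * dζ τ τ α β)
        + ((∑ α, ∑ κ, Γ α κ τ * gi κ τ * z α) + ∑ α, ∑ κ, Γ τ κ τ * gi κ α * z α)
        - ∑ α, gi α τ * ∑ σ, dζ τ σ α σ) := by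
    intro τ
    have h1 : ∑ α, ∑ β, (dgi τ α β * ζ τ α β + gi α β * dζ τ τ α β) =
        -2 * (∑ a, ∑ k, ∑ b, Γ a k τ * gi k b * ζ τ a b)
          + ∑ α, ∑ β, gi α β * dζ τ τ α β := by
      rw [← e1]
      simp only [Finset.sum_add_distrib]
    rw [h1, Finset.sum_add_distrib, e2, hds]
    ring
  rw [Finset.sum_congr rfl fun τ _ => hL τ, ← Finset.mul_sum]
  congr 1
  simp only [Finset.sum_add_distrib, Finset.sum_sub_distrib, e3, ← Finset.mul_sum]
  ring

end Algebra

/-! ### Ricci tensor and Christoffel symbols in coordinates -/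

section Coordinates

variable {ι : Type*} [Fintype ι] {E : Type*} [NormedAddCommGroup E] [NormedSpace ℝ E]

/-- The Ricci tensor of the connection with coefficients `Γ`, where `Γ u τ α β` is the component
`Γ^τ_{αβ}` of `D_β ∂_α` and the coordinate directions are `b`. -/
def coordRicci (b : ι → E) (Γ : E → ι → ι → ι → ℝ) (u : E) (α β : ι) : ℝ :=
  ∑ τ, (fderiv ℝ (fun y => Γ y τ α β) u (b τ) - fderiv ℝ (fun y => Γ y τ α τ) u (b β)
    + ∑ κ, (Γ u τ κ τ * Γ u κ α β - Γ u τ κ β * Γ u κ α τ))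

variable [DecidableEq ι]

/-- The Christoffel symbols `Γ^τ_{αβ}` of the metric with matrix `G` in the coordinate directions
`b`. -/
def christoffel (b : ι → E) (G : E → Matrix ι ι ℝ) (u : E) (τ α β : ι) : ℝ :=
  1 / 2 * ∑ σ, (G u)⁻¹ τ σ * (fderiv ℝ (fun y => G y α σ) u (b β)
    + fderiv ℝ (fun y => G y β σ) u (b α) - fderiv ℝ (fun y => G y α β) u (b σ))

variable {b : ι → E} {G : E → Matrix ι ι ℝ} {u : E}

lemma fderiv_symm_of_eventually {κ : Type*} {G : E → Matrix κ κ ℝ}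
    (hs : ∀ᶠ y in 𝓝 u, ∀ α β, G y α β = G y β α) (α β : κ) :
    fderiv ℝ (fun y => G y α β) u = fderiv ℝ (fun y => G y β α) u :=
  Filter.EventuallyEq.fderiv_eq (hs.mono fun _ h => h α β)

lemma inv_symm_of_symm {A : Matrix ι ι ℝ} (hA : ∀ α β, A α β = A β α) (α β : ι) :
    A⁻¹ α β = A⁻¹ β α := by
  have h : A.transpose = A := Matrix.ext fun i j => hA j i
  have h2 := Matrix.transpose_nonsing_inv A
  rw [h] at h2
  exact (congrFun (congrFun h2 β) α)

lemma christoffel_symm (hs : ∀ᶠ y in 𝓝 u, ∀ α β, G y α β = G y β α) (τ α β : ι) :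
    christoffel b G u τ α β = christoffel b G u τ β α := by
  unfold christoffel
  congr 1
  refine Finset.sum_congr rfl fun σ _ => ?_
  rw [fderiv_symm_of_eventually hs α β]
  ring

/-- The Christoffel symbols of the first kind. -/
lemma sum_metric_mul_christoffel (hdet : (G u).det ≠ 0) (σ α β : ι) :
    ∑ τ, G u σ τ * christoffel b G u τ α β = 1 / 2 * (fderiv ℝ (fun y => G y α σ) u (b β)
      + fderiv ℝ (fun y => G y β σ) u (b α) - fderiv ℝ (fun y => G y α β) u (b σ)) := by
  set w : ι → ℝ := fun σ => fderiv ℝ (fun y => G y α σ) u (b β)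
      + fderiv ℝ (fun y => G y β σ) u (b α) - fderiv ℝ (fun y => G y α β) u (b σ) with hw
  have h1 : ∀ τ, christoffel b G u τ α β = 1 / 2 * ((G u)⁻¹.mulVec w) τ := fun τ => rfl
  have h2 : (G u).mulVec ((G u)⁻¹.mulVec w) = w := by
    rw [Matrix.mulVec_mulVec, Matrix.mul_nonsing_inv _ (isUnit_iff_ne_zero.2 hdet),
      Matrix.one_mulVec]
  calc ∑ τ, G u σ τ * christoffel b G u τ α β
      = 1 / 2 * ((G u).mulVec ((G u)⁻¹.mulVec w)) σ := by
        conv_rhs => rw [Matrix.mulVec, dotProduct, Finset.mul_sum]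
        exact Finset.sum_congr rfl fun τ _ => by rw [h1]; ring
    _ = 1 / 2 * w σ := by rw [h2]

/-- The Christoffel symbols are metric compatible. -/
lemma fderiv_metric_eq_christoffel (hs : ∀ᶠ y in 𝓝 u, ∀ α β, G y α β = G y β α)
    (hdet : (G u).det ≠ 0) (α β γ : ι) :
    fderiv ℝ (fun y => G y α β) u (b γ) =
      ∑ σ, (G u β σ * christoffel b G u σ α γ + G u α σ * christoffel b G u σ β γ) := by
  rw [Finset.sum_add_distrib, sum_metric_mul_christoffel hdet, sum_metric_mul_christoffel hdet,
    fderiv_symm_of_eventually hs β α, fderiv_symm_of_eventually hs γ β,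
    fderiv_symm_of_eventually hs γ α]
  ring

lemma sum_inv_mul_metric_mul_christoffel (hdet : (G u).det ≠ 0) (i α β : ι) :
    ∑ k, (G u)⁻¹ i k * ∑ σ, G u k σ * christoffel b G u σ α β = christoffel b G u i α β := by
  have h : (G u)⁻¹.mulVec ((G u).mulVec fun σ => christoffel b G u σ α β) =
      fun σ => christoffel b G u σ α β := by
    rw [Matrix.mulVec_mulVec, Matrix.nonsing_inv_mul _ (isUnit_iff_ne_zero.2 hdet),
      Matrix.one_mulVec]
  exact congrFun h i

/-- The logarithmic derivative of `√|g|` is the contraction `Γ^κ_{γκ}`. -/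
lemma fderiv_sqrt_abs_det_eq_christoffel (hG : ∀ i j, ContDiffAt ℝ 1 (fun y => G y i j) u)
    (hs : ∀ᶠ y in 𝓝 u, ∀ α β, G y α β = G y β α) (hdet : (G u).det ≠ 0) (γ : ι) :
    fderiv ℝ (fun y => √|(G y).det|) u (b γ) =
      √|(G u).det| * ∑ κ, christoffel b G u κ γ κ := by
  rw [fderiv_sqrt_abs_det_apply (fun i j => (hG i j).differentiableAt (by simp)) hdet]
  have h1 : ∑ i, ∑ j, (G u)⁻¹ i j * fderiv ℝ (fun y => G y j i) u (b γ) =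
      2 * ∑ κ, christoffel b G u κ γ κ := by
    have h2 : ∀ i j, (G u)⁻¹ i j * fderiv ℝ (fun y => G y j i) u (b γ) =
        (G u)⁻¹ i j * (∑ σ, G u j σ * christoffel b G u σ i γ)
          + (G u)⁻¹ j i * ∑ σ, G u i σ * christoffel b G u σ j γ := by
      intro i j
      rw [fderiv_metric_eq_christoffel hs hdet, Finset.sum_add_distrib,
        inv_symm_of_symm hs.self_of_nhds j i]
      ring
    simp only [h2, Finset.sum_add_distrib]
    rw [Finset.sum_comm (f := fun i j => (G u)⁻¹ j i * ∑ σ, G u i σ * christoffel b G u σ j γ)]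
    simp only [sum_inv_mul_metric_mul_christoffel hdet]
    rw [two_mul]
    simp only [christoffel_symm hs _ γ]
  rw [h1]
  ring

/-- The inverse metric is parallel for the Christoffel symbols. -/
lemma fderiv_inv_eq_christoffel (hG : ∀ i j, ContDiffAt ℝ 1 (fun y => G y i j) u)
    (hs : ∀ᶠ y in 𝓝 u, ∀ α β, G y α β = G y β α) (hdet : (G u).det ≠ 0) (α β γ : ι) :
    fderiv ℝ (fun y => (G y)⁻¹ α β) u (b γ) =
      -∑ κ, (christoffel b G u α κ γ * (G u)⁻¹ κ β + christoffel b G u β κ γ * (G u)⁻¹ κ α) := by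
  rw [fderiv_inv_apply hG hdet]
  congr 1
  have hi := inv_symm_of_symm hs.self_of_nhds
  have h2 : ∀ k l, (G u)⁻¹ α k * fderiv ℝ (fun y => G y k l) u (b γ) * (G u)⁻¹ l β =
      ((G u)⁻¹ α k * ∑ σ, G u k σ * christoffel b G u σ l γ) * (G u)⁻¹ l β
        + ((G u)⁻¹ β l * ∑ σ, G u l σ * christoffel b G u σ k γ) * (G u)⁻¹ k α := by
    intro k l
    rw [fderiv_metric_eq_christoffel hs hdet, Finset.sum_add_distrib, hi β l, hi k α]
    ring
  simp only [h2, Finset.sum_add_distrib]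
  congr 1
  · rw [Finset.sum_comm]
    simp only [← Finset.sum_mul, sum_inv_mul_metric_mul_christoffel hdet]
  · simp only [← Finset.sum_mul, sum_inv_mul_metric_mul_christoffel hdet]

lemma contDiffAt_fderiv_apply {n : ℕ∞} {f : E → ℝ} (hf : ContDiffAt ℝ ∞ f u) (v : E) :
    ContDiffAt ℝ n (fun y => fderiv ℝ f y v) u :=
  ((hf.fderiv_right (m := n) (by exact_mod_cast le_top)).clm_apply contDiffAt_const)

lemma contDiffAt_christoffel (hG : ∀ i j, ContDiffAt ℝ ∞ (fun y => G y i j) u)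
    (hdet : (G u).det ≠ 0) (τ α β : ι) :
    ContDiffAt ℝ ∞ (fun y => christoffel b G y τ α β) u := by
  unfold christoffel
  refine contDiffAt_const.mul (ContDiffAt.sum fun σ _ => ?_)
  exact (contDiffAt_inv_apply hG hdet τ σ).mul
    (((contDiffAt_fderiv_apply (n := ⊤) (hG _ _) _).add
      (contDiffAt_fderiv_apply (n := ⊤) (hG _ _) _)).sub
      (contDiffAt_fderiv_apply (n := ⊤) (hG _ _) _))

lemma fderiv_fderiv_comm {f : E → ℝ} (hf : ContDiffAt ℝ ∞ f u) (v w : E) :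
    fderiv ℝ (fun y => fderiv ℝ f y v) u w = fderiv ℝ (fun y => fderiv ℝ f y w) u v := by
  have hd : DifferentiableAt ℝ (fderiv ℝ f) u :=
    (hf.fderiv_right (m := 1)
      (le_of_eq_of_le one_add_one_eq_two ENat.LEInfty.out)).differentiableAt (by simp)
  have h1 : ∀ a c : E, fderiv ℝ (fun y => fderiv ℝ f y a) u c = fderiv ℝ (fderiv ℝ f) u c a := by
    intro a c
    rw [fderiv_clm_apply hd (differentiableAt_const a)]
    simp
  rw [h1, h1]
  exact (hf.of_le ENat.LEInfty.out).isSymmSndFDerivAt (n := 2) (by simp) w v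

/-- The Ricci tensor of the Levi-Civita connection is symmetric: the contraction `Γ^τ_{ατ}` is the
gradient of `log √|g|`. -/
lemma coordRicci_christoffel_symm
    (hG : ∀ᶠ y in 𝓝 u, ∀ i j, ContDiffAt ℝ ∞ (fun y => G y i j) y)
    (hs : ∀ᶠ y in 𝓝 u, ∀ α β, G y α β = G y β α) (hdet : (G u).det ≠ 0) (α β : ι) :
    coordRicci b (christoffel b G) u α β = coordRicci b (christoffel b G) u β α := by
  have hG0 := hG.self_of_nhds
  have hΓd : ∀ τ α β, DifferentiableAt ℝ (fun y => christoffel b G y τ α β) u := fun τ α β =>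
    (contDiffAt_christoffel hG0 hdet τ α β).differentiableAt (by simp)
  have hdet' : ∀ᶠ y in 𝓝 u, (G y).det ≠ 0 :=
    (continuousAt_det fun i j => (hG0 i j).continuousAt).eventually_ne hdet
  have hlog : ∀ γ, (fun y => ∑ τ, christoffel b G y τ γ τ) =ᶠ[𝓝 u]
      fun y => fderiv ℝ (fun y => Real.log √|(G y).det|) y (b γ) := by
    intro γ
    filter_upwards [hG, hs.eventually_nhds, hdet'] with y h1 h2 h3
    have hpos : √|(G y).det| ≠ 0 := (Real.sqrt_pos.2 (abs_pos.2 h3)).ne'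
    rw [fderiv.log ((contDiffAt_sqrt_abs_det (n := ⊤) h1 h3).differentiableAt (by simp)) hpos,
      FunLike.coe_smul, Pi.smul_apply,
      fderiv_sqrt_abs_det_eq_christoffel (fun i j => (h1 i j).of_le (by exact_mod_cast le_top))
        h2 h3, smul_eq_mul, inv_mul_cancel_left₀ hpos]
  have hlogs : ContDiffAt ℝ ∞ (fun y => Real.log √|(G y).det|) u :=
    (contDiffAt_sqrt_abs_det (n := ⊤) hG0 hdet).log (Real.sqrt_pos.2 (abs_pos.2 hdet)).ne'
  -- the only term of the Ricci tensor that is not manifestly symmetric is a Hessian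
  have htr : ∀ γ δ, ∑ τ, fderiv ℝ (fun y => christoffel b G y τ γ τ) u (b δ) =
      fderiv ℝ (fun y => fderiv ℝ (fun y => Real.log √|(G y).det|) y (b γ)) u (b δ) := by
    intro γ δ
    rw [← (hlog γ).fderiv_eq, fderiv_fun_sum fun τ _ => hΓd τ γ τ]
    simp
  have hsymm : ∀ᶠ y in 𝓝 u, ∀ τ α β, christoffel b G y τ α β = christoffel b G y τ β α :=
    hs.eventually_nhds.mono fun y hy τ α β => christoffel_symm hy τ α β
  have h1 : ∀ τ, fderiv ℝ (fun y => christoffel b G y τ α β) u =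
      fderiv ℝ (fun y => christoffel b G y τ β α) u := fun τ =>
    Filter.EventuallyEq.fderiv_eq (hsymm.mono fun y hy => hy τ α β)
  unfold coordRicci
  simp only [Finset.sum_add_distrib, Finset.sum_sub_distrib]
  rw [htr, htr, fderiv_fderiv_comm hlogs (b α) (b β)]
  congr 1
  · simp only [h1]
  · congr 1
    · simp only [hsymm.self_of_nhds _ α β]
    · rw [Finset.sum_comm]
      refine Finset.sum_congr rfl fun τ _ => Finset.sum_congr rfl fun κ _ => ?_
      rw [hsymm.self_of_nhds κ τ β, hsymm.self_of_nhds τ α κ, hsymm.self_of_nhds κ β τ,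
        hsymm.self_of_nhds τ κ α, mul_comm]

end Coordinates

/-! ### Families of functions depending smoothly on a parameter -/

section Joint

variable {E : Type*} [NormedAddCommGroup E] [NormedSpace ℝ E] {f : ℝ → E → ℝ} {t : ℝ} {u : E}

lemma contDiffAt_partial_fderiv (hf : ContDiffAt ℝ ∞ (fun z : ℝ × E => f z.1 z.2) (t, u)) (v : E) :
    ContDiffAt ℝ ∞ (fun z : ℝ × E => fderiv ℝ (f z.1) z.2 v) (t, u) := by
  have h := ContDiffAt.fderiv (𝕜 := ℝ) (n := ∞) (m := ∞) (x₀ := ((t, u) : ℝ × E))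
    (f := fun z y => f z.1 y) (g := Prod.snd)
    (ContDiffAt.comp (g := fun z : ℝ × E => f z.1 z.2) (((t, u), u) : (ℝ × E) × E) hf
      ((contDiffAt_fst.fst).prodMk contDiffAt_snd)) contDiffAt_snd le_rfl
  exact h.clm_apply contDiffAt_const

lemma contDiffAt_partial_deriv (hf : ContDiffAt ℝ ∞ (fun z : ℝ × E => f z.1 z.2) (t, u)) :
    ContDiffAt ℝ ∞ (fun z : ℝ × E => deriv (fun s => f s z.2) z.1) (t, u) := by
  have h := ContDiffAt.fderiv (𝕜 := ℝ) (n := ∞) (m := ∞) (x₀ := ((t, u) : ℝ × E))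
    (f := fun z s => f s z.2) (g := Prod.fst)
    (ContDiffAt.comp (g := fun z : ℝ × E => f z.1 z.2) (((t, u), t) : (ℝ × E) × ℝ) hf
      (contDiffAt_snd.prodMk contDiffAt_fst.snd)) contDiffAt_fst le_rfl
  exact h.clm_apply contDiffAt_const

lemma contDiffAt_slice_right (hf : ContDiffAt ℝ ∞ (fun z : ℝ × E => f z.1 z.2) (t, u)) :
    ContDiffAt ℝ ∞ (f t) u :=
  ContDiffAt.comp (g := fun z : ℝ × E => f z.1 z.2) u hf (contDiffAt_const.prodMk contDiffAt_id)

lemma contDiffAt_slice_left (hf : ContDiffAt ℝ ∞ (fun z : ℝ × E => f z.1 z.2) (t, u)) :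
    ContDiffAt ℝ ∞ (fun s => f s u) t :=
  ContDiffAt.comp (g := fun z : ℝ × E => f z.1 z.2) t hf (contDiffAt_id.prodMk contDiffAt_const)

lemma fderiv_slice_right {F : ℝ × E → ℝ} (hF : DifferentiableAt ℝ F (t, u)) (v : E) :
    fderiv ℝ (fun y => F (t, y)) u v = fderiv ℝ F (t, u) (0, v) := by
  have h := hF.hasFDerivAt.comp u ((hasFDerivAt_const t u).prodMk (hasFDerivAt_id u))
  have h2 : fderiv ℝ (fun y => F (t, y)) u = _ := h.fderiv
  rw [h2]
  simp

lemma deriv_slice_left {F : ℝ × E → ℝ} (hF : DifferentiableAt ℝ F (t, u)) :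
    deriv (fun s => F (s, u)) t = fderiv ℝ F (t, u) (1, 0) := by
  have h := hF.hasFDerivAt.comp_hasDerivAt t ((hasDerivAt_id t).prodMk (hasDerivAt_const t u))
  have h2 : deriv (fun s => F (s, u)) t = _ := h.deriv
  rw [h2]

lemma deriv_fderiv_comm (hf : ContDiffAt ℝ ∞ (fun z : ℝ × E => f z.1 z.2) (t, u)) (v : E) :
    deriv (fun s => fderiv ℝ (f s) u v) t = fderiv ℝ (fun y => deriv (fun s => f s y) t) u v := by
  set F : ℝ × E → ℝ := fun z => f z.1 z.2 with hF
  have hd : ∀ᶠ z in 𝓝 (t, u), DifferentiableAt ℝ F z :=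
    ((hf.of_le (m := 1) ENat.LEInfty.out).eventually (by simp)).mono fun z hz =>
      hz.differentiableAt (by simp)
  have c1 : Filter.Tendsto (fun s : ℝ => (s, u)) (𝓝 t) (𝓝 (t, u)) :=
    (Continuous.prodMk_left u).continuousAt
  have c2 : Filter.Tendsto (fun y : E => (t, y)) (𝓝 u) (𝓝 (t, u)) :=
    (Continuous.prodMk_right t).continuousAt
  have h1 : (fun s => fderiv ℝ (f s) u v) =ᶠ[𝓝 t] fun s => fderiv ℝ F (s, u) (0, v) :=
    (c1.eventually hd).mono fun s hs => fderiv_slice_right hs v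
  have h2 : (fun y => deriv (fun s => f s y) t) =ᶠ[𝓝 u] fun y => fderiv ℝ F (t, y) (1, 0) :=
    (c2.eventually hd).mono fun y hy => deriv_slice_left hy
  have hs : ∀ w, DifferentiableAt ℝ (fun z => fderiv ℝ F z w) (t, u) := fun w =>
    (contDiffAt_fderiv_apply (n := ⊤) hf w).differentiableAt (by simp)
  rw [h1.deriv_eq, h2.fderiv_eq, deriv_slice_left (hs _), fderiv_slice_right (hs _),
    fderiv_fderiv_comm hf]

end Joint

/-! ### Differentiation of integrals and the divergence theorem -/

section Integrals

variable {E : Type*} [NormedAddCommGroup E] [NormedSpace ℝ E] [MeasurableSpace E]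
  [BorelSpace E] {μ : Measure E} {U K : Set E}

/-- Differentiation under the integral over a compact set. -/
lemma hasDerivAt_setIntegral_of_contDiffAt [IsFiniteMeasureOnCompacts μ] {f : ℝ → E → ℝ}
    (hK : IsCompact K) (hKU : K ⊆ U)
    (hf : ∀ t, ∀ u ∈ U, ContDiffAt ℝ ∞ (fun z : ℝ × E => f z.1 z.2) (t, u)) :
    HasDerivAt (fun t => ∫ u in K, f t u ∂μ) (∫ u in K, deriv (fun t => f t u) 0 ∂μ) 0 := by
  have hc : ∀ t, ContinuousOn (f t) K := fun t u hu =>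
    (contDiffAt_slice_right (hf t u (hKU hu))).continuousAt.continuousWithinAt
  have hc' : ContinuousOn (fun z : ℝ × E => deriv (fun s => f s z.2) z.1)
      (Set.Icc (-1) 1 ×ˢ K) := fun z hz =>
    (contDiffAt_partial_deriv (hf z.1 z.2 (hKU hz.2))).continuousAt.continuousWithinAt
  obtain ⟨C, hC⟩ := (isCompact_Icc.prod hK).exists_bound_of_continuousOn hc'
  have hmeas : MeasurableSet K := hK.measurableSet
  have hc0 : ContinuousOn (fun u => deriv (fun s => f s u) 0) K :=
    hc'.comp (f := fun u => ((0 : ℝ), u)) (by fun_prop) fun u hu => ⟨by simp, hu⟩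
  refine (hasDerivAt_integral_of_dominated_loc_of_deriv_le (μ := μ.restrict K)
    (F := f) (F' := fun t u => deriv (fun s => f s u) t) (bound := fun _ => C)
    (Icc_mem_nhds (a := (-1 : ℝ)) (b := 1) (by norm_num) (by norm_num)) ?_ ?_ ?_ ?_ ?_ ?_).2
  · exact Filter.Eventually.of_forall fun t => ((hc t).integrableOn_compact hK).1
  · exact (hc 0).integrableOn_compact hK
  · exact (hc0.integrableOn_compact hK).1
  · refine (ae_restrict_iff' hmeas).2 (Filter.Eventually.of_forall fun u hu t ht => ?_)
    exact hC (t, u) ⟨ht, hu⟩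
  · exact (continuousOn_const (c := C)).integrableOn_compact hK
  · refine (ae_restrict_iff' hmeas).2 (Filter.Eventually.of_forall fun u hu t _ => ?_)
    exact ((contDiffAt_slice_left (hf t u (hKU hu))).differentiableAt (by simp)).hasDerivAt

/-- The divergence theorem for a function supported in a compact set. -/
lemma setIntegral_fderiv_eq_zero [FiniteDimensional ℝ E] [μ.IsAddHaarMeasure] {f : E → ℝ}
    (hU : IsOpen U) (hK : IsCompact K)
    (hKU : K ⊆ U) (hf : ∀ u ∈ U, ContDiffAt ℝ ∞ f u) (h0 : ∀ u ∈ U, u ∉ K → f u = 0) (v : E) :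
    ∫ u in K, fderiv ℝ f u v ∂μ = 0 := by
  classical
  -- extended by zero, `f` becomes a smooth function with compact support on the whole space
  set w : E → ℝ := K.indicator f with hw
  have hwf : ∀ u ∈ U, w =ᶠ[𝓝 u] f := fun u hu => by
    filter_upwards [hU.mem_nhds hu] with y hy
    by_cases hyK : y ∈ K
    · rw [hw, Set.indicator_of_mem hyK]
    · rw [hw, Set.indicator_of_notMem hyK, h0 y hy hyK]
  have hw0 : ∀ u ∉ K, w =ᶠ[𝓝 u] fun _ => 0 := fun u hu => by
    filter_upwards [hK.isClosed.isOpen_compl.mem_nhds hu] with y hy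
    exact Set.indicator_of_notMem hy f
  have hws : ContDiff ℝ ∞ w := contDiff_iff_contDiffAt.2 fun u => by
    by_cases hu : u ∈ K
    · exact (hf u (hKU hu)).congr_of_eventuallyEq (hwf u (hKU hu))
    · exact contDiffAt_const.congr_of_eventuallyEq (hw0 u hu)
  have hwc : HasCompactSupport w := HasCompactSupport.intro hK fun u hu =>
    Set.indicator_of_notMem hu f
  have hdc : Continuous fun u => fderiv ℝ w u v :=
    (hws.continuous_fderiv (by simp)).clm_apply continuous_const
  have hds : HasCompactSupport fun u => fderiv ℝ w u v :=
    HasCompactSupport.intro hK fun u hu => by rw [(hw0 u hu).fderiv_eq]; simp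
  have h1 : ∫ u in K, fderiv ℝ f u v ∂μ = ∫ u in K, fderiv ℝ w u v ∂μ :=
    setIntegral_congr_fun hK.measurableSet fun u hu => by
      simp only [(hwf u (hKU hu)).fderiv_eq]
  have h2 : ∫ u in K, fderiv ℝ w u v ∂μ = ∫ u, fderiv ℝ w u v ∂μ :=
    setIntegral_eq_integral_of_forall_compl_eq_zero fun u hu => by
      rw [(hw0 u hu).fderiv_eq]; simp
  -- integrate by parts against the constant function `1`
  have h3 := integral_mul_fderiv_eq_neg_fderiv_mul_of_integrable (μ := μ)
    (f := fun _ : E => (1 : ℝ)) (g := w) (v := v) (by simp)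
    (by simpa using hdc.integrable_of_hasCompactSupport hds)
    (by simpa using hws.continuous.integrable_of_hasCompactSupport hwc)
    (fun x _ => differentiableAt_const 1) (fun x _ => hws.differentiable (by simp) x)
  rw [h1, h2]
  simpa using h3

end Integrals

/-! ### The first variation of the Hilbert action in coordinates -/

section Hilbert

variable {ι : Type*} [Fintype ι] {E : Type*} [NormedAddCommGroup E] [NormedSpace ℝ E] {b : ι → E}

lemma contDiffAt_coordRicci_joint {Γ : ℝ → E → ι → ι → ι → ℝ} {t : ℝ} {u : E}
    (hΓ : ∀ τ α β, ContDiffAt ℝ ∞ (fun z : ℝ × E => Γ z.1 z.2 τ α β) (t, u)) (α β : ι) :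
    ContDiffAt ℝ ∞ (fun z : ℝ × E => coordRicci b (Γ z.1) z.2 α β) (t, u) := by
  unfold coordRicci
  have h : ∀ i j k v, ContDiffAt ℝ ∞
      (fun z : ℝ × E => fderiv ℝ (fun y => Γ z.1 y i j k) z.2 v) (t, u) := fun i j k v =>
    contDiffAt_partial_fderiv (f := fun s y => Γ s y i j k) (hΓ i j k) v
  exact ContDiffAt.sum fun τ _ => ((h _ _ _ _).sub (h _ _ _ _)).add (ContDiffAt.sum fun κ _ =>
    ((hΓ _ _ _).mul (hΓ _ _ _)).sub ((hΓ _ _ _).mul (hΓ _ _ _)))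

lemma deriv_coordRicci {Γ : ℝ → E → ι → ι → ι → ℝ} {t : ℝ} {u : E}
    (hΓ : ∀ τ α β, ContDiffAt ℝ ∞ (fun z : ℝ × E => Γ z.1 z.2 τ α β) (t, u)) (α β : ι) :
    HasDerivAt (fun s => coordRicci b (Γ s) u α β)
      (∑ τ, (fderiv ℝ (fun y => deriv (fun s => Γ s y τ α β) t) u (b τ)
        - fderiv ℝ (fun y => deriv (fun s => Γ s y τ α τ) t) u (b β)
        + ∑ κ, (deriv (fun s => Γ s u τ κ τ) t * Γ t u κ α β
          + Γ t u τ κ τ * deriv (fun s => Γ s u κ α β) t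
          - deriv (fun s => Γ s u τ κ β) t * Γ t u κ α τ
          - Γ t u τ κ β * deriv (fun s => Γ s u κ α τ) t))) t := by
  have h1 : ∀ i j k, HasDerivAt (fun s => Γ s u i j k) (deriv (fun s => Γ s u i j k) t) t :=
    fun i j k => ((contDiffAt_slice_left (f := fun s y => Γ s y i j k)
      (hΓ i j k)).differentiableAt (by simp)).hasDerivAt
  have h2 : ∀ i j k v, HasDerivAt (fun s => fderiv ℝ (fun y => Γ s y i j k) u v)
      (fderiv ℝ (fun y => deriv (fun s => Γ s y i j k) t) u v) t := fun i j k v => by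
    rw [← deriv_fderiv_comm (f := fun s y => Γ s y i j k) (hΓ i j k) v]
    exact ((contDiffAt_slice_left (f := fun s y => fderiv ℝ (fun y => Γ s y i j k) y v)
      (contDiffAt_partial_fderiv (f := fun s y => Γ s y i j k)
        (hΓ i j k) v)).differentiableAt (by simp)).hasDerivAt
  unfold coordRicci
  refine HasDerivAt.fun_sum fun τ _ => ((h2 _ _ _ _).fun_sub (h2 _ _ _ _)).fun_add
    (HasDerivAt.fun_sum fun κ _ => ?_)
  refine (((h1 _ _ _).fun_mul (h1 _ _ _)).fun_sub ((h1 _ _ _).fun_mul (h1 _ _ _))).congr_deriv ?_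
  ring

variable [DecidableEq ι]

lemma contDiffAt_christoffel_joint {G : ℝ → E → Matrix ι ι ℝ} {t : ℝ} {u : E}
    (hG : ∀ i j, ContDiffAt ℝ ∞ (fun z : ℝ × E => G z.1 z.2 i j) (t, u))
    (hdet : (G t u).det ≠ 0) (τ α β : ι) :
    ContDiffAt ℝ ∞ (fun z : ℝ × E => christoffel b (G z.1) z.2 τ α β) (t, u) := by
  unfold christoffel
  refine contDiffAt_const.mul (ContDiffAt.sum fun σ _ => ?_)
  have hi := contDiffAt_inv_apply (A := fun z : ℝ × E => G z.1 z.2) hG hdet τ σ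
  have h : ∀ i j v, ContDiffAt ℝ ∞
      (fun z : ℝ × E => fderiv ℝ (fun y => G z.1 y i j) z.2 v) (t, u) := fun i j v =>
    contDiffAt_partial_fderiv (f := fun s y => G s y i j) (hG i j) v
  exact hi.mul (((h _ _ _).add (h _ _ _)).sub (h _ _ _))

variable {G : ℝ → E → Matrix ι ι ℝ} {U K : Set E}

/-- The Lagrangian density `√|g| g^{αβ} R_{αβ}` of the metric with matrix `G`. -/
def hilbertDensity (b : ι → E) (G : E → Matrix ι ι ℝ) (u : E) : ℝ :=
  √|(G u).det| * ∑ α, ∑ β, (G u)⁻¹ α β * coordRicci b (christoffel b G) u α β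

/-- The vector density `√|g| (g^{αβ} δΓ^τ_{αβ} - g^{ατ} δΓ^σ_{ασ})`. -/
def palatiniVector (b : ι → E) (G : ℝ → E → Matrix ι ι ℝ) (τ : ι) (u : E) : ℝ :=
  √|(G 0 u).det| *
    (∑ α, ∑ β, (G 0 u)⁻¹ α β * deriv (fun s => christoffel b (G s) u τ α β) 0
      - ∑ α, (G 0 u)⁻¹ α τ * ∑ σ, deriv (fun s => christoffel b (G s) u σ α σ) 0)

lemma deriv_christoffel_contDiffAt {u : E}
    (hG : ∀ i j, ContDiffAt ℝ ∞ (fun z : ℝ × E => G z.1 z.2 i j) (0, u))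
    (hdet : (G 0 u).det ≠ 0) (τ α β : ι) :
    ContDiffAt ℝ ∞ (fun y => deriv (fun s => christoffel b (G s) y τ α β) 0) u :=
  contDiffAt_slice_right (f := fun t y => deriv (fun s => christoffel b (G s) y τ α β) t)
    (contDiffAt_partial_deriv (f := fun s y => christoffel b (G s) y τ α β)
      (contDiffAt_christoffel_joint hG hdet τ α β))

lemma contDiffAt_palatiniVector {u : E}
    (hG : ∀ i j, ContDiffAt ℝ ∞ (fun z : ℝ × E => G z.1 z.2 i j) (0, u))
    (hdet : (G 0 u).det ≠ 0) (τ : ι) : ContDiffAt ℝ ∞ (palatiniVector b G τ) u := by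
  have hG0 : ∀ i j, ContDiffAt ℝ ∞ (fun y => G 0 y i j) u := fun i j =>
    contDiffAt_slice_right (f := fun s y => G s y i j) (hG i j)
  have hz := deriv_christoffel_contDiffAt (b := b) hG hdet
  have hi := contDiffAt_inv_apply hG0 hdet
  exact (contDiffAt_sqrt_abs_det (n := ⊤) hG0 hdet).mul
    ((ContDiffAt.sum fun α _ => ContDiffAt.sum fun β _ => (hi α β).mul (hz τ α β)).sub
      (ContDiffAt.sum fun α _ => (hi α τ).mul (ContDiffAt.sum fun σ _ => hz σ α σ)))

/-- The derivative of `√|g|` in terms of the variation of the inverse metric. -/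
lemma deriv_sqrt_abs_det_eq_inv {A : ℝ → Matrix ι ι ℝ} {t : ℝ}
    (hA : ∀ i j, ContDiffAt ℝ 1 (fun s => A s i j) t)
    (hdet : (A t).det ≠ 0) :
    HasDerivAt (fun s => √|(A s).det|)
      (-(1 / 2) * √|(A t).det| * ∑ i, ∑ j, A t j i * deriv (fun s => (A s)⁻¹ i j) t) t := by
  have hd : ∀ i j, DifferentiableAt ℝ (fun s => A s i j) t := fun i j =>
    (hA i j).differentiableAt (by simp)
  have h1 := ((contDiffAt_sqrt_abs_det (n := 1) hA hdet).differentiableAt (by simp)).hasDerivAt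
  refine h1.congr_deriv ?_
  rw [← fderiv_apply_one_eq_deriv, fderiv_sqrt_abs_det_apply hd hdet]
  have h2 : ∑ i, ∑ j, A t j i * deriv (fun s => (A s)⁻¹ i j) t =
      -∑ i, ∑ j, (A t)⁻¹ i j * fderiv ℝ (fun s => A s j i) t 1 := by
    set B : Matrix ι ι ℝ := Matrix.of fun i j => fderiv ℝ (fun s => A s i j) t 1
    have h3 : (Matrix.of fun i j => deriv (fun s => (A s)⁻¹ i j) t) = -((A t)⁻¹ * B * (A t)⁻¹) := by
      ext i j
      simp only [Matrix.of_apply, Matrix.neg_apply, Matrix.mul_apply, Finset.sum_mul, B]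
      rw [← fderiv_apply_one_eq_deriv, fderiv_inv_apply hA hdet, Finset.sum_comm]
    have h4 : ∑ i, ∑ j, A t j i * deriv (fun s => (A s)⁻¹ i j) t =
        (A t * Matrix.of fun i j => deriv (fun s => (A s)⁻¹ i j) t).trace := by
      simp only [Matrix.trace, Matrix.diag, Matrix.mul_apply, Matrix.of_apply]
      exact Finset.sum_comm
    have h5 : ∑ i, ∑ j, (A t)⁻¹ i j * fderiv ℝ (fun s => A s j i) t 1 = ((A t)⁻¹ * B).trace := by
      simp only [Matrix.trace, Matrix.diag, Matrix.mul_apply, Matrix.of_apply, B]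
    rw [h4, h5, h3, mul_neg, Matrix.trace_neg, ← mul_assoc, ← mul_assoc,
      Matrix.mul_nonsing_inv _ (isUnit_iff_ne_zero.2 hdet), one_mul, Matrix.trace_mul_comm]
  rw [h2]
  ring

/-- The first variation of the Hilbert density: the Einstein tensor contracted with the variation of
the inverse metric, plus the divergence of the Palatini vector. -/
lemma deriv_hilbertDensity {u : E}
    (hG : ∀ i j, ContDiffAt ℝ ∞ (fun z : ℝ × E => G z.1 z.2 i j) (0, u))
    (hs : ∀ᶠ y in 𝓝 u, ∀ t α β, G t y α β = G t y β α) (hdet : (G 0 u).det ≠ 0) :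
    deriv (fun t => hilbertDensity b (G t) u) 0 =
      √|(G 0 u).det| * (∑ α, ∑ β, (coordRicci b (christoffel b (G 0)) u α β
        - 1 / 2 * (∑ μ, ∑ ν, (G 0 u)⁻¹ μ ν * coordRicci b (christoffel b (G 0)) u μ ν) * G 0 u α β)
          * deriv (fun t => (G t u)⁻¹ α β) 0)
      + ∑ τ, fderiv ℝ (palatiniVector b G τ) u (b τ) := by
  have hsu := hs.self_of_nhds
  have hGt : ∀ i j, ContDiffAt ℝ ∞ (fun t => G t u i j) 0 := fun i j =>
    contDiffAt_slice_left (f := fun s y => G s y i j) (hG i j)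
  have hG0 : ∀ i j, ContDiffAt ℝ ∞ (fun y => G 0 y i j) u := fun i j =>
    contDiffAt_slice_right (f := fun s y => G s y i j) (hG i j)
  have hG1 : ∀ i j, ContDiffAt ℝ 1 (fun y => G 0 y i j) u := fun i j =>
    (hG0 i j).of_le ENat.LEInfty.out
  have hs0 : ∀ᶠ y in 𝓝 u, ∀ α β, G 0 y α β = G 0 y β α := hs.mono fun y h => h 0
  have hΓ := contDiffAt_christoffel_joint (b := b) hG hdet
  have hz := deriv_christoffel_contDiffAt (b := b) hG hdet
  have hzd : ∀ τ α β, DifferentiableAt ℝ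
      (fun y => deriv (fun s => christoffel b (G s) y τ α β) 0) u := fun τ α β =>
    (hz τ α β).differentiableAt (by simp)
  have hid : ∀ α β, DifferentiableAt ℝ (fun y => (G 0 y)⁻¹ α β) u := fun α β =>
    (contDiffAt_inv_apply hG0 hdet α β).differentiableAt (by simp)
  have hsd : DifferentiableAt ℝ (fun y => √|(G 0 y).det|) u :=
    (contDiffAt_sqrt_abs_det (n := ⊤) hG0 hdet).differentiableAt (by simp)
  have d1 := deriv_sqrt_abs_det_eq_inv (A := fun t => G t u)
    (fun i j => (hGt i j).of_le ENat.LEInfty.out) hdet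
  have d2 : ∀ α β, HasDerivAt (fun t => (G t u)⁻¹ α β) (deriv (fun t => (G t u)⁻¹ α β) 0) 0 :=
    fun α β => ((contDiffAt_inv_apply (A := fun t => G t u) hGt hdet α β).differentiableAt
      (by simp)).hasDerivAt
  have d3 := fun α β => deriv_coordRicci (b := b) (Γ := fun s y => christoffel b (G s) y) hΓ α β
  have d4 := d1.fun_mul (HasDerivAt.fun_sum (u := Finset.univ) fun α _ =>
    HasDerivAt.fun_sum (u := Finset.univ) fun β _ => (d2 α β).fun_mul (d3 α β))
  have d5 : deriv (fun t => hilbertDensity b (G t) u) 0 = _ := d4.deriv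
  rw [d5]
  -- the divergence of the Palatini vector, expanded by the product rule
  have hV : ∀ τ, fderiv ℝ (palatiniVector b G τ) u (b τ) =
      fderiv ℝ (fun y => √|(G 0 y).det|) u (b τ) *
        (∑ α, ∑ β, (G 0 u)⁻¹ α β * deriv (fun s => christoffel b (G s) u τ α β) 0
          - ∑ α, (G 0 u)⁻¹ α τ * ∑ σ, deriv (fun s => christoffel b (G s) u σ α σ) 0)
      + √|(G 0 u).det| *
        (∑ α, ∑ β, (fderiv ℝ (fun y => (G 0 y)⁻¹ α β) u (b τ) *
            deriv (fun s => christoffel b (G s) u τ α β) 0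
          + (G 0 u)⁻¹ α β *
            fderiv ℝ (fun y => deriv (fun s => christoffel b (G s) y τ α β) 0) u (b τ))
        - ∑ α, (fderiv ℝ (fun y => (G 0 y)⁻¹ α τ) u (b τ) *
            ∑ σ, deriv (fun s => christoffel b (G s) u σ α σ) 0
          + (G 0 u)⁻¹ α τ *
            ∑ σ, fderiv ℝ (fun y => deriv (fun s => christoffel b (G s) y σ α σ) 0) u (b τ))) := by
    intro τ
    have f1 := HasFDerivAt.fun_sum (u := Finset.univ) fun α _ =>
      HasFDerivAt.fun_sum (u := Finset.univ) fun β _ =>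
        (hid α β).hasFDerivAt.fun_mul (hzd τ α β).hasFDerivAt
    have f2 := HasFDerivAt.fun_sum (u := Finset.univ) fun α _ =>
      (hid α τ).hasFDerivAt.fun_mul (HasFDerivAt.fun_sum (u := Finset.univ) fun σ _ =>
        (hzd σ α σ).hasFDerivAt)
    have f3 := hsd.hasFDerivAt.fun_mul (f1.fun_sub f2)
    have f4 : fderiv ℝ (palatiniVector b G τ) u = _ := f3.fderiv
    rw [f4]
    simp only [FunLike.coe_add, FunLike.coe_smul, FunLike.coe_sub, FunLike.coe_sum, Pi.add_apply,
      Pi.sub_apply, Pi.smul_apply, Finset.sum_apply, smul_eq_mul]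
    rw [add_comm]
    congr 1
    · ring
    · congr 1
      congr 1
      · exact Finset.sum_congr rfl fun α _ => Finset.sum_congr rfl fun β _ => by ring
      · exact Finset.sum_congr rfl fun α _ => by ring
  have hpal := palatini_algebra √|(G 0 u).det| (G 0 u)⁻¹ (christoffel b (G 0) u)
    (fun τ α β => deriv (fun s => christoffel b (G s) u τ α β) 0)
    (fun σ τ α β => fderiv ℝ (fun y => deriv (fun s => christoffel b (G s) y τ α β) 0) u (b σ))
    (fun σ => fderiv ℝ (fun y => √|(G 0 y).det|) u (b σ))
    (fun σ α β => fderiv ℝ (fun y => (G 0 y)⁻¹ α β) u (b σ))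
    (inv_symm_of_symm (hsu 0)) (fun τ α β => christoffel_symm hs0 τ α β)
    (fun τ α β => by
      congr 1
      funext s
      exact christoffel_symm (hs.mono fun y h => h s) τ α β)
    (fun σ => fderiv_sqrt_abs_det_eq_christoffel hG1 hs0 hdet σ)
    (fun σ α β => fderiv_inv_eq_christoffel (b := b) hG1 hs0 hdet α β σ)
  rw [Finset.sum_congr rfl fun τ _ => hV τ, hpal]
  set R : ι → ι → ℝ := coordRicci b (christoffel b (G 0)) u with hR
  set S : ℝ := ∑ μ, ∑ ν, (G 0 u)⁻¹ μ ν * R μ ν with hS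
  have hA : ∑ α, ∑ β, (R α β - 1 / 2 * S * G 0 u α β) * deriv (fun t => (G t u)⁻¹ α β) 0 =
      (∑ α, ∑ β, deriv (fun t => (G t u)⁻¹ α β) 0 * R α β)
        - 1 / 2 * S * ∑ α, ∑ β, G 0 u β α * deriv (fun t => (G t u)⁻¹ α β) 0 := by
    simp only [Finset.mul_sum, ← Finset.sum_sub_distrib]
    refine Finset.sum_congr rfl fun α _ => Finset.sum_congr rfl fun β _ => ?_
    rw [hsu 0 β α]
    ring
  rw [hA]
  simp only [Finset.sum_add_distrib]
  ring

/-- **First variation of the Hilbert action.** For a family of metrics that is fixed outside a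
compact subset `K` of the coordinate domain `U`, the divergence of the Palatini vector integrates
to zero. -/
theorem hasDerivAt_integral_hilbertDensity [FiniteDimensional ℝ E] [MeasurableSpace E]
    [BorelSpace E] {μ : Measure E} [μ.IsAddHaarMeasure] (hU : IsOpen U) (hK : IsCompact K)
    (hKU : K ⊆ U)
    (hG : ∀ t, ∀ u ∈ U, ∀ i j, ContDiffAt ℝ ∞ (fun z : ℝ × E => G z.1 z.2 i j) (t, u))
    (hs : ∀ u ∈ U, ∀ t α β, G t u α β = G t u β α) (hdet : ∀ t, ∀ u ∈ U, (G t u).det ≠ 0)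
    (hGK : ∀ t, ∀ u ∈ U, u ∉ K → G t u = G 0 u) :
    HasDerivAt (fun t => ∫ u in K, hilbertDensity b (G t) u ∂μ)
      (∫ u in K, √|(G 0 u).det| * (∑ α, ∑ β, (coordRicci b (christoffel b (G 0)) u α β
        - 1 / 2 * (∑ μ, ∑ ν, (G 0 u)⁻¹ μ ν * coordRicci b (christoffel b (G 0)) u μ ν) * G 0 u α β)
          * deriv (fun t => (G t u)⁻¹ α β) 0) ∂μ) 0 := by
  have hcd : ∀ t, ∀ u ∈ U,
      ContDiffAt ℝ ∞ (fun z : ℝ × E => hilbertDensity b (G z.1) z.2) (t, u) := by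
    intro t u hu
    exact (contDiffAt_sqrt_abs_det (n := ⊤) (A := fun z : ℝ × E => G z.1 z.2) (hG t u hu)
      (hdet t u hu)).mul (ContDiffAt.sum fun α _ => ContDiffAt.sum fun β _ =>
        (contDiffAt_inv_apply (A := fun z : ℝ × E => G z.1 z.2) (hG t u hu) (hdet t u hu) α β).mul
        (contDiffAt_coordRicci_joint (Γ := fun s y => christoffel b (G s) y)
          (contDiffAt_christoffel_joint (hG t u hu) (hdet t u hu)) α β))
  have hVc : ∀ τ, ∀ u ∈ U, ContDiffAt ℝ ∞ (palatiniVector b G τ) u := fun τ u hu =>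
    contDiffAt_palatiniVector (hG 0 u hu) (hdet 0 u hu) τ
  -- off `K` the metric does not vary, on a neighbourhood since `K` is closed
  have hV0 : ∀ τ, ∀ u ∈ U, u ∉ K → palatiniVector b G τ u = 0 := by
    intro τ u hu huK
    have hev : ∀ᶠ y in 𝓝 u, y ∈ U ∧ y ∉ K :=
      Filter.Eventually.and (hU.mem_nhds hu) (hK.isClosed.isOpen_compl.mem_nhds huK)
    have hz : ∀ τ α β, deriv (fun s => christoffel b (G s) u τ α β) 0 = 0 := by
      intro τ α β
      have : (fun s => christoffel b (G s) u τ α β) = fun _ => christoffel b (G 0) u τ α β := by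
        funext s
        have h1 : ∀ i j, fderiv ℝ (fun y => G s y i j) u = fderiv ℝ (fun y => G 0 y i j) u :=
          fun i j => Filter.EventuallyEq.fderiv_eq (hev.mono fun y hy => by
            change G s y i j = G 0 y i j
            rw [hGK s y hy.1 hy.2])
        simp only [christoffel, h1, hGK s u hu huK]
      rw [this, deriv_const]
    simp [palatiniVector, hz]
  have hdiv : ∀ τ, ∫ u in K, fderiv ℝ (palatiniVector b G τ) u (b τ) ∂μ = 0 := fun τ =>
    setIntegral_fderiv_eq_zero hU hK hKU (hVc τ) (hV0 τ) (b τ)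
  have hVi : ∀ τ, IntegrableOn (fun u => fderiv ℝ (palatiniVector b G τ) u (b τ)) K μ :=
    fun τ => ContinuousOn.integrableOn_compact hK (fun u hu =>
      (contDiffAt_fderiv_apply (n := ⊤) (hVc τ u (hKU hu))
        (b τ)).continuousAt.continuousWithinAt)
  have hdi : IntegrableOn (fun u => deriv (fun t => hilbertDensity b (G t) u) 0) K μ :=
    ContinuousOn.integrableOn_compact hK (fun u hu =>
      (contDiffAt_slice_right (f := fun t y => deriv (fun s => hilbertDensity b (G s) y) t)
        (contDiffAt_partial_deriv (f := fun s y => hilbertDensity b (G s) y)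
          (hcd 0 u (hKU hu)))).continuousAt.continuousWithinAt)
  refine (hasDerivAt_setIntegral_of_contDiffAt (f := fun t u => hilbertDensity b (G t) u) hK hKU
    hcd).congr_deriv ?_
  have h1 : ∫ u in K, ∑ τ, fderiv ℝ (palatiniVector b G τ) u (b τ) ∂μ = 0 := by
    rw [integral_finsetSum _ fun τ _ => hVi τ]
    exact Finset.sum_eq_zero fun τ _ => hdiv τ
  have h3 := integral_sub hdi (integrable_finsetSum Finset.univ fun τ _ => hVi τ)
  rw [h1, sub_zero] at h3
  rw [← h3]
  refine setIntegral_congr_fun hK.measurableSet fun u hu => ?_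
  have h2 := deriv_hilbertDensity (b := b) (hG 0 u (hKU hu))
    (Filter.mem_of_superset (hU.mem_nhds (hKU hu)) hs) (hdet 0 u (hKU hu))
  simp only [h2]
  ring

end Hilbert

/-! ### Coordinate frames on the phase space -/

/-- The topology of the total space of the tangent bundle, as a local shortcut instance, since it is
found by the general search only after long detours. -/
@[reducible] def topologicalSpacePhase (m : ℕ) (V : Type*) [TopologicalSpace V]
    [ChartedSpace (EuclideanSpace ℝ (Fin m)) V] [IsManifold (𝓡 m) ∞ V] :
    TopologicalSpace (Phase m V) := instTopologicalSpaceTangentBundle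

attribute [local instance] topologicalSpacePhase

section Fields

variable {m : ℕ} {V : Type*} [TopologicalSpace V] [ChartedSpace (EuclideanSpace ℝ (Fin m)) V]
  [IsManifold (𝓡 m) ∞ V]

lemma SmoothFieldAt.diffFieldAt {X : VField m V} {p : Phase m V} (h : SmoothFieldAt X p) :
    DiffFieldAt X p := ContMDiffAt.mdifferentiableAt h (by simp)

/-- The components of a tangent vector in the chart of `TV` around `p₀`. -/
def coordCoef (p₀ : Phase m V) (α : Fin m ⊕ Fin m) (p : Phase m V) :
    TangentSpace (𝓡 m).tangent p →ₗ[ℝ] ℝ :=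
  (trivializationAt (Model m) (TangentSpace (𝓡 m).tangent : Phase m V → Type _) p₀).localFrameCoeff
    (𝓡 m).tangent (modelBasis m) α p

/-- The domain of the chart of `TV` around `p₀`. -/
def chartDomain (p₀ : Phase m V) : Set (Phase m V) := (extChartAt (𝓡 m).tangent p₀).source

lemma chartDomain_eq (p₀ : Phase m V) : chartDomain p₀ = (trivializationAt (Model m)
    (TangentSpace (𝓡 m).tangent : Phase m V → Type _) p₀).baseSet := by
  rw [chartDomain, extChartAt_source, TangentBundle.trivializationAt_baseSet]

lemma isOpen_chartDomain (p₀ : Phase m V) : IsOpen (chartDomain p₀) := isOpen_extChartAt_source p₀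

lemma mem_chartDomain (p₀ : Phase m V) : p₀ ∈ chartDomain p₀ := mem_extChartAt_source p₀

variable {p₀ p : Phase m V}

lemma coordVec_eq_localFrame (hp : p ∈ chartDomain p₀) (α : Fin m ⊕ Fin m) :
    coordVec p₀ α p = (trivializationAt (Model m)
      (TangentSpace (𝓡 m).tangent : Phase m V → Type _) p₀).localFrame (modelBasis m) α p := by
  rw [chartDomain_eq] at hp
  rw [Bundle.Trivialization.localFrame_apply_of_mem_baseSet _ _ hp]
  simp [coordVec, Bundle.Trivialization.basisAt]

lemma smoothFieldAt_coordVec (hp : p ∈ chartDomain p₀) (α : Fin m ⊕ Fin m) :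
    SmoothFieldAt (coordVec p₀ α) p := by
  have hp' := hp
  rw [chartDomain_eq] at hp'
  refine ContMDiffAt.congr_of_eventuallyEq (contMDiffAt_localFrame_of_mem (I := (𝓡 m).tangent) ∞
    (trivializationAt (Model m) (TangentSpace (𝓡 m).tangent : Phase m V → Type _) p₀)
    (modelBasis m) α hp') ?_
  filter_upwards [(isOpen_chartDomain p₀).mem_nhds hp] with q hq
  rw [coordVec_eq_localFrame hq]

lemma eq_sum_coordCoef (hp : p ∈ chartDomain p₀) (X : TangentSpace (𝓡 m).tangent p) :
    X = ∑ α, coordCoef p₀ α p X • coordVec p₀ α p := by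
  classical
  simp only [coordVec_eq_localFrame hp]
  rw [chartDomain_eq] at hp
  have h := Bundle.Trivialization.eq_sum_localFrameCoeff_smul (I := (𝓡 m).tangent)
    (b := modelBasis m) (s := fun q => if h : q = p then h ▸ X else 0) hp
  simp only [dite_true] at h
  exact h

lemma coordCoef_coordVec (hp : p ∈ chartDomain p₀) (α β : Fin m ⊕ Fin m) :
    coordCoef p₀ α p (coordVec p₀ β p) = if α = β then 1 else 0 := by
  rw [coordVec_eq_localFrame hp]
  rw [chartDomain_eq] at hp
  rw [coordCoef,
    Bundle.Trivialization.localFrameCoeff_apply_of_mem_baseSet _ _ hp,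
    Bundle.Trivialization.localFrame_apply_of_mem_baseSet _ _ hp]
  simp [Finsupp.single_apply, eq_comm]

lemma contMDiffAt_coordCoef {X : VField m V} (hp : p ∈ chartDomain p₀) (hX : SmoothFieldAt X p)
    (α : Fin m ⊕ Fin m) :
    ContMDiffAt (𝓡 m).tangent 𝓘(ℝ, ℝ) ∞ (fun q => coordCoef p₀ α q (X q)) p := by
  rw [chartDomain_eq] at hp
  exact contMDiffAt_localFrameCoeff (modelBasis m) hp hX α

lemma mdifferentiableAt_coordCoef {X : VField m V} (hp : p ∈ chartDomain p₀) (hX : DiffFieldAt X p)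
    (α : Fin m ⊕ Fin m) :
    MDifferentiableAt (𝓡 m).tangent 𝓘(ℝ, ℝ) (fun q => coordCoef p₀ α q (X q)) p := by
  rw [chartDomain_eq] at hp
  exact mdifferentiableAt_localFrameCoeff (modelBasis m) hp hX α

lemma DiffFieldAt.add {X Y : VField m V} (hX : DiffFieldAt X p) (hY : DiffFieldAt Y p) :
    DiffFieldAt (X + Y) p := mdifferentiableAt_add_section hX hY

lemma DiffFieldAt.sub {X Y : VField m V} (hX : DiffFieldAt X p) (hY : DiffFieldAt Y p) :
    DiffFieldAt (X - Y) p := mdifferentiableAt_sub_section hX hY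

lemma DiffFieldAt.smul {f : Phase m V → ℝ} {X : VField m V}
    (hf : MDifferentiableAt (𝓡 m).tangent 𝓘(ℝ, ℝ) f p) (hX : DiffFieldAt X p) :
    DiffFieldAt (f • X) p := MDifferentiableAt.smul_section hf hX

lemma SmoothFieldAt.add {X Y : VField m V} (hX : SmoothFieldAt X p) (hY : SmoothFieldAt Y p) :
    SmoothFieldAt (X + Y) p := ContMDiffAt.add_section hX hY

lemma SmoothFieldAt.sub {X Y : VField m V} (hX : SmoothFieldAt X p) (hY : SmoothFieldAt Y p) :
    SmoothFieldAt (X - Y) p := ContMDiffAt.sub_section hX hY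

lemma SmoothFieldAt.smul {f : Phase m V → ℝ} {X : VField m V}
    (hf : ContMDiffAt (𝓡 m).tangent 𝓘(ℝ, ℝ) ∞ f p) (hX : SmoothFieldAt X p) :
    SmoothFieldAt (f • X) p := ContMDiffAt.smul_section hf hX

lemma smoothFieldAt_extendVec (v : TangentSpace (𝓡 m).tangent p) :
    SmoothFieldAt (extendVec v) p := by
  exact FiberBundle.contMDiffAt_extend (𝓡 m).tangent (Model m) v

@[simp] lemma extendVec_self (v : TangentSpace (𝓡 m).tangent p) : extendVec v p = v :=
  FiberBundle.extend_apply_self _ _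

end Fields

/-! The smoothness exponents in which Mathlib states its results on Lie brackets, read over `ℝ`.
The following lemmas serve as local instances. -/

lemma isManifold_minSmoothness_two (m : ℕ) (V : Type*) [TopologicalSpace V]
    [ChartedSpace (EuclideanSpace ℝ (Fin m)) V] [IsManifold (𝓡 m) ∞ V] :
    IsManifold (𝓡 m).tangent (minSmoothness ℝ 2) (Phase m V) := by
  rw [minSmoothness_of_isRCLikeNormedField]
  infer_instance

lemma isManifold_minSmoothness_three (m : ℕ) (V : Type*) [TopologicalSpace V]
    [ChartedSpace (EuclideanSpace ℝ (Fin m)) V] [IsManifold (𝓡 m) ∞ V] :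
    IsManifold (𝓡 m).tangent (minSmoothness ℝ 3) (Phase m V) := by
  rw [minSmoothness_of_isRCLikeNormedField]
  infer_instance

lemma isManifold_infty_add_one (m : ℕ) (V : Type*) [TopologicalSpace V]
    [ChartedSpace (EuclideanSpace ℝ (Fin m)) V] [IsManifold (𝓡 m) ∞ V] :
    IsManifold (𝓡 m).tangent (∞ + 1) (Phase m V) :=
  inferInstanceAs (IsManifold (𝓡 m).tangent ∞ (Phase m V))

attribute [local instance] isManifold_minSmoothness_two isManifold_minSmoothness_three
  isManifold_infty_add_one

/-! ### Derivatives of functions, fields and tensors -/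

section Tensors

variable {m : ℕ} {V : Type*} [TopologicalSpace V] [ChartedSpace (EuclideanSpace ℝ (Fin m)) V]
  [IsManifold (𝓡 m) ∞ V] {p₀ p : Phase m V}

lemma diffFieldAt_coordVec (hp : p ∈ chartDomain p₀) (α : Fin m ⊕ Fin m) :
    DiffFieldAt (coordVec p₀ α) p := (smoothFieldAt_coordVec hp α).diffFieldAt

lemma diffFieldAt_extendVec (v : TangentSpace (𝓡 m).tangent p) :
    DiffFieldAt (extendVec v) p := (smoothFieldAt_extendVec v).diffFieldAt

lemma eventually_mem_chartDomain (hp : p ∈ chartDomain p₀) : ∀ᶠ q in 𝓝 p, q ∈ chartDomain p₀ :=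
  (isOpen_chartDomain p₀).mem_nhds hp

lemma DiffFieldAt.congr {X Y : VField m V} (hX : DiffFieldAt X p) (h : ∀ᶠ q in 𝓝 p, Y q = X q) :
    DiffFieldAt Y p := by
  refine MDifferentiableAt.congr_of_eventuallyEq hX ?_
  filter_upwards [h] with q hq
  rw [hq]

lemma SmoothFieldAt.congr {X Y : VField m V} (hX : SmoothFieldAt X p)
    (h : ∀ᶠ q in 𝓝 p, Y q = X q) : SmoothFieldAt Y p := by
  refine ContMDiffAt.congr_of_eventuallyEq hX ?_
  filter_upwards [h] with q hq
  rw [hq]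

lemma DiffFieldAt.sum {ι : Type*} [Fintype ι] {X : ι → VField m V} (h : ∀ i, DiffFieldAt (X i) p) :
    DiffFieldAt (fun q => ∑ i, X i q) p := by
  have := MDifferentiableAt.sum_section (I := (𝓡 m).tangent) (F := Model m)
    (E := (TangentSpace (𝓡 m).tangent : Phase m V → Type _)) (s := Finset.univ) (t := X) (x₀ := p)
    (fun i _ => h i)
  simpa [DiffFieldAt] using this

lemma SmoothFieldAt.sum {ι : Type*} [Fintype ι] {X : ι → VField m V}
    (h : ∀ i, SmoothFieldAt (X i) p) : SmoothFieldAt (fun q => ∑ i, X i q) p := by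
  have := ContMDiffAt.sum_section (I := (𝓡 m).tangent) (F := Model m)
    (V := (TangentSpace (𝓡 m).tangent : Phase m V → Type _)) (s := Finset.univ) (t := X) (x₀ := p)
    (fun i _ => h i)
  simpa [SmoothFieldAt] using this

/-- A field of endomorphisms that is smooth on smooth vector fields maps differentiable vector
fields to differentiable ones. -/
lemma DiffFieldAt.map {H : Π p : Phase m V,
      TangentSpace (𝓡 m).tangent p →L[ℝ] TangentSpace (𝓡 m).tangent p}
    (hH : ∀ p X, SmoothFieldAt X p → SmoothFieldAt (fun q => H q (X q)) p)
    {X : VField m V} (hX : DiffFieldAt X p) : DiffFieldAt (fun q => H q (X q)) p := by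
  have hp := mem_chartDomain p
  refine (DiffFieldAt.sum (X := fun α => (fun q => coordCoef p α q (X q)) •
    fun q => H q (coordVec p α q)) fun α => DiffFieldAt.smul (mdifferentiableAt_coordCoef hp hX α)
      (hH p _ (smoothFieldAt_coordVec hp α)).diffFieldAt).congr ?_
  filter_upwards [eventually_mem_chartDomain hp] with q hq
  conv_lhs => rw [eq_sum_coordCoef hq (X q)]
  simp [map_sum]

lemma eq_sum_tensor2 {q : Phase m V} (hq : q ∈ chartDomain p₀) (T : Tensor2 m V)
    (v w : TangentSpace (𝓡 m).tangent q) :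
    T q v w = ∑ α, ∑ β, coordCoef p₀ α q v *
      (coordCoef p₀ β q w * T q (coordVec p₀ α q) (coordVec p₀ β q)) := by
  conv_lhs => rw [eq_sum_coordCoef hq v, eq_sum_coordCoef hq w]
  rw [map_sum (T q), FunLike.coe_sum, Finset.sum_apply]
  refine Finset.sum_congr rfl fun α _ => ?_
  rw [map_sum]
  refine Finset.sum_congr rfl fun β _ => ?_
  rw [map_smul, map_smul, FunLike.coe_smul, Pi.smul_apply, smul_eq_mul, smul_eq_mul]
  ring

lemma mdifferentiableAt_sum {ι : Type} [Fintype ι] {f : ι → Phase m V → ℝ}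
    (h : ∀ i, MDifferentiableAt (𝓡 m).tangent 𝓘(ℝ, ℝ) (f i) p) :
    MDifferentiableAt (𝓡 m).tangent 𝓘(ℝ, ℝ) (fun q => ∑ i, f i q) p := by
  have := MDifferentiableAt.sum (I := (𝓡 m).tangent) (t := Finset.univ) (f := f) (z := p)
    (fun i (_ : i ∈ Finset.univ) => h i)
  convert this using 1
  funext q
  simp

lemma contMDiffAt_fintype_sum {ι : Type*} [Fintype ι] {n : ℕ∞ω} {f : ι → Phase m V → ℝ}
    (h : ∀ i, ContMDiffAt (𝓡 m).tangent 𝓘(ℝ, ℝ) n (f i) p) :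
    ContMDiffAt (𝓡 m).tangent 𝓘(ℝ, ℝ) n (fun q => ∑ i, f i q) p := by
  have := contMDiffAt_finsetSum (I' := (𝓡 m).tangent) (t := Finset.univ) (f := f) (x := p)
    fun i _ => h i
  convert this using 1

/-- A covariant 2-tensor that is smooth on smooth vector fields is differentiable on differentiable
ones. -/
lemma mdifferentiableAt_tensor2 {T : Tensor2 m V}
    (hT : ∀ p X Y, SmoothFieldAt X p → SmoothFieldAt Y p →
      ContMDiffAt (𝓡 m).tangent 𝓘(ℝ, ℝ) ∞ (fun q => T q (X q) (Y q)) p)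
    {X Y : VField m V} (hX : DiffFieldAt X p) (hY : DiffFieldAt Y p) :
    MDifferentiableAt (𝓡 m).tangent 𝓘(ℝ, ℝ) (fun q => T q (X q) (Y q)) p := by
  have hp := mem_chartDomain p
  have : MDifferentiableAt (𝓡 m).tangent 𝓘(ℝ, ℝ) (fun q => ∑ α, ∑ β, coordCoef p α q (X q) *
      (coordCoef p β q (Y q) * T q (coordVec p α q) (coordVec p β q))) p :=
    mdifferentiableAt_sum fun α => mdifferentiableAt_sum fun β =>
      (mdifferentiableAt_coordCoef hp hX α).mul ((mdifferentiableAt_coordCoef hp hY β).mul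
        ((hT p _ _ (smoothFieldAt_coordVec hp α) (smoothFieldAt_coordVec hp β)).mdifferentiableAt
          (by simp)))
  refine this.congr_of_eventuallyEq ?_
  filter_upwards [eventually_mem_chartDomain hp] with q hq using eq_sum_tensor2 hq T _ _

lemma SmoothFieldAt.mlieBracket {X Y : VField m V} (hX : SmoothFieldAt X p)
    (hY : SmoothFieldAt Y p) :
    SmoothFieldAt (VectorField.mlieBracket (𝓡 m).tangent X Y) p :=
  ContMDiffAt.mlieBracket_vectorField (n := ⊤) (m := ⊤) hX hY (by simp)

/-- The differential of the chart maps the coordinate frame to the standard basis. -/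
lemma mfderiv_extChartAt_coordVec (hp : p ∈ chartDomain p₀) (α : Fin m ⊕ Fin m) :
    mfderiv (𝓡 m).tangent 𝓘(ℝ, Model m) (extChartAt (𝓡 m).tangent p₀) p (coordVec p₀ α p) =
      modelBasis m α := by
  have hp' := hp
  rw [chartDomain, extChartAt_source] at hp'
  rw [chartDomain_eq] at hp
  have h := TangentBundle.continuousLinearMapAt_trivializationAt (I := (𝓡 m).tangent) hp'
  refine (congrArg (fun L => L (coordVec p₀ α p)) h).symm.trans ?_
  have h' : (trivializationAt (Model m) (TangentSpace (𝓡 m).tangent : Phase m V → Type _)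
      p₀).symmL ℝ p (modelBasis m α) = coordVec p₀ α p :=
    Bundle.Trivialization.symmL_apply _ hp _
  rw [← h']
  exact (trivializationAt (Model m) (TangentSpace (𝓡 m).tangent : Phase m V → Type _)
    p₀).continuousLinearMapAt_symmL (R := ℝ) hp (modelBasis m α)

lemma contMDiffAt_chart (hp : p ∈ chartDomain p₀) {n : ℕ∞} :
    ContMDiffAt (𝓡 m).tangent 𝓘(ℝ, Model m) n (extChartAt (𝓡 m).tangent p₀) p := by
  rw [chartDomain, extChartAt_source] at hp
  exact (contMDiffAt_extChartAt' (n := ∞) hp).of_le (by exact_mod_cast le_top)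

lemma contMDiffAt_chart_symm (hp : p ∈ chartDomain p₀) {n : ℕ∞} :
    ContMDiffAt 𝓘(ℝ, Model m) (𝓡 m).tangent n (extChartAt (𝓡 m).tangent p₀).symm
      (extChartAt (𝓡 m).tangent p₀ p) := by
  have := (contMDiffOn_extChartAt_symm (I := (𝓡 m).tangent) (n := ∞) p₀)
  refine ((this _ ((extChartAt (𝓡 m).tangent p₀).map_source hp)).contMDiffAt ?_).of_le
    (by exact_mod_cast le_top)
  exact (isOpen_extChartAt_target p₀).mem_nhds ((extChartAt (𝓡 m).tangent p₀).map_source hp)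

lemma mvfderiv_congr {f g : Phase m V → ℝ} (h : f =ᶠ[𝓝 p] g) :
    mvfderiv (𝓡 m).tangent f p = mvfderiv (𝓡 m).tangent g p := by
  ext v
  exact congrArg (fun L : TangentSpace (𝓡 m).tangent p →L[ℝ] ℝ => L v) h.mfderiv_eq

lemma mvfderiv_coordVec {f : Phase m V → ℝ} (hp : p ∈ chartDomain p₀)
    (hf : MDifferentiableAt (𝓡 m).tangent 𝓘(ℝ, ℝ) f p) (α : Fin m ⊕ Fin m) :
    mvfderiv (𝓡 m).tangent f p (coordVec p₀ α p) =
      fderiv ℝ (f ∘ (extChartAt (𝓡 m).tangent p₀).symm) (extChartAt (𝓡 m).tangent p₀ p)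
        (modelBasis m α) := by
  have h1 := (contMDiffAt_chart_symm (n := 1) hp).mdifferentiableAt (by simp)
  have h2 := (contMDiffAt_chart (n := 1) hp).mdifferentiableAt (by simp)
  have hinv := (extChartAt (𝓡 m).tangent p₀).left_inv hp
  have h3 : MDifferentiableAt 𝓘(ℝ, Model m) 𝓘(ℝ, ℝ) (f ∘ (extChartAt (𝓡 m).tangent p₀).symm)
      (extChartAt (𝓡 m).tangent p₀ p) := by
    refine MDifferentiableAt.comp _ ?_ h1
    rwa [hinv]
  have h4 : f =ᶠ[𝓝 p] (f ∘ (extChartAt (𝓡 m).tangent p₀).symm) ∘ (extChartAt (𝓡 m).tangent p₀) := by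
    filter_upwards [eventually_mem_chartDomain hp] with q hq
    exact congrArg f ((extChartAt (𝓡 m).tangent p₀).left_inv hq).symm
  rw [mvfderiv_congr h4, mvfderiv_comp_apply _ h3 h2, mfderiv_extChartAt_coordVec hp]
  change mfderiv _ _ _ _ _ = _
  rw [mfderiv_eq_fderiv]
  rfl

lemma mvfderiv_eq_sum {f : Phase m V → ℝ} (hp : p ∈ chartDomain p₀)
    (hf : MDifferentiableAt (𝓡 m).tangent 𝓘(ℝ, ℝ) f p) (v : TangentSpace (𝓡 m).tangent p) :
    mvfderiv (𝓡 m).tangent f p v = ∑ α, coordCoef p₀ α p v *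
      fderiv ℝ (f ∘ (extChartAt (𝓡 m).tangent p₀).symm) (extChartAt (𝓡 m).tangent p₀ p)
        (modelBasis m α) := by
  conv_lhs => rw [eq_sum_coordCoef hp v]
  rw [map_sum]
  refine Finset.sum_congr rfl fun α _ => ?_
  rw [map_smul, mvfderiv_coordVec hp hf, smul_eq_mul]

/-- The derivative of a smooth function along a smooth vector field is smooth. -/
lemma SmoothFieldAt.contMDiffAt_mvfderiv {f : Phase m V → ℝ} {X : VField m V}
    (hf : ContMDiffAt (𝓡 m).tangent 𝓘(ℝ, ℝ) ∞ f p) (hX : SmoothFieldAt X p) :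
    ContMDiffAt (𝓡 m).tangent 𝓘(ℝ, ℝ) ∞ (fun q => mvfderiv (𝓡 m).tangent f q (X q)) p := by
  have hp := mem_chartDomain p
  have h1 : ContDiffAt ℝ ∞ (f ∘ (extChartAt (𝓡 m).tangent p).symm)
      (extChartAt (𝓡 m).tangent p p) := by
    refine (ContMDiffAt.comp _ ?_ (contMDiffAt_chart_symm (n := ⊤) hp)).contDiffAt
    rwa [(extChartAt (𝓡 m).tangent p).left_inv hp]
  have h2 (α : Fin m ⊕ Fin m) := contDiffAt_fderiv_apply (n := ⊤) h1 (modelBasis m α)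
  have : ContMDiffAt (𝓡 m).tangent 𝓘(ℝ, ℝ) ∞ (fun q => ∑ α, coordCoef p α q (X q) *
      fderiv ℝ (f ∘ (extChartAt (𝓡 m).tangent p).symm) (extChartAt (𝓡 m).tangent p q)
        (modelBasis m α)) p :=
    contMDiffAt_fintype_sum fun α => (contMDiffAt_coordCoef hp hX α).mul
      ((h2 α).contMDiffAt.comp p (contMDiffAt_chart (n := ⊤) hp))
  refine this.congr_of_eventuallyEq ?_
  filter_upwards [eventually_mem_chartDomain hp,
    (contMDiffAt_iff_contMDiffAt_nhds (by simp)).1 (ContMDiffAt.of_le (m := 1) hf (by simp))]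
    with q hq hfq
  exact mvfderiv_eq_sum hq (hfq.mdifferentiableAt (by simp)) _

/-- Coordinate vector fields commute. -/
lemma mlieBracket_coordVec (hp : p ∈ chartDomain p₀) (α β : Fin m ⊕ Fin m) :
    VectorField.mlieBracket (𝓡 m).tangent (coordVec p₀ α) (coordVec p₀ β) p = 0 := by
  let C (α : Fin m ⊕ Fin m) : Π x : Model m, TangentSpace 𝓘(ℝ, Model m) x :=
    fun _ => modelBasis m α
  have hC (α : Fin m ⊕ Fin m) (x : Model m) : MDifferentiableAt 𝓘(ℝ, Model m)
      (𝓘(ℝ, Model m).prod 𝓘(ℝ, Model m)) (T% (C α)) x :=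
    (contMDiffAt_vectorSpace_iff_contDiffAt.2
      (contDiffAt_const (n := 1) (c := modelBasis m α))).mdifferentiableAt one_ne_zero
  have key (α : Fin m ⊕ Fin m) : coordVec p₀ α =ᶠ[𝓝 p] VectorField.mpullback (𝓡 m).tangent
      𝓘(ℝ, Model m) (extChartAt (𝓡 m).tangent p₀) (C α) := by
    filter_upwards [eventually_mem_chartDomain hp] with q hq
    refine Eq.trans ?_ (VectorField.mpullback_apply ..).symm
    exact ((isInvertible_mfderiv_extChartAt hq).inverse_apply_eq.2
      (mfderiv_extChartAt_coordVec hq α).symm).symm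
  have h0 : VectorField.mlieBracket 𝓘(ℝ, Model m) (C α) (C β) (extChartAt (𝓡 m).tangent p₀ p)
      = 0 := by
    rw [← VectorField.mlieBracketWithin_univ, VectorField.mlieBracketWithin_eq_lieBracketWithin]
    simp [VectorField.lieBracketWithin, C]
    rfl
  refine ((key α).mlieBracket_vectorField_eq (key β)).trans
    ((VectorField.mpullback_mlieBracket (n := 2) (hC α _) (hC β _) (contMDiffAt_chart hp)
      (by simp)).symm.trans ?_)
  refine (VectorField.mpullback_apply ..).trans ?_
  exact (congrArg _ h0).trans (map_zero _)

end Tensors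

/-! ### Horizontal and vertical parts -/

namespace PhaseGeometry

variable {m : ℕ} {V : Type*} [TopologicalSpace V] [ChartedSpace (EuclideanSpace ℝ (Fin m)) V]
  [IsManifold (𝓡 m) ∞ V] {p : Phase m V} (P : PhaseGeometry m V)

lemma diffFieldAt_hor {X : VField m V} (hX : DiffFieldAt X p) : DiffFieldAt (P.hor X) p :=
  hX.map P.h_smooth

lemma diffFieldAt_ver {X : VField m V} (hX : DiffFieldAt X p) : DiffFieldAt (P.ver X) p :=
  hX.sub (P.diffFieldAt_hor hX)

lemma smoothFieldAt_hor {X : VField m V} (hX : SmoothFieldAt X p) : SmoothFieldAt (P.hor X) p :=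
  P.h_smooth p X hX

lemma smoothFieldAt_ver {X : VField m V} (hX : SmoothFieldAt X p) : SmoothFieldAt (P.ver X) p :=
  hX.sub (P.smoothFieldAt_hor hX)

lemma mdifferentiableAt_g {X Y : VField m V} (hX : DiffFieldAt X p) (hY : DiffFieldAt Y p) :
    MDifferentiableAt (𝓡 m).tangent 𝓘(ℝ, ℝ) (fun q => P.g q (X q) (Y q)) p :=
  mdifferentiableAt_tensor2 P.g_smooth hX hY

lemma hor_add (X Y : VField m V) : P.hor (X + Y) = P.hor X + P.hor Y := by
  funext q; simp [hor]

lemma ver_add (X Y : VField m V) : P.ver (X + Y) = P.ver X + P.ver Y := by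
  funext q; simp [ver]; abel

lemma hor_smul (f : Phase m V → ℝ) (X : VField m V) : P.hor (f • X) = f • P.hor X := by
  funext q; simp [hor]

lemma ver_smul (f : Phase m V → ℝ) (X : VField m V) : P.ver (f • X) = f • P.ver X := by
  funext q; simp [ver, smul_sub]

lemma hor_hor (X : VField m V) : P.hor (P.hor X) = P.hor X := by
  funext q; simp [hor, P.h_idem]

lemma ver_hor (X : VField m V) : P.ver (P.hor X) = 0 := by
  funext q; simp [hor, ver, P.h_idem]

lemma hor_ver (X : VField m V) : P.hor (P.ver X) = 0 := by
  funext q; simp [hor, ver, P.h_idem]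

lemma ver_ver (X : VField m V) : P.ver (P.ver X) = P.ver X := by
  funext q; simp [ver, P.h_idem]

lemma hor_add_ver (X : VField m V) : P.hor X + P.ver X = X := by
  funext q; simp [hor, ver]

lemma isVertical_sub (X : TangentSpace (𝓡 m).tangent p) : IsVertical (X - P.h p X) := by
  rw [← P.h_ker]; simp [P.h_idem]

lemma g_hor_ver (X Y : VField m V) (q : Phase m V) : P.g q (P.hor X q) (P.ver Y q) = 0 :=
  P.g_adapted _ _ _ (P.isVertical_sub _)

lemma g_ver_hor (X Y : VField m V) (q : Phase m V) : P.g q (P.ver X q) (P.hor Y q) = 0 := by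
  rw [P.g_symm, P.g_hor_ver]

end PhaseGeometry

/-! ### Smooth endomorphism fields and the metric matrix -/

section Homs

variable {m : ℕ} {V : Type*} [TopologicalSpace V] [ChartedSpace (EuclideanSpace ℝ (Fin m)) V]
  [IsManifold (𝓡 m) ∞ V] {p₀ p : Phase m V}

/-- A field of endomorphisms is smooth as soon as its values on a coordinate frame are. -/
lemma contMDiffAt_hom_of_coordVec
    {A : Π q : Phase m V, TangentSpace (𝓡 m).tangent q →L[ℝ] TangentSpace (𝓡 m).tangent q}
    (hA : ∀ α, SmoothFieldAt (fun q => A q (coordVec p α q)) p) :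
    ContMDiffAt (𝓡 m).tangent ((𝓡 m).tangent.prod 𝓘(ℝ, Model m →L[ℝ] Model m)) ∞
      (fun q => Bundle.TotalSpace.mk' (Model m →L[ℝ] Model m)
        (E := fun q : Phase m V => TangentSpace (𝓡 m).tangent q →L[ℝ] TangentSpace (𝓡 m).tangent q)
        q (A q)) p := by
  rw [contMDiffAt_hom_bundle]
  refine ⟨contMDiffAt_id, ?_⟩
  set t := trivializationAt (Model m) (TangentSpace (𝓡 m).tangent : Phase m V → Type _) p with ht
  have h1 (α) : ContMDiffAt (𝓡 m).tangent 𝓘(ℝ, Model m) ∞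
      (fun q => (t ⟨q, A q (coordVec p α q)⟩).2) p :=
    (Bundle.contMDiffAt_section _).1 (hA α)
  let Λ (α : Fin m ⊕ Fin m) : Model m →L[ℝ] (Model m →L[ℝ] Model m) :=
    ContinuousLinearMap.smulRightL ℝ (Model m) (Model m)
      (LinearMap.toContinuousLinearMap ((modelBasis m).coord α))
  have h2 : ContMDiffAt (𝓡 m).tangent 𝓘(ℝ, Model m →L[ℝ] Model m) ∞
      (∑ α, fun q => Λ α ((t ⟨q, A q (coordVec p α q)⟩).2)) p :=
    contMDiffAt_finsetSum' fun α _ => (Λ α).contDiff.contMDiff.contMDiffAt.comp p (h1 α)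
  refine h2.congr_of_eventuallyEq ?_
  filter_upwards [eventually_mem_chartDomain (mem_chartDomain p)] with q hq
  rw [chartDomain_eq] at hq
  refine ContinuousLinearMap.coe_injective ((modelBasis m).ext fun β => ?_)
  have hsym : t.symmL ℝ q (modelBasis m β) = coordVec p β q :=
    Bundle.Trivialization.symmL_apply _ hq _
  have hL : (ContinuousLinearMap.inCoordinates (Model m)
      (TangentSpace (𝓡 m).tangent : Phase m V → Type _) (Model m)
      (TangentSpace (𝓡 m).tangent : Phase m V → Type _) p q p q (A q)) (modelBasis m β) =
      (t ⟨q, A q (coordVec p β q)⟩).2 := by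
    rw [← hsym]
    exact t.continuousLinearMapAt_apply_of_mem ℝ hq _
  refine hL.trans ?_
  have hR : (∑ α, fun q => Λ α ((t ⟨q, A q (coordVec p α q)⟩).2)) q (modelBasis m β) =
      ∑ α, (modelBasis m).coord α (modelBasis m β) • (t ⟨q, A q (coordVec p α q)⟩).2 := by
    rw [Finset.sum_apply, FunLike.coe_sum, Finset.sum_apply]
    rfl
  refine Eq.trans ?_ hR.symm
  rw [Finset.sum_eq_single β]
  · simp
  · intro α _ hα
    simp [hα.symm]
  · simp

end Homs

namespace PhaseGeometry

variable {m : ℕ} {V : Type*} [TopologicalSpace V] [ChartedSpace (EuclideanSpace ℝ (Fin m)) V]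
  [IsManifold (𝓡 m) ∞ V] {p₀ p : Phase m V} (P : PhaseGeometry m V)

lemma metricMatrix_symm (p₀ p : Phase m V) (α β : Fin m ⊕ Fin m) :
    metricMatrix P p₀ p α β = metricMatrix P p₀ p β α := P.g_symm _ _ _

lemma det_metricMatrix_ne_zero (hp : p ∈ chartDomain p₀) : (metricMatrix P p₀ p).det ≠ 0 := by
  intro h
  obtain ⟨v, hv, h0⟩ := Matrix.exists_mulVec_eq_zero_iff.2 h
  apply hv
  -- a kernel vector of the matrix is a tangent vector orthogonal to everything
  have hX : ∑ β, v β • coordVec p₀ β p = 0 := by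
    refine P.g_nondeg p _ fun Y => ?_
    rw [P.g_symm, eq_sum_coordCoef hp Y, map_sum (P.g p), FunLike.coe_sum, Finset.sum_apply]
    refine Finset.sum_eq_zero fun α _ => ?_
    rw [map_smul, FunLike.coe_smul, Pi.smul_apply, map_sum]
    have := congrFun h0 α
    simp only [Matrix.mulVec, dotProduct, Pi.zero_apply] at this
    rw [show ∑ β, P.g p (coordVec p₀ α p) (v β • coordVec p₀ β p) = 0 by
      rw [← this]
      refine Finset.sum_congr rfl fun β _ => ?_
      rw [map_smul, smul_eq_mul, mul_comm]; rfl]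
    simp
  funext α
  have := congrArg (coordCoef p₀ α p) hX
  rw [map_sum, map_zero] at this
  change v α = 0
  simpa only [map_smul, coordCoef_coordVec hp, smul_eq_mul, mul_ite, mul_one, mul_zero,
    Finset.sum_ite_eq, Finset.mem_univ, if_true] using this

lemma inv_metricMatrix_symm (p₀ p : Phase m V) (α β : Fin m ⊕ Fin m) :
    (metricMatrix P p₀ p)⁻¹ α β = (metricMatrix P p₀ p)⁻¹ β α :=
  inv_symm_of_symm (P.metricMatrix_symm p₀ p) α β

/-- Raising the index of a covector with the inverse metric matrix inverts lowering it. -/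
lemma g_sum_inv_smul (hp : p ∈ chartDomain p₀) (ξ : TangentSpace (𝓡 m).tangent p →ₗ[ℝ] ℝ)
    (w : TangentSpace (𝓡 m).tangent p) :
    P.g p (∑ α, ∑ β, ((metricMatrix P p₀ p)⁻¹ α β * ξ (coordVec p₀ α p)) • coordVec p₀ β p) w =
      ξ w := by
  have hdet : IsUnit (metricMatrix P p₀ p).det := (P.det_metricMatrix_ne_zero hp).isUnit
  have key (γ : Fin m ⊕ Fin m) : P.g p (∑ α, ∑ β, ((metricMatrix P p₀ p)⁻¹ α β *
      ξ (coordVec p₀ α p)) • coordVec p₀ β p) (coordVec p₀ γ p) = ξ (coordVec p₀ γ p) := by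
    rw [map_sum (P.g p), FunLike.coe_sum, Finset.sum_apply]
    have h1 (α) : P.g p (∑ β, ((metricMatrix P p₀ p)⁻¹ α β * ξ (coordVec p₀ α p)) •
        coordVec p₀ β p) (coordVec p₀ γ p) =
        ((metricMatrix P p₀ p)⁻¹ * metricMatrix P p₀ p) α γ * ξ (coordVec p₀ α p) := by
      rw [map_sum (P.g p), FunLike.coe_sum, Finset.sum_apply, Matrix.mul_apply, Finset.sum_mul]
      refine Finset.sum_congr rfl fun β _ => ?_
      rw [map_smul, FunLike.coe_smul, Pi.smul_apply, smul_eq_mul, mul_right_comm]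
      rfl
    rw [Finset.sum_congr rfl fun α _ => h1 α, Matrix.nonsing_inv_mul _ hdet]
    simp only [Matrix.one_apply, ite_mul, one_mul, zero_mul, Finset.sum_ite_eq', Finset.mem_univ,
      if_true]
  rw [eq_sum_coordCoef hp w, map_sum, map_sum ξ]
  refine Finset.sum_congr rfl fun γ _ => ?_
  rw [map_smul, map_smul, key]

lemma eq_of_g_eq {X Y : TangentSpace (𝓡 m).tangent p} (h : ∀ Z, P.g p X Z = P.g p Y Z) : X = Y := by
  refine sub_eq_zero.1 (P.g_nondeg p _ fun Z => ?_)
  rw [map_sub, FunLike.coe_sub, Pi.sub_apply, h, sub_self]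

lemma contMDiffAt_metricMatrix (hp : p ∈ chartDomain p₀) (α β : Fin m ⊕ Fin m) :
    ContMDiffAt (𝓡 m).tangent 𝓘(ℝ, ℝ) ∞ (fun q => metricMatrix P p₀ q α β) p :=
  P.g_smooth p _ _ (smoothFieldAt_coordVec hp α) (smoothFieldAt_coordVec hp β)

lemma contMDiffAt_inv_metricMatrix (hp : p ∈ chartDomain p₀) (α β : Fin m ⊕ Fin m) :
    ContMDiffAt (𝓡 m).tangent 𝓘(ℝ, ℝ) ∞ (fun q => (metricMatrix P p₀ q)⁻¹ α β) p := by
  have h1 : ContMDiffAt (𝓡 m).tangent 𝓘(ℝ, (Fin m ⊕ Fin m) → (Fin m ⊕ Fin m) → ℝ) ∞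
      (fun q α β => metricMatrix P p₀ q α β) p :=
    contMDiffAt_pi_space.2 fun α => contMDiffAt_pi_space.2 fun β =>
      P.contMDiffAt_metricMatrix hp α β
  have h2 := contDiffAt_inv_apply (F := (Fin m ⊕ Fin m) → (Fin m ⊕ Fin m) → ℝ) (n := ∞)
    (A := fun M => Matrix.of M) (x := fun α β => metricMatrix P p₀ p α β)
    (fun i j => (contDiff_apply_apply ℝ ℝ i j).contDiffAt) (P.det_metricMatrix_ne_zero hp) α β
  exact h2.contMDiffAt.comp p h1

end PhaseGeometry

/-! ### Connections from Koszul forms -/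

section Koszul

variable {m : ℕ} {V : Type*} [TopologicalSpace V] [ChartedSpace (EuclideanSpace ℝ (Fin m)) V]
  [IsManifold (𝓡 m) ∞ V] {p₀ p : Phase m V}

/-- The linear form `z ↦ B z x` of a bilinear form `B` on a tangent space. -/
def evalRight (B : TangentSpace (𝓡 m).tangent p →L[ℝ] TangentSpace (𝓡 m).tangent p →L[ℝ] ℝ)
    (x : TangentSpace (𝓡 m).tangent p) : TangentSpace (𝓡 m).tangent p →ₗ[ℝ] ℝ where
  toFun z := B z x
  map_add' z z' := by rw [map_add, FunLike.coe_add, Pi.add_apply]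
  map_smul' c z := by rw [map_smul, FunLike.coe_smul, Pi.smul_apply]; rfl

lemma evalRight_apply
    (B : TangentSpace (𝓡 m).tangent p →L[ℝ] TangentSpace (𝓡 m).tangent p →L[ℝ] ℝ)
    (x z : TangentSpace (𝓡 m).tangent p) : evalRight B x z = B z x := rfl

/-- `Φ X Y Z p` has the algebraic properties of `2 g(D_X Y, Z)(p)` for a smooth linear
connection `D`: it is function-linear in `X` and `Z`, satisfies the Leibniz rule in `Y`, and is
smooth for smooth arguments. -/
structure IsKoszulForm (P : PhaseGeometry m V)
    (Φ : VField m V → VField m V → VField m V → Phase m V → ℝ) : Prop where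
  add_left : ∀ {p X X' Y Z}, DiffFieldAt X p → DiffFieldAt X' p → DiffFieldAt Y p →
    DiffFieldAt Z p → Φ (X + X') Y Z p = Φ X Y Z p + Φ X' Y Z p
  smul_left : ∀ {p f X Y Z}, MDifferentiableAt (𝓡 m).tangent 𝓘(ℝ, ℝ) f p → DiffFieldAt X p →
    DiffFieldAt Y p → DiffFieldAt Z p → Φ (f • X) Y Z p = f p * Φ X Y Z p
  add_right : ∀ {p X Y Z Z'}, DiffFieldAt X p → DiffFieldAt Y p → DiffFieldAt Z p →
    DiffFieldAt Z' p → Φ X Y (Z + Z') p = Φ X Y Z p + Φ X Y Z' p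
  smul_right : ∀ {p f X Y Z}, MDifferentiableAt (𝓡 m).tangent 𝓘(ℝ, ℝ) f p → DiffFieldAt X p →
    DiffFieldAt Y p → DiffFieldAt Z p → Φ X Y (f • Z) p = f p * Φ X Y Z p
  add_mid : ∀ {p X Y Y' Z}, DiffFieldAt X p → DiffFieldAt Y p → DiffFieldAt Y' p →
    DiffFieldAt Z p → Φ X (Y + Y') Z p = Φ X Y Z p + Φ X Y' Z p
  leibniz : ∀ {p f X Y Z}, MDifferentiableAt (𝓡 m).tangent 𝓘(ℝ, ℝ) f p → DiffFieldAt X p →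
    DiffFieldAt Y p → DiffFieldAt Z p → Φ X (f • Y) Z p =
      f p * Φ X Y Z p + 2 * (mvfderiv (𝓡 m).tangent f p (X p) * P.g p (Y p) (Z p))
  smooth : ∀ {p X Y Z}, SmoothFieldAt X p → SmoothFieldAt Y p → SmoothFieldAt Z p →
    ContMDiffAt (𝓡 m).tangent 𝓘(ℝ, ℝ) ∞ (Φ X Y Z) p

namespace IsKoszulForm

variable {P : PhaseGeometry m V} {Φ : VField m V → VField m V → VField m V → Phase m V → ℝ}

lemma tensorialAt_left (hΦ : IsKoszulForm P Φ) {Y Z : VField m V} (hY : DiffFieldAt Y p)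
    (hZ : DiffFieldAt Z p) :
    TensorialAt (𝓡 m).tangent (Model m) (fun X => Φ X Y Z p) p where
  smul hf hX := hΦ.smul_left hf hX hY hZ
  add hX hX' := hΦ.add_left hX hX' hY hZ

lemma tensorialAt_right (hΦ : IsKoszulForm P Φ) {X Y : VField m V} (hX : DiffFieldAt X p)
    (hY : DiffFieldAt Y p) :
    TensorialAt (𝓡 m).tangent (Model m) (fun Z => Φ X Y Z p) p where
  smul hf hZ := hΦ.smul_right hf hX hY hZ
  add hZ hZ' := hΦ.add_right hX hY hZ hZ'

/-- The bilinear form `(Z, X) ↦ Φ X Y Z p` on the tangent space at `p`. -/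
def bilin (hΦ : IsKoszulForm P Φ) {Y : VField m V} (hY : DiffFieldAt Y p) :
    TangentSpace (𝓡 m).tangent p →L[ℝ] TangentSpace (𝓡 m).tangent p →L[ℝ] ℝ :=
  TensorialAt.mkHom₂ (I := (𝓡 m).tangent) (F := Model m) (F' := Model m) (fun Z X => Φ X Y Z p) p
    (fun _ hX => hΦ.tensorialAt_right hX hY) (fun _ hZ => hΦ.tensorialAt_left hY hZ)

lemma bilin_apply (hΦ : IsKoszulForm P Φ) {X Y Z : VField m V} (hX : DiffFieldAt X p)
    (hY : DiffFieldAt Y p) (hZ : DiffFieldAt Z p) :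
    hΦ.bilin hY (Z p) (X p) = Φ X Y Z p :=
  TensorialAt.mkHom₂_apply _ _ hZ hX

open Classical in
/-- The covariant derivative with `2 g(D_X Y, Z) = Φ X Y Z`, obtained by raising the index `Z` with
the inverse metric; it is set to zero where `Y` is not differentiable. -/
def covAux (hΦ : IsKoszulForm P Φ) (Y : VField m V) (p : Phase m V) :
    TangentSpace (𝓡 m).tangent p →L[ℝ] TangentSpace (𝓡 m).tangent p :=
  if hY : DiffFieldAt Y p then
    ∑ α, ∑ β, ((metricMatrix P p p)⁻¹ α β / 2) •
      (hΦ.bilin hY (coordVec p α p)).smulRight (coordVec p β p)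
  else 0

lemma two_mul_g_covAux (hΦ : IsKoszulForm P Φ) {X Y Z : VField m V} (hX : DiffFieldAt X p)
    (hY : DiffFieldAt Y p) (hZ : DiffFieldAt Z p) :
    2 * P.g p (hΦ.covAux Y p (X p)) (Z p) = Φ X Y Z p := by
  have h := P.g_sum_inv_smul (mem_chartDomain p) (evalRight (hΦ.bilin hY) (X p)) (Z p)
  have h2 : (hΦ.covAux Y p (X p)) = (1 / 2 : ℝ) • ∑ α, ∑ β, ((metricMatrix P p p)⁻¹ α β *
      (evalRight (hΦ.bilin hY) (X p)) (coordVec p α p)) • coordVec p β p := by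
    rw [covAux, dif_pos hY, FunLike.coe_sum, Finset.sum_apply, Finset.smul_sum]
    refine Finset.sum_congr rfl fun α _ => ?_
    rw [FunLike.coe_sum, Finset.sum_apply, Finset.smul_sum]
    refine Finset.sum_congr rfl fun β _ => ?_
    change (_ : ℝ) • ((hΦ.bilin hY (coordVec p α p) (X p)) • coordVec p β p) =
      (1 / 2 : ℝ) • (((metricMatrix P p p)⁻¹ α β *
        hΦ.bilin hY (coordVec p α p) (X p)) • coordVec p β p)
    rw [smul_smul, smul_smul]
    congr 1
    ring
  rw [h2, map_smul (P.g p), FunLike.coe_smul, Pi.smul_apply, h, ← hΦ.bilin_apply hX hY hZ]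
  simp [evalRight_apply]

lemma covAux_eq (hΦ : IsKoszulForm P Φ) {X Y : VField m V} (hX : DiffFieldAt X p)
    (hY : DiffFieldAt Y p) {W : TangentSpace (𝓡 m).tangent p}
    (h : ∀ Z : VField m V, DiffFieldAt Z p → 2 * P.g p W (Z p) = Φ X Y Z p) :
    hΦ.covAux Y p (X p) = W := by
  refine P.eq_of_g_eq fun z => ?_
  have h1 := h _ (diffFieldAt_extendVec z)
  rw [← hΦ.two_mul_g_covAux hX hY (diffFieldAt_extendVec z), extendVec_self] at h1
  linarith

lemma isCovariantDerivativeOn (hΦ : IsKoszulForm P Φ) :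
    IsCovariantDerivativeOn (I := (𝓡 m).tangent) (Model m) hΦ.covAux Set.univ where
  add {Y Y' p} hY hY' _ := by
    ext1 x
    have hx := diffFieldAt_extendVec x
    have := hΦ.covAux_eq (X := extendVec x) (W := (hΦ.covAux Y p + hΦ.covAux Y' p) x) hx
      (DiffFieldAt.add hY hY') fun Z hZ => by
        rw [hΦ.add_mid hx hY hY' hZ, ← hΦ.two_mul_g_covAux hx hY hZ,
          ← hΦ.two_mul_g_covAux hx hY' hZ, extendVec_self, FunLike.coe_add, Pi.add_apply, map_add,
          FunLike.coe_add, Pi.add_apply]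
        ring
    rwa [extendVec_self] at this
  leibniz {Y f p} hY hf _ := by
    ext1 x
    have hx := diffFieldAt_extendVec x
    have := hΦ.covAux_eq (X := extendVec x) (W := (f p • hΦ.covAux Y p +
      (mvfderiv (𝓡 m).tangent f p).smulRight (Y p)) x) hx
      (DiffFieldAt.smul hf hY) fun Z hZ => by
        rw [hΦ.leibniz hf hx hY hZ, ← hΦ.two_mul_g_covAux hx hY hZ, extendVec_self]
        rw [FunLike.coe_add, Pi.add_apply, map_add, FunLike.coe_add, Pi.add_apply, FunLike.coe_smul,
          Pi.smul_apply, map_smul, FunLike.coe_smul, Pi.smul_apply,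
          ContinuousLinearMap.smulRight_apply, map_smul, FunLike.coe_smul, Pi.smul_apply,
          smul_eq_mul, smul_eq_mul]
        ring
    rwa [extendVec_self] at this

lemma smoothFieldAt_covAux (hΦ : IsKoszulForm P Φ) {X Y : VField m V} (hX : SmoothFieldAt X p)
    (hY : SmoothFieldAt Y p) (hXd : ∀ᶠ q in 𝓝 p, DiffFieldAt X q)
    (hYd : ∀ᶠ q in 𝓝 p, DiffFieldAt Y q) :
    SmoothFieldAt (fun q => hΦ.covAux Y q (X q)) p := by
  have hp := mem_chartDomain p
  refine (SmoothFieldAt.sum (X := fun α q => ∑ β, ((metricMatrix P p q)⁻¹ α β / 2 *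
    Φ X Y (coordVec p α) q) • coordVec p β q) fun α => SmoothFieldAt.sum fun β =>
      SmoothFieldAt.smul (f := fun q => (metricMatrix P p q)⁻¹ α β / 2 *
    Φ X Y (coordVec p α) q) ?_ (smoothFieldAt_coordVec hp β)).congr ?_
  · exact ((P.contMDiffAt_inv_metricMatrix hp α β).div_const 2).mul
      (hΦ.smooth hX hY (smoothFieldAt_coordVec hp α))
  · filter_upwards [hXd, hYd, eventually_mem_chartDomain hp] with q hXq hYq hq
    refine hΦ.covAux_eq hXq hYq fun Z hZ => ?_
    have h := P.g_sum_inv_smul hq (evalRight (hΦ.bilin hYq) (X q)) (Z q)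
    have h2 : ∑ α, ∑ β, ((metricMatrix P p q)⁻¹ α β / 2 *
        Φ X Y (coordVec p α) q) • coordVec p β q = (1 / 2 : ℝ) • ∑ α, ∑ β,
        ((metricMatrix P p q)⁻¹ α β *
        (evalRight (hΦ.bilin hYq) (X q)) (coordVec p α q)) • coordVec p β q := by
      simp only [Finset.smul_sum, smul_smul]
      refine Finset.sum_congr rfl fun α _ => Finset.sum_congr rfl fun β _ => ?_
      congr 1
      rw [← hΦ.bilin_apply hXq hYq (diffFieldAt_coordVec hq α)]
      change _ = (1 / 2 : ℝ) * (_ * hΦ.bilin hYq (coordVec p α q) (X q))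
      ring
    rw [h2, map_smul (P.g q), FunLike.coe_smul, Pi.smul_apply, h, ← hΦ.bilin_apply hXq hYq hZ]
    simp [evalRight_apply]

/-- The linear connection `D` with `2 g(D_X Y, Z) = Φ X Y Z`. -/
def connection (hΦ : IsKoszulForm P Φ) : LinearConnection m V where
  cov := ⟨hΦ.covAux, hΦ.isCovariantDerivativeOn⟩
  smooth := ⟨⟨fun {Y} hY => by
    intro p _
    have hY' (q) : SmoothFieldAt Y q := (hY.contMDiffAt Filter.univ_mem)
    refine (contMDiffAt_hom_of_coordVec fun α => ?_).contMDiffWithinAt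
    refine hΦ.smoothFieldAt_covAux (smoothFieldAt_coordVec (mem_chartDomain p) α) (hY' p) ?_
      (Filter.Eventually.of_forall fun q => (hY' q).diffFieldAt)
    filter_upwards [eventually_mem_chartDomain (mem_chartDomain p)] with q hq
    exact diffFieldAt_coordVec hq α⟩⟩

lemma two_mul_g_connection (hΦ : IsKoszulForm P Φ) {X Y Z : VField m V} (hX : DiffFieldAt X p)
    (hY : DiffFieldAt Y p) (hZ : DiffFieldAt Z p) :
    2 * P.g p (hΦ.connection.cov Y p (X p)) (Z p) = Φ X Y Z p :=
  hΦ.two_mul_g_covAux hX hY hZ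

end IsKoszulForm
end Koszul

/-! ### The Koszul expressions of a d-metric -/

namespace PhaseGeometry

variable {m : ℕ} {V : Type*} [TopologicalSpace V] [ChartedSpace (EuclideanSpace ℝ (Fin m)) V]
  [IsManifold (𝓡 m) ∞ V] {p : Phase m V} (P : PhaseGeometry m V) {X X' Y Y' Z Z' : VField m V}
  {f : Phase m V → ℝ}

/-- The derivative `X (g(Y, Z))` at `p`. -/
def dg (X Y Z : VField m V) (p : Phase m V) : ℝ :=
  mvfderiv (𝓡 m).tangent (fun q => P.g q (Y q) (Z q)) p (X p)

/-- The product `g([X, Y], Z)` at `p`. -/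
def bg (X Y Z : VField m V) (p : Phase m V) : ℝ :=
  P.g p (VectorField.mlieBracket (𝓡 m).tangent X Y p) (Z p)

lemma dg_comm : P.dg X Y Z p = P.dg X Z Y p := by
  simp only [dg, P.g_symm _ (Y _)]

lemma dg_add_left : P.dg (X + X') Y Z p = P.dg X Y Z p + P.dg X' Y Z p := by
  simp only [dg, Pi.add_apply, map_add]

lemma dg_smul_left : P.dg (f • X) Y Z p = f p * P.dg X Y Z p := by
  simp only [dg, Pi.smul_apply', map_smul, smul_eq_mul]

lemma dg_add_mid (hY : DiffFieldAt Y p) (hY' : DiffFieldAt Y' p) (hZ : DiffFieldAt Z p) :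
    P.dg X (Y + Y') Z p = P.dg X Y Z p + P.dg X Y' Z p := by
  have : (fun q => P.g q ((Y + Y') q) (Z q)) =
      fun q => P.g q (Y q) (Z q) + P.g q (Y' q) (Z q) := by
    funext q
    rw [Pi.add_apply, map_add, FunLike.coe_add, Pi.add_apply]
  rw [dg, this, mvfderiv_fun_add (P.mdifferentiableAt_g hY hZ) (P.mdifferentiableAt_g hY' hZ)]
  rfl

lemma dg_smul_mid (hf : MDifferentiableAt (𝓡 m).tangent 𝓘(ℝ, ℝ) f p) (hY : DiffFieldAt Y p)
    (hZ : DiffFieldAt Z p) : P.dg X (f • Y) Z p =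
      f p * P.dg X Y Z p + mvfderiv (𝓡 m).tangent f p (X p) * P.g p (Y p) (Z p) := by
  have : (fun q => P.g q ((f • Y) q) (Z q)) = fun q => f q * P.g q (Y q) (Z q) := by
    funext q
    rw [Pi.smul_apply', map_smul, FunLike.coe_smul, Pi.smul_apply, smul_eq_mul]
  rw [dg, this, mvfderiv_fun_mul hf (P.mdifferentiableAt_g hY hZ)]
  simp [dg]
  ring

lemma dg_add_right (hY : DiffFieldAt Y p) (hZ : DiffFieldAt Z p) (hZ' : DiffFieldAt Z' p) :
    P.dg X Y (Z + Z') p = P.dg X Y Z p + P.dg X Y Z' p := by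
  rw [dg_comm, P.dg_add_mid hZ hZ' hY, P.dg_comm, P.dg_comm (Y := Z')]

lemma dg_smul_right (hf : MDifferentiableAt (𝓡 m).tangent 𝓘(ℝ, ℝ) f p) (hY : DiffFieldAt Y p)
    (hZ : DiffFieldAt Z p) : P.dg X Y (f • Z) p =
      f p * P.dg X Y Z p + mvfderiv (𝓡 m).tangent f p (X p) * P.g p (Y p) (Z p) := by
  rw [dg_comm, P.dg_smul_mid hf hZ hY, P.dg_comm, P.g_symm]

lemma bg_swap : P.bg X Y Z p = -P.bg Y X Z p := by
  rw [bg, VectorField.mlieBracket_swap, Pi.neg_apply, map_neg]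
  rfl

lemma bg_add_left (hX : DiffFieldAt X p) (hX' : DiffFieldAt X' p) :
    P.bg (X + X') Y Z p = P.bg X Y Z p + P.bg X' Y Z p := by
  rw [bg, VectorField.mlieBracket_add_left hX hX', map_add]
  rfl

lemma bg_smul_left (hf : MDifferentiableAt (𝓡 m).tangent 𝓘(ℝ, ℝ) f p) (hX : DiffFieldAt X p) :
    P.bg (f • X) Y Z p =
      f p * P.bg X Y Z p - mvfderiv (𝓡 m).tangent f p (Y p) * P.g p (X p) (Z p) := by
  rw [bg, VectorField.mlieBracket_smul_left hf hX, map_add, map_smul, map_smul,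
    FunLike.coe_add, Pi.add_apply, FunLike.coe_smul, Pi.smul_apply, FunLike.coe_smul,
    Pi.smul_apply, smul_eq_mul, smul_eq_mul, bg]
  ring

lemma bg_add_mid (hY : DiffFieldAt Y p) (hY' : DiffFieldAt Y' p) :
    P.bg X (Y + Y') Z p = P.bg X Y Z p + P.bg X Y' Z p := by
  rw [bg_swap, P.bg_add_left hY hY', P.bg_swap (X := X), P.bg_swap (X := X)]
  ring

lemma bg_smul_mid (hf : MDifferentiableAt (𝓡 m).tangent 𝓘(ℝ, ℝ) f p) (hY : DiffFieldAt Y p) :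
    P.bg X (f • Y) Z p =
      f p * P.bg X Y Z p + mvfderiv (𝓡 m).tangent f p (X p) * P.g p (Y p) (Z p) := by
  rw [bg_swap, P.bg_smul_left hf hY, P.bg_swap (X := X)]
  ring

lemma bg_add_right : P.bg X Y (Z + Z') p = P.bg X Y Z p + P.bg X Y Z' p := by
  simp only [bg, Pi.add_apply, map_add]

lemma bg_smul_right : P.bg X Y (f • Z) p = f p * P.bg X Y Z p := by
  simp only [bg, Pi.smul_apply', map_smul, smul_eq_mul]

lemma contMDiffAt_dg (hX : SmoothFieldAt X p) (hY : SmoothFieldAt Y p) (hZ : SmoothFieldAt Z p) :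
    ContMDiffAt (𝓡 m).tangent 𝓘(ℝ, ℝ) ∞ (P.dg X Y Z) p :=
  SmoothFieldAt.contMDiffAt_mvfderiv (P.g_smooth p Y Z hY hZ) hX

lemma contMDiffAt_bg (hX : SmoothFieldAt X p) (hY : SmoothFieldAt Y p) (hZ : SmoothFieldAt Z p) :
    ContMDiffAt (𝓡 m).tangent 𝓘(ℝ, ℝ) ∞ (P.bg X Y Z) p :=
  P.g_smooth p _ _ (hX.mlieBracket hY) hZ

lemma dg_zero_left : P.dg 0 Y Z p = 0 := by simp [dg]

lemma dg_zero_mid : P.dg X 0 Z p = 0 := by simp [dg, mvfderiv_const]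

lemma dg_zero_right : P.dg X Y 0 p = 0 := by simp [dg, mvfderiv_const]

lemma bg_zero_left : P.bg 0 Y Z p = 0 := by simp [bg]

lemma bg_zero_mid : P.bg X 0 Z p = 0 := by simp [bg]

lemma bg_zero_right : P.bg X Y 0 p = 0 := by simp [bg]

/-- The Koszul expression, `2 g(∇_X Y, Z)` for the Levi-Civita connection `∇`. -/
def koszul (X Y Z : VField m V) (p : Phase m V) : ℝ :=
  P.dg X Y Z p + P.dg Y X Z p - P.dg Z X Y p + P.bg X Y Z p - P.bg X Z Y p - P.bg Y Z X p

/-- The expression giving `2 g(D_X Y, Z)` for the canonical d-connection `D`, when `Y` and `Z`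
are of the type (horizontal or vertical) opposite to that of `X`. -/
def mixed (X Y Z : VField m V) (p : Phase m V) : ℝ :=
  P.dg X Y Z p + P.bg X Y Z p - P.bg X Z Y p

/-- The Koszul expression defines a connection. -/
lemma isKoszulForm_koszul : IsKoszulForm P P.koszul where
  add_left hX hX' hY hZ := by
    simp only [koszul, P.dg_add_left, P.dg_add_mid hX hX' hZ, P.dg_add_mid hX hX' hY,
      P.bg_add_left hX hX', P.bg_add_right]
    ring
  smul_left {p f X Y Z} hf hX hY hZ := by
    simp only [koszul, P.dg_smul_left, P.dg_smul_mid hf hX hZ, P.dg_smul_mid hf hX hY,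
      P.bg_smul_left hf hX, P.bg_smul_right]
    ring
  add_right hX hY hZ hZ' := by
    simp only [koszul, P.dg_add_left, P.dg_add_right hY hZ hZ', P.dg_add_right hX hZ hZ',
      P.bg_add_mid hZ hZ', P.bg_add_right]
    ring
  smul_right {p f X Y Z} hf hX hY hZ := by
    simp only [koszul, P.dg_smul_left, P.dg_smul_right hf hY hZ, P.dg_smul_right hf hX hZ,
      P.bg_smul_mid hf hZ, P.bg_smul_right, P.g_symm p (Z p)]
    ring
  add_mid hX hY hY' hZ := by
    simp only [koszul, P.dg_add_left, P.dg_add_right hX hY hY', P.dg_add_mid hY hY' hZ,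
      P.bg_add_mid hY hY', P.bg_add_left hY hY', P.bg_add_right]
    ring
  leibniz {p f X Y Z} hf hX hY hZ := by
    simp only [koszul, P.dg_smul_left, P.dg_smul_right hf hX hY, P.dg_smul_mid hf hY hZ,
      P.bg_smul_mid hf hY, P.bg_smul_left hf hY, P.bg_smul_right, P.g_symm p (Y p) (X p)]
    ring
  smooth hX hY hZ := ((((P.contMDiffAt_dg hX hY hZ).add (P.contMDiffAt_dg hY hX hZ)).sub
    (P.contMDiffAt_dg hZ hX hY)).add (P.contMDiffAt_bg hX hY hZ)).sub
    (P.contMDiffAt_bg hX hZ hY) |>.sub (P.contMDiffAt_bg hY hZ hX)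

/-- Metric compatibility of the Koszul expression. -/
lemma koszul_add_koszul : P.koszul X Y Z p + P.koszul X Z Y p = 2 * P.dg X Y Z p := by
  rw [koszul, koszul, P.dg_comm (X := X) (Y := Z), P.bg_swap (X := Z) (Y := Y)]
  ring

/-- Vanishing torsion of the Koszul expression. -/
lemma koszul_sub_koszul : P.koszul X Y Z p - P.koszul Y X Z p = 2 * P.bg X Y Z p := by
  rw [koszul, koszul, P.dg_comm (X := Z) (Y := Y), P.bg_swap (X := Y) (Y := X)]
  ring

/-- Metric compatibility of `mixed`. -/
lemma mixed_add_mixed : P.mixed X Y Z p + P.mixed X Z Y p = 2 * P.dg X Y Z p := by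
  rw [mixed, mixed, P.dg_comm (Y := Z)]
  ring

lemma mixed_add_left (hX : DiffFieldAt X p) (hX' : DiffFieldAt X' p) :
    P.mixed (X + X') Y Z p = P.mixed X Y Z p + P.mixed X' Y Z p := by
  simp only [mixed, P.dg_add_left, P.bg_add_left hX hX']
  ring

/-- `mixed` is function-linear in its first argument on fields orthogonal to the others. -/
lemma mixed_smul_left (hf : MDifferentiableAt (𝓡 m).tangent 𝓘(ℝ, ℝ) f p) (hX : DiffFieldAt X p)
    (hXY : P.g p (X p) (Y p) = 0) (hXZ : P.g p (X p) (Z p) = 0) :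
    P.mixed (f • X) Y Z p = f p * P.mixed X Y Z p := by
  simp only [mixed, P.dg_smul_left, P.bg_smul_left hf hX, hXY, hXZ]
  ring

lemma mixed_add_mid (hY : DiffFieldAt Y p) (hY' : DiffFieldAt Y' p) (hZ : DiffFieldAt Z p) :
    P.mixed X (Y + Y') Z p = P.mixed X Y Z p + P.mixed X Y' Z p := by
  simp only [mixed, P.dg_add_mid hY hY' hZ, P.bg_add_mid hY hY', P.bg_add_right]
  ring

lemma mixed_smul_mid (hf : MDifferentiableAt (𝓡 m).tangent 𝓘(ℝ, ℝ) f p) (hY : DiffFieldAt Y p)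
    (hZ : DiffFieldAt Z p) : P.mixed X (f • Y) Z p = f p * P.mixed X Y Z p +
      2 * (mvfderiv (𝓡 m).tangent f p (X p) * P.g p (Y p) (Z p)) := by
  simp only [mixed, P.dg_smul_mid hf hY hZ, P.bg_smul_mid hf hY, P.bg_smul_right]
  ring

lemma mixed_add_right (hY : DiffFieldAt Y p) (hZ : DiffFieldAt Z p) (hZ' : DiffFieldAt Z' p) :
    P.mixed X Y (Z + Z') p = P.mixed X Y Z p + P.mixed X Y Z' p := by
  simp only [mixed, P.dg_add_right hY hZ hZ', P.bg_add_mid hZ hZ', P.bg_add_right]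
  ring

lemma mixed_smul_right (hf : MDifferentiableAt (𝓡 m).tangent 𝓘(ℝ, ℝ) f p) (hY : DiffFieldAt Y p)
    (hZ : DiffFieldAt Z p) : P.mixed X Y (f • Z) p = f p * P.mixed X Y Z p := by
  simp only [mixed, P.dg_smul_right hf hY hZ, P.bg_smul_mid hf hZ, P.bg_smul_right,
    P.g_symm p (Z p)]
  ring

lemma contMDiffAt_mixed (hX : SmoothFieldAt X p) (hY : SmoothFieldAt Y p)
    (hZ : SmoothFieldAt Z p) : ContMDiffAt (𝓡 m).tangent 𝓘(ℝ, ℝ) ∞ (P.mixed X Y Z) p :=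
  ((P.contMDiffAt_dg hX hY hZ).add (P.contMDiffAt_bg hX hY hZ)).sub (P.contMDiffAt_bg hX hZ hY)

/-- The expression `2 g(D_X Y, Z)` for the canonical d-connection `D`: the Koszul expressions of the
horizontal and of the vertical parts alone, and `mixed` for derivatives of vertical fields in
horizontal directions and conversely. -/
def canonicalKoszul (X Y Z : VField m V) (p : Phase m V) : ℝ :=
  P.koszul (P.hor X) (P.hor Y) (P.hor Z) p + P.koszul (P.ver X) (P.ver Y) (P.ver Z) p +
    P.mixed (P.hor X) (P.ver Y) (P.ver Z) p + P.mixed (P.ver X) (P.hor Y) (P.hor Z) p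

lemma g_eq_hor_add_ver (Y Z : VField m V) (q : Phase m V) : P.g q (Y q) (Z q) =
    P.g q (P.hor Y q) (P.hor Z q) + P.g q (P.ver Y q) (P.ver Z q) := by
  conv_lhs => rw [← P.hor_add_ver Y, ← P.hor_add_ver Z]
  rw [Pi.add_apply, Pi.add_apply, map_add (P.g q), FunLike.coe_add, Pi.add_apply, map_add, map_add,
    g_hor_ver, g_ver_hor]
  ring

/-- The expression for the canonical d-connection defines a connection. The Leibniz terms of the
four summands add up to `X f g(Y, Z)`, as `g` is the sum of its horizontal and its vertical part. -/
lemma isKoszulForm_canonicalKoszul : IsKoszulForm P P.canonicalKoszul where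
  add_left hX hX' hY hZ := by
    have K := P.isKoszulForm_koszul
    simp only [canonicalKoszul, hor_add, ver_add]
    rw [K.add_left (P.diffFieldAt_hor hX) (P.diffFieldAt_hor hX') (P.diffFieldAt_hor hY)
        (P.diffFieldAt_hor hZ), K.add_left (P.diffFieldAt_ver hX) (P.diffFieldAt_ver hX')
        (P.diffFieldAt_ver hY) (P.diffFieldAt_ver hZ),
      P.mixed_add_left (P.diffFieldAt_hor hX) (P.diffFieldAt_hor hX'),
      P.mixed_add_left (P.diffFieldAt_ver hX) (P.diffFieldAt_ver hX')]
    ring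
  smul_left hf hX hY hZ := by
    have K := P.isKoszulForm_koszul
    simp only [canonicalKoszul, hor_smul, ver_smul]
    rw [K.smul_left hf (P.diffFieldAt_hor hX) (P.diffFieldAt_hor hY) (P.diffFieldAt_hor hZ),
      K.smul_left hf (P.diffFieldAt_ver hX) (P.diffFieldAt_ver hY) (P.diffFieldAt_ver hZ),
      P.mixed_smul_left hf (P.diffFieldAt_hor hX) (P.g_hor_ver ..) (P.g_hor_ver ..),
      P.mixed_smul_left hf (P.diffFieldAt_ver hX) (P.g_ver_hor ..) (P.g_ver_hor ..)]
    ring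
  add_right hX hY hZ hZ' := by
    have K := P.isKoszulForm_koszul
    simp only [canonicalKoszul, hor_add, ver_add]
    rw [K.add_right (P.diffFieldAt_hor hX) (P.diffFieldAt_hor hY) (P.diffFieldAt_hor hZ)
        (P.diffFieldAt_hor hZ'), K.add_right (P.diffFieldAt_ver hX) (P.diffFieldAt_ver hY)
        (P.diffFieldAt_ver hZ) (P.diffFieldAt_ver hZ'),
      P.mixed_add_right (P.diffFieldAt_hor hY) (P.diffFieldAt_hor hZ) (P.diffFieldAt_hor hZ'),
      P.mixed_add_right (P.diffFieldAt_ver hY) (P.diffFieldAt_ver hZ) (P.diffFieldAt_ver hZ')]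
    ring
  smul_right hf hX hY hZ := by
    have K := P.isKoszulForm_koszul
    simp only [canonicalKoszul, hor_smul, ver_smul]
    rw [K.smul_right hf (P.diffFieldAt_hor hX) (P.diffFieldAt_hor hY) (P.diffFieldAt_hor hZ),
      K.smul_right hf (P.diffFieldAt_ver hX) (P.diffFieldAt_ver hY) (P.diffFieldAt_ver hZ),
      P.mixed_smul_right hf (P.diffFieldAt_hor hY) (P.diffFieldAt_hor hZ),
      P.mixed_smul_right hf (P.diffFieldAt_ver hY) (P.diffFieldAt_ver hZ)]
    ring
  add_mid hX hY hY' hZ := by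
    have K := P.isKoszulForm_koszul
    simp only [canonicalKoszul, hor_add, ver_add]
    rw [K.add_mid (P.diffFieldAt_hor hX) (P.diffFieldAt_hor hY) (P.diffFieldAt_hor hY')
        (P.diffFieldAt_hor hZ), K.add_mid (P.diffFieldAt_ver hX) (P.diffFieldAt_ver hY)
        (P.diffFieldAt_ver hY') (P.diffFieldAt_ver hZ),
      P.mixed_add_mid (P.diffFieldAt_hor hY) (P.diffFieldAt_hor hY') (P.diffFieldAt_hor hZ),
      P.mixed_add_mid (P.diffFieldAt_ver hY) (P.diffFieldAt_ver hY') (P.diffFieldAt_ver hZ)]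
    ring
  leibniz {p f X Y Z} hf hX hY hZ := by
    have K := P.isKoszulForm_koszul
    have hsplit : mvfderiv (𝓡 m).tangent f p (X p) = mvfderiv (𝓡 m).tangent f p (P.hor X p) +
        mvfderiv (𝓡 m).tangent f p (P.ver X p) := by
      rw [← map_add, ← Pi.add_apply, hor_add_ver]
    simp only [canonicalKoszul, hor_smul, ver_smul]
    rw [K.leibniz hf (P.diffFieldAt_hor hX) (P.diffFieldAt_hor hY) (P.diffFieldAt_hor hZ),
      K.leibniz hf (P.diffFieldAt_ver hX) (P.diffFieldAt_ver hY) (P.diffFieldAt_ver hZ),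
      P.mixed_smul_mid hf (P.diffFieldAt_hor hY) (P.diffFieldAt_hor hZ),
      P.mixed_smul_mid hf (P.diffFieldAt_ver hY) (P.diffFieldAt_ver hZ),
      P.g_eq_hor_add_ver Y Z, hsplit]
    ring
  smooth hX hY hZ := by
    have K := P.isKoszulForm_koszul
    exact (((K.smooth (P.smoothFieldAt_hor hX) (P.smoothFieldAt_hor hY)
      (P.smoothFieldAt_hor hZ)).add (K.smooth (P.smoothFieldAt_ver hX) (P.smoothFieldAt_ver hY)
      (P.smoothFieldAt_ver hZ))).add (P.contMDiffAt_mixed (P.smoothFieldAt_hor hX)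
      (P.smoothFieldAt_ver hY) (P.smoothFieldAt_ver hZ))).add (P.contMDiffAt_mixed
      (P.smoothFieldAt_ver hX) (P.smoothFieldAt_hor hY) (P.smoothFieldAt_hor hZ))

end PhaseGeometry

/-! ### The Levi-Civita connection and the canonical d-connection -/

section Existence

variable {m : ℕ} {V : Type*} [TopologicalSpace V] [ChartedSpace (EuclideanSpace ℝ (Fin m)) V]
  [IsManifold (𝓡 m) ∞ V] {p : Phase m V} {P : PhaseGeometry m V} {X Y Z : VField m V}

lemma IsKoszulForm.isMetricCompatible {Φ : VField m V → VField m V → VField m V → Phase m V → ℝ}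
    (hΦ : IsKoszulForm P Φ) (h : ∀ {p X Y Z}, DiffFieldAt X p → DiffFieldAt Y p →
      DiffFieldAt Z p → Φ X Y Z p + Φ X Z Y p = 2 * P.dg X Y Z p) :
    IsMetricCompatible P hΦ.connection := by
  intro p Y Z w hY hZ
  have hw := diffFieldAt_extendVec w
  have h1 := hΦ.two_mul_g_connection hw hY hZ
  have h2 := hΦ.two_mul_g_connection hw hZ hY
  have h3 := h hw hY hZ
  rw [PhaseGeometry.dg] at h3
  rw [extendVec_self] at h1 h2 h3
  rw [P.g_symm p (Y p)]
  linarith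

/-- Existence of the Levi-Civita connection. -/
theorem isLeviCivita_koszul (P : PhaseGeometry m V) :
    IsLeviCivita P P.isKoszulForm_koszul.connection := by
  refine ⟨P.isKoszulForm_koszul.isMetricCompatible fun _ _ _ => P.koszul_add_koszul, ?_⟩
  rw [CovariantDerivative.torsion_eq_zero_iff]
  intro X Y p hX hY
  refine P.eq_of_g_eq fun z => ?_
  have hz := diffFieldAt_extendVec z
  have h1 := P.isKoszulForm_koszul.two_mul_g_connection hX hY hz
  have h2 := P.isKoszulForm_koszul.two_mul_g_connection hY hX hz
  have h3 := P.koszul_sub_koszul (X := X) (Y := Y) (Z := extendVec z) (p := p)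
  rw [PhaseGeometry.bg] at h3
  rw [extendVec_self] at h1 h2 h3
  rw [map_sub, FunLike.coe_sub, Pi.sub_apply]
  linarith

/-- The Koszul formula: a Levi-Civita connection is determined by the metric. -/
lemma IsLeviCivita.two_mul_g {D : LinearConnection m V} (hD : IsLeviCivita P D)
    (hX : DiffFieldAt X p) (hY : DiffFieldAt Y p) (hZ : DiffFieldAt Z p) :
    2 * P.g p (D.cov Y p (X p)) (Z p) = P.koszul X Y Z p := by
  have tor {X Y Z : VField m V} (hX : DiffFieldAt X p) (hY : DiffFieldAt Y p) :
      P.g p (D.cov Y p (X p)) (Z p) - P.g p (D.cov X p (Y p)) (Z p) = P.bg X Y Z p := by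
    rw [PhaseGeometry.bg, ← (D.cov.torsion_eq_zero_iff.1 hD.2) hX hY, map_sub,
      FunLike.coe_sub, Pi.sub_apply]
  have met {X Y Z : VField m V} (hY : DiffFieldAt Y p) (hZ : DiffFieldAt Z p) :
      P.dg X Y Z p = P.g p (D.cov Y p (X p)) (Z p) + P.g p (D.cov Z p (X p)) (Y p) := by
    rw [PhaseGeometry.dg, hD.1 p Y Z (X p) hY hZ, P.g_symm p (Y p)]
  rw [PhaseGeometry.koszul, met hY hZ, met hX hZ, met hX hY, ← tor hX hY, ← tor hX hZ, ← tor hY hZ]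
  ring

lemma IsLeviCivita.cov_eq {D D' : LinearConnection m V} (hD : IsLeviCivita P D)
    (hD' : IsLeviCivita P D') (hY : DiffFieldAt Y p) : D.cov Y p = D'.cov Y p := by
  ext1 x
  refine P.eq_of_g_eq fun z => ?_
  have h1 := hD.two_mul_g (diffFieldAt_extendVec x) hY (diffFieldAt_extendVec z)
  have h2 := hD'.two_mul_g (diffFieldAt_extendVec x) hY (diffFieldAt_extendVec z)
  rw [extendVec_self, extendVec_self] at h1 h2
  linarith

lemma torsion_eq_of_cov_eq {D D' : LinearConnection m V}
    (h : ∀ (p : Phase m V) (Y : VField m V), DiffFieldAt Y p → D.cov Y p = D'.cov Y p) :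
    D.cov.torsion = D'.cov.torsion := by
  funext p
  ext1 v
  ext1 w
  rw [CovariantDerivative.torsion_apply_eq_extend, CovariantDerivative.torsion_apply_eq_extend]
  have hv := h p _ (diffFieldAt_extendVec v)
  have hw := h p _ (diffFieldAt_extendVec w)
  unfold extendVec at hv hw
  rw [hv, hw]

namespace PhaseGeometry

lemma koszul_zero_left : P.koszul 0 Y Z p = 0 := by
  simp [koszul, dg_zero_left, dg_zero_mid, bg_zero_left, bg_zero_right]

lemma koszul_zero_mid : P.koszul X 0 Z p = 0 := by
  simp [koszul, dg_zero_left, dg_zero_mid, dg_zero_right, bg_zero_left, bg_zero_mid, bg_zero_right]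

lemma koszul_zero_right : P.koszul X Y 0 p = 0 := by
  simp [koszul, dg_zero_left, dg_zero_right, bg_zero_mid, bg_zero_right]

lemma mixed_zero_left : P.mixed 0 Y Z p = 0 := by
  simp [mixed, dg_zero_left, bg_zero_left]

lemma mixed_zero_mid : P.mixed X 0 Z p = 0 := by
  simp [mixed, dg_zero_mid, bg_zero_mid, bg_zero_right]

lemma mixed_zero_right : P.mixed X Y 0 p = 0 := by
  simp [mixed, dg_zero_right, bg_zero_mid, bg_zero_right]

lemma g_h_left (v w : TangentSpace (𝓡 m).tangent p) : P.g p (P.h p v) w = P.g p v (P.h p w) := by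
  have h1 := P.g_hor_ver (fun q => extendVec v q) (extendVec w) p
  have h2 := P.g_ver_hor (fun q => extendVec v q) (extendVec w) p
  simp only [hor, ver, extendVec_self, map_sub, FunLike.coe_sub, Pi.sub_apply] at h1 h2
  linarith

lemma h_eq_zero_of_isVertical {v : TangentSpace (𝓡 m).tangent p} (h : IsVertical v) :
    P.h p v = 0 := (P.h_ker p v).2 h

end PhaseGeometry

/-- Existence of the canonical d-connection. -/
theorem isCanonical_canonicalKoszul (P : PhaseGeometry m V) :
    IsCanonical P P.isKoszulForm_canonicalKoszul.connection := by
  have K {p : Phase m V} {X Y Z : VField m V} (hX : DiffFieldAt X p) (hY : DiffFieldAt Y p)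
      (hZ : DiffFieldAt Z p) :=
    P.isKoszulForm_canonicalKoszul.two_mul_g_connection hX hY hZ
  set D := P.isKoszulForm_canonicalKoszul.connection with hD
  constructor
  -- the splitting is preserved
  · intro p Y w hY
    refine P.eq_of_g_eq fun z => ?_
    have hw := diffFieldAt_extendVec w
    have hz := diffFieldAt_extendVec z
    have h1 := K hw (P.diffFieldAt_hor hY) hz
    have h2 := K hw hY (P.diffFieldAt_hor hz)
    have h3 : P.hor (extendVec z) p = P.h p z := by rw [PhaseGeometry.hor, extendVec_self]
    simp only [PhaseGeometry.canonicalKoszul, P.hor_hor, P.ver_hor, P.koszul_zero_mid,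
      P.koszul_zero_right, P.mixed_zero_mid, P.mixed_zero_right, extendVec_self, h3] at h1 h2
    rw [P.g_h_left]
    linarith
  -- metric compatibility
  · refine P.isKoszulForm_canonicalKoszul.isMetricCompatible fun {p X Y Z} hX hY hZ => ?_
    have h1 := P.koszul_add_koszul (X := P.hor X) (Y := P.hor Y) (Z := P.hor Z) (p := p)
    have h2 := P.koszul_add_koszul (X := P.ver X) (Y := P.ver Y) (Z := P.ver Z) (p := p)
    have h3 := P.mixed_add_mixed (X := P.hor X) (Y := P.ver Y) (Z := P.ver Z) (p := p)
    have h4 := P.mixed_add_mixed (X := P.ver X) (Y := P.hor Y) (Z := P.hor Z) (p := p)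
    have h5 : P.dg X Y Z p = P.dg X (P.hor Y) (P.hor Z) p + P.dg X (P.ver Y) (P.ver Z) p := by
      simp only [PhaseGeometry.dg]
      rw [show (fun q => P.g q (Y q) (Z q)) = fun q => P.g q (P.hor Y q) (P.hor Z q) +
        P.g q (P.ver Y q) (P.ver Z q) from funext (P.g_eq_hor_add_ver Y Z),
        mvfderiv_fun_add (P.mdifferentiableAt_g (P.diffFieldAt_hor hY) (P.diffFieldAt_hor hZ))
          (P.mdifferentiableAt_g (P.diffFieldAt_ver hY) (P.diffFieldAt_ver hZ))]
      rfl
    have h6 (A B : VField m V) : P.dg X A B p = P.dg (P.hor X) A B p + P.dg (P.ver X) A B p := by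
      rw [← P.dg_add_left, P.hor_add_ver]
    rw [h5, h6, h6]
    simp only [PhaseGeometry.canonicalKoszul]
    linarith
  -- the horizontal part of the torsion vanishes on horizontal vectors
  · intro p x y
    refine P.eq_of_g_eq fun z => ?_
    have hx := diffFieldAt_extendVec x
    have hy := diffFieldAt_extendVec y
    have hz := diffFieldAt_extendVec z
    have e (v : TangentSpace (𝓡 m).tangent p) : P.hor (extendVec v) p = P.h p v := by
      rw [PhaseGeometry.hor, extendVec_self]
    have h1 := K (P.diffFieldAt_hor hx) (P.diffFieldAt_hor hy) (P.diffFieldAt_hor hz)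
    have h2 := K (P.diffFieldAt_hor hy) (P.diffFieldAt_hor hx) (P.diffFieldAt_hor hz)
    have h3 := P.koszul_sub_koszul (X := P.hor (extendVec x)) (Y := P.hor (extendVec y))
      (Z := P.hor (extendVec z)) (p := p)
    have h4 := D.cov.torsion_apply (P.diffFieldAt_hor hx) (P.diffFieldAt_hor hy)
    simp only [PhaseGeometry.canonicalKoszul, P.hor_hor, P.ver_hor, P.koszul_zero_left,
      P.mixed_zero_left, P.mixed_zero_mid, e] at h1 h2 h3 h4
    rw [PhaseGeometry.bg, e] at h3
    rw [P.g_h_left, h4, map_sub, map_sub, FunLike.coe_sub, Pi.sub_apply, FunLike.coe_sub,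
      Pi.sub_apply, map_zero]
    change _ = (0 : ℝ)
    linarith
  -- the vertical part of the torsion vanishes on vertical vectors
  · intro p x y hvx hvy
    refine P.eq_of_g_eq fun z => ?_
    have hx := diffFieldAt_extendVec x
    have hy := diffFieldAt_extendVec y
    have hz := diffFieldAt_extendVec z
    have e (v : TangentSpace (𝓡 m).tangent p) (hv : IsVertical v) :
        P.ver (extendVec v) p = v := by
      rw [PhaseGeometry.ver, extendVec_self, P.h_eq_zero_of_isVertical hv, sub_zero]
    have e' : P.ver (extendVec z) p = z - P.h p z := by rw [PhaseGeometry.ver, extendVec_self]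
    have h1 := K (P.diffFieldAt_ver hx) (P.diffFieldAt_ver hy) (P.diffFieldAt_ver hz)
    have h2 := K (P.diffFieldAt_ver hy) (P.diffFieldAt_ver hx) (P.diffFieldAt_ver hz)
    have h3 := P.koszul_sub_koszul (X := P.ver (extendVec x)) (Y := P.ver (extendVec y))
      (Z := P.ver (extendVec z)) (p := p)
    have h4 := D.cov.torsion_apply (P.diffFieldAt_ver hx) (P.diffFieldAt_ver hy)
    simp only [PhaseGeometry.canonicalKoszul, P.hor_ver, P.ver_ver, P.koszul_zero_left,
      P.mixed_zero_left, P.mixed_zero_mid, e x hvx, e y hvy, e'] at h1 h2 h3 h4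
    rw [PhaseGeometry.bg, e'] at h3
    have h5 : P.g p (D.cov.torsion p x y) (z - P.h p z) = 0 := by
      rw [h4, map_sub (P.g p), map_sub (P.g p), FunLike.coe_sub, Pi.sub_apply, FunLike.coe_sub,
        Pi.sub_apply]
      linarith
    rw [map_sub] at h5
    rw [P.g_h_left]
    linarith
  -- the mixed coefficients `L^a_{bk}`
  · intro p X Y Z hX hY hZ
    have h1 := K (P.diffFieldAt_hor hX) (P.diffFieldAt_ver hY) (P.diffFieldAt_ver hZ)
    rw [h1, P.g_symm p (P.ver Y p)]
    simp only [PhaseGeometry.canonicalKoszul, P.hor_ver, P.ver_ver, P.hor_hor, P.ver_hor,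
      P.koszul_zero_left, P.koszul_zero_mid, P.mixed_zero_left]
    simp [PhaseGeometry.mixed, PhaseGeometry.dg, PhaseGeometry.bg]
  -- the mixed coefficients `C^i_{jc}`
  · intro p X Y Z hX hY hZ
    have h1 := K (P.diffFieldAt_ver hX) (P.diffFieldAt_hor hY) (P.diffFieldAt_hor hZ)
    rw [h1, P.g_symm p (P.hor Y p)]
    simp only [PhaseGeometry.canonicalKoszul, P.hor_ver, P.ver_ver, P.hor_hor, P.ver_hor,
      P.koszul_zero_left, P.koszul_zero_mid, P.mixed_zero_left]
    simp [PhaseGeometry.mixed, PhaseGeometry.dg, PhaseGeometry.bg]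

end Existence

/-! ### The Hausdorff property of the phase space -/

section Hausdorff

variable {m : ℕ} {V : Type*} [TopologicalSpace V] [ChartedSpace (EuclideanSpace ℝ (Fin m)) V]
  [IsManifold (𝓡 m) ∞ V]

/-- The total space of the tangent bundle of a Hausdorff manifold is Hausdorff. -/
lemma t2Space_phase [T2Space V] : T2Space (Phase m V) := by
  refine ⟨fun x y hxy => ?_⟩
  have hc : Continuous (fun q : Phase m V => q.proj) := FiberBundle.continuous_proj _ _
  -- points of one fibre are separated in a trivialization, others by the base
  by_cases h : x.proj = y.proj
  · let e := trivializationAt (EuclideanSpace ℝ (Fin m)) (TangentSpace (𝓡 m) : V → Type _) x.proj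
    have hx : x ∈ e.source := by
      rw [e.mem_source]; exact FiberBundle.mem_baseSet_trivializationAt' x.proj
    have hy : y ∈ e.source := by
      rw [e.mem_source]; rw [← h]; exact FiberBundle.mem_baseSet_trivializationAt' x.proj
    have hne : (e x).2 ≠ (e y).2 := by
      intro h2
      refine hxy (e.injOn hx hy ?_)
      refine Prod.ext ?_ h2
      exact (e.coe_fst hx).trans (h.trans (e.coe_fst hy).symm)
    obtain ⟨A, B, hA, hB, hxA, hyB, hAB⟩ := t2_separation hne
    have hcont : ContinuousOn (fun q => (e q).2) e.source := continuous_snd.comp_continuousOn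
      e.continuousOn
    refine ⟨_, _, hcont.isOpen_inter_preimage e.open_source hA,
      hcont.isOpen_inter_preimage e.open_source hB, ⟨hx, hxA⟩, ⟨hy, hyB⟩, ?_⟩
    exact (hAB.preimage _).mono Set.inter_subset_right Set.inter_subset_right
  · obtain ⟨A, B, hA, hB, hxA, hyB, hAB⟩ := t2_separation h
    exact ⟨_, _, hA.preimage hc, hB.preimage hc, hxA, hyB, hAB.preimage _⟩

end Hausdorff

attribute [local instance] t2Space_phase

/-! ### Distortion of a connection, its curvature and its Ricci tensor -/

section Regularity

variable {m : ℕ} {V : Type*} [TopologicalSpace V] [ChartedSpace (EuclideanSpace ℝ (Fin m)) V]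
  [IsManifold (𝓡 m) ∞ V] {p₀ p : Phase m V} {X Y Z W : VField m V}

/-- The vector field `X` is smooth on a neighbourhood of `p`. -/
def SmoothNear (X : VField m V) (p : Phase m V) : Prop := ∀ᶠ q in 𝓝 p, SmoothFieldAt X q

lemma SmoothNear.smoothFieldAt (h : SmoothNear X p) : SmoothFieldAt X p := h.self_of_nhds

lemma SmoothNear.diffFieldAt (h : SmoothNear X p) : DiffFieldAt X p := h.smoothFieldAt.diffFieldAt

lemma SmoothNear.eventually (h : SmoothNear X p) : ∀ᶠ q in 𝓝 p, SmoothNear X q :=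
  Filter.Eventually.eventually_nhds h

lemma SmoothNear.congr (h : SmoothNear X p) (hXY : ∀ᶠ q in 𝓝 p, Y q = X q) : SmoothNear Y p := by
  filter_upwards [h, hXY.eventually_nhds] with q hq hq' using hq.congr hq'

lemma smoothNear_coordVec (hp : p ∈ chartDomain p₀) (α : Fin m ⊕ Fin m) :
    SmoothNear (coordVec p₀ α) p := by
  filter_upwards [eventually_mem_chartDomain hp] with q hq using smoothFieldAt_coordVec hq α

lemma coordVec_self (p : Phase m V) (α : Fin m ⊕ Fin m) : coordVec p α p = frame p α := by
  have h := mfderiv_extChartAt_coordVec (mem_chartDomain p) α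
  rwa [mfderiv_extChartAt_self] at h

lemma coordCoef_self (p : Phase m V) (α : Fin m ⊕ Fin m) (v : TangentSpace (𝓡 m).tangent p) :
    coordCoef p α p v = coframe p α v := by
  have h := congrArg ((modelBasis m).coord α) (eq_sum_coordCoef (mem_chartDomain p) v)
  refine Eq.trans ?_ h.symm
  simp only [coordVec_self]
  have h2 (β) : (modelBasis m).coord α (coordCoef p β p v • frame p β) =
      if β = α then coordCoef p β p v else 0 := by
    refine (map_smul ((modelBasis m).coord α) _ _).trans ?_
    rw [frame, Module.Basis.coord_apply, Module.Basis.repr_self, Finsupp.single_apply]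
    simp
  refine Eq.trans ?_ (map_sum ((modelBasis m).coord α) _ _).symm
  rw [Finset.sum_congr rfl fun β _ => h2 β]
  simp

lemma smoothNear_extendVec (v : TangentSpace (𝓡 m).tangent p) : SmoothNear (extendVec v) p := by
  obtain ⟨s, hs, h⟩ := FiberBundle.exists_contMDiffOn_extend (k := ∞) (𝓡 m).tangent (Model m) v
  filter_upwards [eventually_mem_nhds_iff.2 hs] with q hq
  exact (h q (mem_of_mem_nhds hq)).contMDiffAt hq

lemma LinearConnection.cov_congr (D : LinearConnection m V) (hX : DiffFieldAt X p)
    (hXY : ∀ᶠ q in 𝓝 p, Y q = X q) : D.cov Y p = D.cov X p :=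
  D.cov.isCovariantDerivativeOnUniv.congr_of_eventuallyEq (hX.congr hXY) hX Filter.univ_mem hXY

lemma distortion_apply (D' D : LinearConnection m V) (hW : DiffFieldAt W p) :
    distortion D' D p (W p) = D'.cov W p - D.cov W p :=
  IsCovariantDerivativeOn.difference_apply D'.cov.isCovariantDerivativeOnUniv
    D.cov.isCovariantDerivativeOnUniv trivial hW

variable [T2Space V]

/-- The covariant derivative of a field that is smooth near `p` is a smooth field of endomorphisms
near `p`. -/
lemma LinearConnection.contMDiffAt_cov (D : LinearConnection m V) (hW : SmoothNear W p) :
    ContMDiffAt (𝓡 m).tangent ((𝓡 m).tangent.prod 𝓘(ℝ, Model m →L[ℝ] Model m)) ∞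
      (fun q => Bundle.TotalSpace.mk' (Model m →L[ℝ] Model m)
        (E := fun q : Phase m V => TangentSpace (𝓡 m).tangent q →L[ℝ] TangentSpace (𝓡 m).tangent q)
        q (D.cov W q)) p := by
  obtain ⟨s, hs, hso, hps⟩ := eventually_nhds_iff.1 hW
  -- cut the field off outside the neighbourhood on which it is smooth
  obtain ⟨ρ, -, hρ⟩ := ((SmoothBumpFunction.nhds_basis_tsupport (I := (𝓡 m).tangent) p).mem_iff.1
    (hso.mem_nhds hps))
  have hg : ∀ q, SmoothFieldAt ((ρ : Phase m V → ℝ) • W) q := by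
    intro q
    by_cases hq : q ∈ tsupport ρ
    · exact SmoothFieldAt.smul ρ.contMDiff.contMDiffAt (hs q (hρ hq))
    · have h0 : ∀ᶠ y in 𝓝 q, ((ρ : Phase m V → ℝ) • W) y = 0 := by
        filter_upwards [(isClosed_tsupport ρ).isOpen_compl.mem_nhds hq] with y hy
        rw [Pi.smul_apply', image_eq_zero_of_notMem_tsupport hy, zero_smul]
      have hz : SmoothFieldAt (0 : VField m V) q :=
        (Bundle.contMDiff_zeroSection ℝ
          (TangentSpace (𝓡 m).tangent : Phase m V → Type _)).contMDiffAt
      exact hz.congr h0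
  have h1 := D.smooth.contMDiff.contMDiff (σ := (ρ : Phase m V → ℝ) • W)
    (fun q _ => (hg q).contMDiffWithinAt)
  refine ((h1 p trivial).contMDiffAt Filter.univ_mem).congr_of_eventuallyEq ?_
  filter_upwards [hW, ρ.eventuallyEq_one.eventually_nhds] with q hq hq1
  have : D.cov W q = D.cov ((ρ : Phase m V → ℝ) • W) q := by
    refine D.cov.isCovariantDerivativeOnUniv.congr_of_eventuallyEq hq.diffFieldAt
      (hg q).diffFieldAt Filter.univ_mem ?_
    filter_upwards [hq1] with y hy
    rw [Pi.smul_apply', hy, Pi.one_apply, one_smul]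
  rw [this]

lemma LinearConnection.smoothFieldAt_cov (D : LinearConnection m V) (hW : SmoothNear W p)
    (hX : SmoothFieldAt X p) : SmoothFieldAt (fun q => D.cov W q (X q)) p :=
  ContMDiffAt.clm_bundle_apply (D.contMDiffAt_cov hW) hX

lemma LinearConnection.smoothNear_cov (D : LinearConnection m V) (hW : SmoothNear W p)
    (hX : SmoothNear X p) : SmoothNear (fun q => D.cov W q (X q)) p := by
  filter_upwards [hW.eventually, hX] with q h1 h2 using D.smoothFieldAt_cov h1 h2

/-- The second covariant derivatives of two connections `D` and `D + S`. -/
lemma cov_cov_eq_of_distortion (D' D : LinearConnection m V) {S : Tensor12 m V}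
    (hS : ∀ {q : Phase m V} {W : VField m V}, DiffFieldAt W q →
      D'.cov W q = D.cov W q + S q (W q))
    (hY : SmoothNear Y p) (hW : SmoothNear W p) :
    D'.cov (fun q => D'.cov W q (Y q)) p (X p) = D.cov (fun q => D.cov W q (Y q)) p (X p)
      + D.cov (fun q => S q (W q) (Y q)) p (X p) + S p (D.cov W p (Y p)) (X p)
      + S p (S p (W p) (Y p)) (X p) := by
  have hA' := (D'.smoothNear_cov hW hY).diffFieldAt
  have hA := (D.smoothNear_cov hW hY).diffFieldAt
  have hZ : ∀ᶠ q in 𝓝 p, S q (W q) (Y q) =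
      ((fun q => D'.cov W q (Y q)) - fun q => D.cov W q (Y q) : VField m V) q := by
    filter_upwards [hW] with q hq
    rw [Pi.sub_apply, hS hq.diffFieldAt, FunLike.coe_add, Pi.add_apply]
    exact (add_sub_cancel_left _ _).symm
  have hB : DiffFieldAt (fun q => S q (W q) (Y q)) p := (hA'.sub hA).congr hZ
  have h2 : D.cov (fun q => D'.cov W q (Y q)) p = D.cov (fun q => D.cov W q (Y q)) p +
      D.cov (fun q => S q (W q) (Y q)) p := by
    rw [← D.cov.isCovariantDerivativeOnUniv.add hA hB]
    refine D.cov_congr (hA.add hB) ?_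
    filter_upwards [hZ] with q hq
    rw [Pi.add_apply, hq, Pi.sub_apply]
    exact (add_sub_cancel _ _).symm
  rw [hS hA', h2, hS hW.diffFieldAt]
  simp only [FunLike.coe_add, Pi.add_apply, map_add]
  exact (add_assoc _ _ _).symm

/-- Under a change of the connection the curvature changes by `distCurvature`. -/
lemma curvature_eq_add_distCurvature (D' D : LinearConnection m V) {S : Tensor12 m V}
    (hS : ∀ {q : Phase m V} {W : VField m V}, DiffFieldAt W q →
      D'.cov W q = D.cov W q + S q (W q)) (hX : SmoothNear X p)
    (hY : SmoothNear Y p) (hW : SmoothNear W p) :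
    curvature D' X Y W p = curvature D X Y W p + distCurvature D S X Y W p := by
  have h1 := cov_cov_eq_of_distortion D' D hS (X := X) hY hW
  have h2 := cov_cov_eq_of_distortion D' D hS (X := Y) hX hW
  have h3 := D.cov.torsion_apply hX.diffFieldAt hY.diffFieldAt
  have h4 : S p (W p) (D.cov.torsion p (X p) (Y p)) = S p (W p) (D.cov Y p (X p)) -
      S p (W p) (D.cov X p (Y p)) - S p (W p) (VectorField.mlieBracket (𝓡 m).tangent X Y p) := by
    rw [h3, map_sub, map_sub]
  have h5 : D'.cov W p (VectorField.mlieBracket (𝓡 m).tangent X Y p) =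
      D.cov W p (VectorField.mlieBracket (𝓡 m).tangent X Y p) +
      S p (W p) (VectorField.mlieBracket (𝓡 m).tangent X Y p) := by
    rw [hS hW.diffFieldAt, FunLike.coe_add, Pi.add_apply]
  unfold curvature distCurvature covTensor
  rw [h1, h2, h4, h5]
  module

/-- The Ricci tensor of `D' = D + Z` is that of `D` plus the distortion of `Z`. -/
theorem ricci_eq_add_distRicci (D' D : LinearConnection m V) (p : Phase m V)
    (v w : TangentSpace (𝓡 m).tangent p) :
    ricci D' p v w = ricci D p v w + distRicci D (distortion D' D) p v w := by
  rw [ricci, ricci, distRicci, ← Finset.sum_add_distrib]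
  refine Finset.sum_congr rfl fun τ _ => ?_
  rw [curvature_eq_add_distCurvature D' D (S := distortion D' D)
    (fun hW => by rw [distortion_apply D' D hW]; exact (add_sub_cancel _ _).symm)
    (smoothNear_extendVec _) (smoothNear_extendVec _) (smoothNear_extendVec _)]
  exact map_add ((modelBasis m).coord τ) _ _

end Regularity

/-! ### Curvature in charts -/

section CurvatureTensor

variable {m : ℕ} {V : Type*} [TopologicalSpace V] [ChartedSpace (EuclideanSpace ℝ (Fin m)) V]
  [IsManifold (𝓡 m) ∞ V] {p₀ p : Phase m V} {X Y Z W : VField m V}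

/-- The Christoffel symbols `Γ^d_{cb}` at `q` of a linear connection in the chart around `p₀`:
`D_{∂_b} ∂_c = Γ^d_{cb} ∂_d`. -/
def chartSymbol (D : LinearConnection m V) (p₀ q : Phase m V) (d c b : Fin m ⊕ Fin m) : ℝ :=
  coordCoef p₀ d q (D.cov (coordVec p₀ c) q (coordVec p₀ b q))

lemma coordCoef_sum_smul (hp : p ∈ chartDomain p₀) (f : Fin m ⊕ Fin m → ℝ) (α : Fin m ⊕ Fin m) :
    coordCoef p₀ α p (∑ β, f β • coordVec p₀ β p) = f α := by
  rw [map_sum]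
  simp only [map_smul, coordCoef_coordVec hp, smul_eq_mul, mul_ite, mul_one, mul_zero]
  rw [Finset.sum_ite_eq]
  simp

lemma LinearConnection.cov_sum_smul (D : LinearConnection m V) {ι : Type*} [Fintype ι]
    {f : ι → Phase m V → ℝ} {X : ι → VField m V}
    (hf : ∀ i, MDifferentiableAt (𝓡 m).tangent 𝓘(ℝ, ℝ) (f i) p) (hX : ∀ i, DiffFieldAt (X i) p)
    (v : TangentSpace (𝓡 m).tangent p) :
    D.cov (fun q => ∑ i, f i q • X i q) p v =
      ∑ i, (f i p • D.cov (X i) p v + mvfderiv (𝓡 m).tangent (f i) p v • X i p) := by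
  classical
  have h (s : Finset ι) : D.cov (fun q => ∑ i ∈ s, f i q • X i q) p v =
      ∑ i ∈ s, (f i p • D.cov (X i) p v + mvfderiv (𝓡 m).tangent (f i) p v • X i p) := by
    induction s using Finset.induction_on with
    | empty =>
      simp only [Finset.sum_empty]
      exact congrArg (fun L : TangentSpace (𝓡 m).tangent p →L[ℝ] TangentSpace (𝓡 m).tangent p =>
        L v)
        D.cov.isCovariantDerivativeOnUniv.zero
    | insert i s hi ih =>
      have hs : DiffFieldAt (fun q => ∑ i ∈ s, f i q • X i q) p :=
        MDifferentiableAt.sum_section (I := (𝓡 m).tangent) (F := Model m)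
          (E := (TangentSpace (𝓡 m).tangent : Phase m V → Type _)) (s := s)
          (t := fun i q => f i q • X i q) (x₀ := p) (fun i _ => DiffFieldAt.smul (hf i) (hX i))
      have h1 : (fun q => ∑ j ∈ insert i s, f j q • X j q : VField m V) =
          f i • X i + fun q => ∑ j ∈ s, f j q • X j q := by
        funext q
        exact Finset.sum_insert hi
      rw [h1, D.cov.isCovariantDerivativeOnUniv.add (DiffFieldAt.smul (hf i) (hX i)) hs,
        D.cov.isCovariantDerivativeOnUniv.leibniz (hX i) (hf i), FunLike.coe_add, Pi.add_apply, ih,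
        Finset.sum_insert hi]
      rfl
  exact h Finset.univ

/-- The components of a covariant derivative in a chart. -/
lemma coordCoef_cov (D : LinearConnection m V) (hp : p ∈ chartDomain p₀) (hW : DiffFieldAt W p)
    (d b : Fin m ⊕ Fin m) :
    coordCoef p₀ d p (D.cov W p (coordVec p₀ b p)) =
      mvfderiv (𝓡 m).tangent (fun q => coordCoef p₀ d q (W q)) p (coordVec p₀ b p) +
      ∑ c, chartSymbol D p₀ p d c b * coordCoef p₀ c p (W p) := by
  have h1 : D.cov W p = D.cov (fun q => ∑ c, coordCoef p₀ c q (W q) • coordVec p₀ c q) p := by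
    refine (D.cov_congr hW ?_).symm
    filter_upwards [eventually_mem_chartDomain hp] with q hq using (eq_sum_coordCoef hq (W q)).symm
  rw [h1, D.cov_sum_smul (f := fun c q => coordCoef p₀ c q (W q)) (X := coordVec p₀)
    (fun c => mdifferentiableAt_coordCoef hp hW c) (fun c => diffFieldAt_coordVec hp c),
    Finset.sum_add_distrib, map_add, coordCoef_sum_smul hp, map_sum, add_comm]
  congr 1
  refine Finset.sum_congr rfl fun c _ => ?_
  rw [map_smul, smul_eq_mul, mul_comm]
  rfl

lemma curvature_swap (D : LinearConnection m V) (X Y W : VField m V) (p : Phase m V) :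
    curvature D X Y W p = - curvature D Y X W p := by
  unfold curvature
  rw [VectorField.mlieBracket_swap_apply, map_neg]
  module

section
variable [T2Space V]

lemma LinearConnection.diffFieldAt_cov (D : LinearConnection m V) (hW : SmoothNear W p)
    (hX : DiffFieldAt X p) : DiffFieldAt (fun q => D.cov W q (X q)) p :=
  MDifferentiableAt.clm_bundle_apply ((D.contMDiffAt_cov hW).mdifferentiableAt (by simp)) hX

lemma tensorialAt_curvature_left (D : LinearConnection m V) (hW : SmoothNear W p) :
    TensorialAt (𝓡 m).tangent (Model m) (fun X => curvature D X Y W p) p where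
  smul {f X} hf hX := by
    have h1 : D.cov (fun q => D.cov W q ((f • X) q)) p =
        f p • D.cov (fun q => D.cov W q (X q)) p +
          (mvfderiv (𝓡 m).tangent f p).smulRight (D.cov W p (X p)) := by
      rw [← D.cov.isCovariantDerivativeOnUniv.leibniz (D.diffFieldAt_cov hW hX) hf]
      congr 1
      funext q
      exact map_smul (D.cov W q) _ _
    have h2 := VectorField.mlieBracket_smul_left (W := Y) hf hX
    unfold curvature
    rw [h1, h2]
    simp only [FunLike.coe_add, Pi.add_apply, FunLike.coe_smul, Pi.smul_apply,
      ContinuousLinearMap.smulRight_apply, Pi.smul_apply', map_add, map_smul, neg_smul, map_neg]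
    module
  add {X X'} hX hX' := by
    have h1 : D.cov (fun q => D.cov W q ((X + X') q)) p =
        D.cov (fun q => D.cov W q (X q)) p + D.cov (fun q => D.cov W q (X' q)) p := by
      rw [← D.cov.isCovariantDerivativeOnUniv.add (D.diffFieldAt_cov hW hX)
        (D.diffFieldAt_cov hW hX')]
      congr 1
      funext q
      exact map_add (D.cov W q) _ _
    have h2 := VectorField.mlieBracket_add_left (W := Y) hX hX'
    unfold curvature
    rw [h1, h2]
    simp only [FunLike.coe_add, Pi.add_apply, map_add]
    module

lemma tensorialAt_curvature_right (D : LinearConnection m V) (hW : SmoothNear W p) :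
    TensorialAt (𝓡 m).tangent (Model m) (fun Y => curvature D X Y W p) p where
  smul hf hY := by
    rw [curvature_swap, (tensorialAt_curvature_left D hW).smul hf hY, curvature_swap D X,
      smul_neg]
  add hY hY' := by
    rw [curvature_swap, (tensorialAt_curvature_left D hW).add hY hY', curvature_swap D X,
      curvature_swap D X, neg_add]

/-- `R(X, Y) W` at `p` as a bilinear function of the values of `X` and `Y` at `p`. -/
def curvatureHom (D : LinearConnection m V) (hW : SmoothNear W p) :
    TangentSpace (𝓡 m).tangent p →L[ℝ] TangentSpace (𝓡 m).tangent p →L[ℝ]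
      TangentSpace (𝓡 m).tangent p :=
  TensorialAt.mkHom₂ (I := (𝓡 m).tangent) (F := Model m) (F' := Model m)
    (fun X Y => curvature D X Y W p) p
    (fun _ _ => tensorialAt_curvature_left D hW) (fun _ _ => tensorialAt_curvature_right D hW)

lemma curvatureHom_apply (D : LinearConnection m V) (hW : SmoothNear W p) (hX : DiffFieldAt X p)
    (hY : DiffFieldAt Y p) : curvatureHom D hW (X p) (Y p) = curvature D X Y W p :=
  TensorialAt.mkHom₂_apply _ _ hX hY

lemma contMDiffAt_chartSymbol (D : LinearConnection m V) (hp : p ∈ chartDomain p₀)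
    (d c b : Fin m ⊕ Fin m) :
    ContMDiffAt (𝓡 m).tangent 𝓘(ℝ, ℝ) ∞ (fun q => chartSymbol D p₀ q d c b) p :=
  contMDiffAt_coordCoef hp (D.smoothFieldAt_cov (smoothNear_coordVec hp c)
    (smoothFieldAt_coordVec hp b)) d

end

lemma contDiffAt_comp_chart_symm {f : Phase m V → ℝ} (hp : p ∈ chartDomain p₀)
    (hf : ContMDiffAt (𝓡 m).tangent 𝓘(ℝ, ℝ) ∞ f p) :
    ContDiffAt ℝ ∞ (f ∘ (extChartAt (𝓡 m).tangent p₀).symm) (extChartAt (𝓡 m).tangent p₀ p) := by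
  rw [← contMDiffAt_iff_contDiffAt]
  refine ContMDiffAt.comp _ ?_ (contMDiffAt_chart_symm (n := ⊤) hp)
  rwa [(extChartAt (𝓡 m).tangent p₀).left_inv hp]

lemma eventually_chart_symm (hp : p ∈ chartDomain p₀) {S : Phase m V → Prop}
    (hS : ∀ᶠ q in 𝓝 p, S q) :
    ∀ᶠ y in 𝓝 (extChartAt (𝓡 m).tangent p₀ p), S ((extChartAt (𝓡 m).tangent p₀).symm y) ∧
      (extChartAt (𝓡 m).tangent p₀).symm y ∈ chartDomain p₀ ∧
      extChartAt (𝓡 m).tangent p₀ ((extChartAt (𝓡 m).tangent p₀).symm y) = y := by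
  have hc := (contMDiffAt_chart_symm (n := 0) hp).continuousAt
  have h1 := (extChartAt (𝓡 m).tangent p₀).map_source hp
  have h2 : Filter.Tendsto (extChartAt (𝓡 m).tangent p₀).symm
      (𝓝 (extChartAt (𝓡 m).tangent p₀ p)) (𝓝 p) := by
    have := hc.tendsto
    rwa [(extChartAt (𝓡 m).tangent p₀).left_inv hp] at this
  filter_upwards [h2.eventually hS, (isOpen_extChartAt_target p₀).mem_nhds h1] with y hy hy'
  exact ⟨hy, (extChartAt (𝓡 m).tangent p₀).map_target hy',
    (extChartAt (𝓡 m).tangent p₀).right_inv hy'⟩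

/-- The trace of an endomorphism of the tangent space can be computed in any chart. -/
lemma sum_coordCoef_map {p₁ : Phase m V} (hp : p ∈ chartDomain p₀) (hp₁ : p ∈ chartDomain p₁)
    (M : TangentSpace (𝓡 m).tangent p →ₗ[ℝ] TangentSpace (𝓡 m).tangent p) :
    ∑ τ, coordCoef p₁ τ p (M (coordVec p₁ τ p)) = ∑ τ, coordCoef p₀ τ p (M (coordVec p₀ τ p)) := by
  have h (τ) : coordCoef p₁ τ p (M (coordVec p₁ τ p)) =
      ∑ a, coordCoef p₀ a p (coordVec p₁ τ p) * coordCoef p₁ τ p (M (coordVec p₀ a p)) := by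
    conv_lhs => rw [eq_sum_coordCoef hp (coordVec p₁ τ p)]
    rw [map_sum, map_sum]
    refine Finset.sum_congr rfl fun a _ => ?_
    rw [map_smul, map_smul, smul_eq_mul]
  simp only [h]
  rw [Finset.sum_comm]
  refine Finset.sum_congr rfl fun a _ => ?_
  conv_rhs => rw [eq_sum_coordCoef hp₁ (M (coordVec p₀ a p))]
  rw [map_sum]
  refine Finset.sum_congr rfl fun τ _ => ?_
  rw [map_smul, smul_eq_mul, mul_comm]

variable [T2Space V]

/-- The components of a second covariant derivative in coordinate directions. -/
lemma coordCoef_cov_cov (D : LinearConnection m V) (hp : p ∈ chartDomain p₀) (hW : SmoothNear W p)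
    {w : Fin m ⊕ Fin m → Model m → ℝ}
    (hw : ∀ α, w α = (fun q => coordCoef p₀ α q (W q)) ∘ (extChartAt (𝓡 m).tangent p₀).symm)
    {γ : Model m → Fin m ⊕ Fin m → Fin m ⊕ Fin m → Fin m ⊕ Fin m → ℝ}
    (hγ : γ = chartSymbol D p₀ ∘ (extChartAt (𝓡 m).tangent p₀).symm) {u : Model m}
    (hu : u = extChartAt (𝓡 m).tangent p₀ p) (d a b : Fin m ⊕ Fin m) :
    coordCoef p₀ d p (D.cov (fun q => D.cov W q (coordVec p₀ b q)) p (coordVec p₀ a p)) =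
      fderiv ℝ (fun y => fderiv ℝ (w d) y (modelBasis m b)) u (modelBasis m a) +
      ∑ c, (fderiv ℝ (fun y => γ y d c b) u (modelBasis m a) * w c u +
        γ u d c b * fderiv ℝ (w c) u (modelBasis m a)) +
      ∑ e, γ u d e a * (fderiv ℝ (w e) u (modelBasis m b) + ∑ c, γ u e c b * w c u) := by
  have hwc (c) : ContDiffAt ℝ ∞ (w c) u := by
    rw [hw, hu]; exact contDiffAt_comp_chart_symm hp (contMDiffAt_coordCoef hp hW.smoothFieldAt c)
  have hγc (d c b) : ContDiffAt ℝ ∞ (fun y => γ y d c b) u := by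
    rw [hγ, hu]; exact contDiffAt_comp_chart_symm hp (contMDiffAt_chartSymbol D hp d c b)
  have hwu (c) : w c u = coordCoef p₀ c p (W p) := by
    rw [hw, hu, Function.comp_apply, (extChartAt (𝓡 m).tangent p₀).left_inv hp]
  have hγu (d c b) : γ u d c b = chartSymbol D p₀ p d c b := by
    rw [hγ, hu, Function.comp_apply, (extChartAt (𝓡 m).tangent p₀).left_inv hp]
  have hcov {q : Phase m V} (hq : q ∈ chartDomain p₀) (hWq : SmoothNear W q) (d : Fin m ⊕ Fin m) :
      coordCoef p₀ d q (D.cov W q (coordVec p₀ b q)) =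
        fderiv ℝ (w d) (extChartAt (𝓡 m).tangent p₀ q) (modelBasis m b) +
        ∑ c, chartSymbol D p₀ q d c b * coordCoef p₀ c q (W q) := by
    rw [coordCoef_cov D hq hWq.diffFieldAt, hw,
      mvfderiv_coordVec hq (mdifferentiableAt_coordCoef hq hWq.diffFieldAt d)]
  have hB := D.smoothNear_cov hW (smoothNear_coordVec hp b)
  rw [coordCoef_cov D hp hB.diffFieldAt,
    mvfderiv_coordVec hp (mdifferentiableAt_coordCoef hp hB.diffFieldAt d)]
  have h1 : ((fun q => coordCoef p₀ d q (D.cov W q (coordVec p₀ b q))) ∘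
      (extChartAt (𝓡 m).tangent p₀).symm) =ᶠ[𝓝 u]
      fun y => fderiv ℝ (w d) y (modelBasis m b) + ∑ c, γ y d c b * w c y := by
    rw [hu]
    filter_upwards [eventually_chart_symm hp hW.eventually] with y hy
    rw [Function.comp_apply, hcov hy.2.1 hy.1, hy.2.2]
    simp only [hγ, hw, Function.comp_apply]
  rw [← hu, h1.fderiv_eq]
  congr 1
  · have e1 := ((contDiffAt_fderiv_apply (n := ⊤) (hwc d) (modelBasis m b)).differentiableAt
      (by simp)).hasFDerivAt
    have e2 (c) := ((hγc d c b).differentiableAt (by simp)).hasFDerivAt.fun_mul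
      ((hwc c).differentiableAt (by simp)).hasFDerivAt
    rw [(e1.fun_add (HasFDerivAt.fun_sum (u := Finset.univ) fun c _ => e2 c)).fderiv]
    simp only [FunLike.coe_add, Pi.add_apply, FunLike.coe_sum, Finset.sum_apply, FunLike.coe_smul,
      Pi.smul_apply, smul_eq_mul]
    congr 1
    refine Finset.sum_congr rfl fun c _ => ?_
    ring
  · refine Finset.sum_congr rfl fun e _ => ?_
    rw [hcov hp hW, hγu, ← hu]
    simp only [hγu, hwu]

/-- The components of the curvature in a chart. -/
lemma coordCoef_curvature (D : LinearConnection m V) (hp : p ∈ chartDomain p₀)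
    (hW : SmoothNear W p)
    {γ : Model m → Fin m ⊕ Fin m → Fin m ⊕ Fin m → Fin m ⊕ Fin m → ℝ}
    (hγ : γ = chartSymbol D p₀ ∘ (extChartAt (𝓡 m).tangent p₀).symm) {u : Model m}
    (hu : u = extChartAt (𝓡 m).tangent p₀ p) (d a b : Fin m ⊕ Fin m) :
    coordCoef p₀ d p (curvature D (coordVec p₀ a) (coordVec p₀ b) W p) =
      ∑ c, coordCoef p₀ c p (W p) * (fderiv ℝ (fun y => γ y d c b) u (modelBasis m a)
        - fderiv ℝ (fun y => γ y d c a) u (modelBasis m b)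
        + ∑ e, (γ u d e a * γ u e c b - γ u d e b * γ u e c a)) := by
  obtain ⟨w, hw⟩ : ∃ w : Fin m ⊕ Fin m → Model m → ℝ, ∀ α,
    w α = (fun q => coordCoef p₀ α q (W q)) ∘ (extChartAt (𝓡 m).tangent p₀).symm :=
      ⟨_, fun _ => rfl⟩
  have hwc : ContDiffAt ℝ ∞ (w d) u := by
    rw [hw, hu]; exact contDiffAt_comp_chart_symm hp (contMDiffAt_coordCoef hp hW.smoothFieldAt d)
  have hwu (c) : coordCoef p₀ c p (W p) = w c u := by
    rw [hw, hu, Function.comp_apply, (extChartAt (𝓡 m).tangent p₀).left_inv hp]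
  unfold curvature
  rw [mlieBracket_coordVec hp, map_zero, sub_zero, map_sub, coordCoef_cov_cov D hp hW hw hγ hu,
    coordCoef_cov_cov D hp hW hw hγ hu, fderiv_fderiv_comm hwc (modelBasis m b) (modelBasis m a)]
  simp only [hwu, Finset.sum_add_distrib, mul_add, mul_sub, Finset.sum_sub_distrib, Finset.mul_sum]
  have hc (a b : Fin m ⊕ Fin m) : ∑ e, ∑ c, γ u d e a * (γ u e c b * w c u) =
      ∑ c, ∑ e, w c u * (γ u d e a * γ u e c b) := by
    rw [Finset.sum_comm]
    exact Finset.sum_congr rfl fun c _ => Finset.sum_congr rfl fun e _ => by ring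
  rw [hc, hc]
  simp only [mul_comm (w _ u) (fderiv ℝ _ u _)]
  ring

/-- The Ricci tensor of a linear connection in a chart. -/
theorem ricci_eq_sum_coordRicci (D : LinearConnection m V) (hp : p ∈ chartDomain p₀)
    (v w : TangentSpace (𝓡 m).tangent p) :
    ricci D p v w = ∑ α, ∑ β, coordCoef p₀ α p v * (coordCoef p₀ β p w *
      coordRicci (modelBasis m) (chartSymbol D p₀ ∘ (extChartAt (𝓡 m).tangent p₀).symm)
        (extChartAt (𝓡 m).tangent p₀ p) α β) := by
  have hv := smoothNear_extendVec v
  obtain ⟨M, hM⟩ : ∃ M : TangentSpace (𝓡 m).tangent p →ₗ[ℝ] TangentSpace (𝓡 m).tangent p,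
      ∀ x, M x = curvatureHom D hv x w := ⟨{
      toFun := fun x => curvatureHom D hv x w
      map_add' := fun x y => by rw [map_add, FunLike.coe_add, Pi.add_apply]
      map_smul' := fun c x => by rw [map_smul, FunLike.coe_smul, Pi.smul_apply]; rfl },
      fun _ => rfl⟩
  -- the Ricci tensor is a trace, which may be taken in the chart around `p₀`
  have h1 : ricci D p v w = ∑ τ, coordCoef p τ p (M (coordVec p τ p)) := by
    unfold ricci
    refine Finset.sum_congr rfl fun τ _ => ?_
    rw [← coordCoef_self, hM, coordVec_self, ← curvatureHom_apply D hv (diffFieldAt_extendVec _)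
      (diffFieldAt_extendVec _), extendVec_self, extendVec_self]
  rw [h1, sum_coordCoef_map hp (mem_chartDomain p)]
  have h2 (τ) : coordCoef p₀ τ p (M (coordVec p₀ τ p)) = ∑ β, coordCoef p₀ β p w *
      coordCoef p₀ τ p (curvature D (coordVec p₀ τ) (coordVec p₀ β) (extendVec v) p) := by
    rw [hM]
    conv_lhs => rw [eq_sum_coordCoef hp w]
    rw [map_sum, map_sum]
    refine Finset.sum_congr rfl fun β _ => ?_
    rw [map_smul, map_smul, smul_eq_mul, curvatureHom_apply D hv (diffFieldAt_coordVec hp τ)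
      (diffFieldAt_coordVec hp β)]
  simp only [h2, coordCoef_curvature D hp hv rfl rfl, extendVec_self, Finset.mul_sum, coordRicci]
  rw [Finset.sum_congr rfl fun τ _ => Finset.sum_comm, Finset.sum_comm]
  refine Finset.sum_congr rfl fun α _ => ?_
  rw [Finset.sum_comm]
  refine Finset.sum_congr rfl fun β _ => Finset.sum_congr rfl fun τ _ => ?_
  ring

end CurvatureTensor

/-! ### Levi-Civita connection and scalar curvature in charts -/

section RicciCongr

variable {ι : Type*} [Fintype ι] {E : Type*} [NormedAddCommGroup E] [NormedSpace ℝ E] {b : ι → E}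
  {Γ Γ' : E → ι → ι → ι → ℝ} {u : E}

lemma coordRicci_congr (h : Γ =ᶠ[𝓝 u] Γ') (α β : ι) :
    coordRicci b Γ u α β = coordRicci b Γ' u α β := by
  have h1 (i j k : ι) : fderiv ℝ (fun y => Γ y i j k) u = fderiv ℝ (fun y => Γ' y i j k) u :=
    Filter.EventuallyEq.fderiv_eq (h.mono fun y hy => congrFun (congrFun (congrFun hy i) j) k)
  unfold coordRicci
  simp only [h1, h.self_of_nhds]

lemma contDiffAt_coordRicci (hΓ : ∀ i j k, ContDiffAt ℝ ∞ (fun y => Γ y i j k) u) (α β : ι) :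
    ContDiffAt ℝ ∞ (fun y => coordRicci b Γ y α β) u := by
  unfold coordRicci
  exact ContDiffAt.sum fun τ _ => ((contDiffAt_fderiv_apply (n := ⊤) (hΓ _ _ _) _).sub
    (contDiffAt_fderiv_apply (n := ⊤) (hΓ _ _ _) _)).add (ContDiffAt.sum fun κ _ =>
    ((hΓ _ _ _).mul (hΓ _ _ _)).sub ((hΓ _ _ _).mul (hΓ _ _ _)))

end RicciCongr

section ChartGeometry

variable {m : ℕ} {V : Type*} [TopologicalSpace V] [ChartedSpace (EuclideanSpace ℝ (Fin m)) V]
  [IsManifold (𝓡 m) ∞ V] {P : PhaseGeometry m V} {p₀ p : Phase m V} {D : LinearConnection m V}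

/-- The matrix of the metric as a function of the coordinates of the chart around `p₀`. -/
def chartMetric (P : PhaseGeometry m V) (p₀ : Phase m V) (u : Model m) :
    Matrix (Fin m ⊕ Fin m) (Fin m ⊕ Fin m) ℝ :=
  metricMatrix P p₀ ((extChartAt (𝓡 m).tangent p₀).symm u)

lemma chartMetric_apply (hp : p ∈ chartDomain p₀) :
    chartMetric P p₀ (extChartAt (𝓡 m).tangent p₀ p) = metricMatrix P p₀ p := by
  rw [chartMetric, (extChartAt (𝓡 m).tangent p₀).left_inv hp]

lemma contDiffAt_chartMetric (hp : p ∈ chartDomain p₀) (α β : Fin m ⊕ Fin m) :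
    ContDiffAt ℝ ∞ (fun u => chartMetric P p₀ u α β) (extChartAt (𝓡 m).tangent p₀ p) :=
  contDiffAt_comp_chart_symm (f := fun q => metricMatrix P p₀ q α β) hp
    (P.contMDiffAt_metricMatrix hp α β)

lemma det_chartMetric_ne_zero (hp : p ∈ chartDomain p₀) :
    (chartMetric P p₀ (extChartAt (𝓡 m).tangent p₀ p)).det ≠ 0 := by
  rw [chartMetric_apply hp]
  exact P.det_metricMatrix_ne_zero hp

lemma dg_coordVec (hp : p ∈ chartDomain p₀) (α β σ : Fin m ⊕ Fin m) :
    P.dg (coordVec p₀ β) (coordVec p₀ α) (coordVec p₀ σ) p =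
      fderiv ℝ (fun u => chartMetric P p₀ u α σ) (extChartAt (𝓡 m).tangent p₀ p)
        (modelBasis m β) :=
  mvfderiv_coordVec hp (P.mdifferentiableAt_g (diffFieldAt_coordVec hp α)
    (diffFieldAt_coordVec hp σ)) β

lemma bg_coordVec (hp : p ∈ chartDomain p₀) (α β σ : Fin m ⊕ Fin m) :
    P.bg (coordVec p₀ α) (coordVec p₀ β) (coordVec p₀ σ) p = 0 := by
  rw [PhaseGeometry.bg, mlieBracket_coordVec hp, map_zero]
  rfl

/-- In a chart the Levi-Civita connection is given by the Christoffel symbols of the metric. -/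
lemma IsLeviCivita.chartSymbol_eq (hD : IsLeviCivita P D) (hp : p ∈ chartDomain p₀)
    (τ α β : Fin m ⊕ Fin m) :
    chartSymbol D p₀ p τ α β = christoffel (modelBasis m) (chartMetric P p₀)
      (extChartAt (𝓡 m).tangent p₀ p) τ α β := by
  have hdet := det_chartMetric_ne_zero (P := P) hp
  set Γ : Fin m ⊕ Fin m → ℝ := fun τ => chartSymbol D p₀ p τ α β
  set Γ' : Fin m ⊕ Fin m → ℝ := fun τ => christoffel (modelBasis m) (chartMetric P p₀)
      (extChartAt (𝓡 m).tangent p₀ p) τ α β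
  have key : (chartMetric P p₀ (extChartAt (𝓡 m).tangent p₀ p)).mulVec Γ =
      (chartMetric P p₀ (extChartAt (𝓡 m).tangent p₀ p)).mulVec Γ' := by
    funext σ
    refine Eq.trans ?_ (sum_metric_mul_christoffel hdet σ α β).symm
    have h := hD.two_mul_g (diffFieldAt_coordVec hp β) (diffFieldAt_coordVec hp α)
      (diffFieldAt_coordVec hp σ)
    rw [PhaseGeometry.koszul, bg_coordVec hp, bg_coordVec hp, bg_coordVec hp, dg_coordVec hp,
      dg_coordVec hp, dg_coordVec hp] at h
    have h2 : P.g p (D.cov (coordVec p₀ α) p (coordVec p₀ β p)) (coordVec p₀ σ p) =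
        ∑ τ, metricMatrix P p₀ p σ τ * Γ τ := by
      conv_lhs => rw [eq_sum_coordCoef hp (D.cov (coordVec p₀ α) p (coordVec p₀ β p))]
      rw [map_sum (P.g p), FunLike.coe_sum, Finset.sum_apply]
      refine Finset.sum_congr rfl fun τ _ => ?_
      rw [map_smul (P.g p), FunLike.coe_smul, Pi.smul_apply, smul_eq_mul, mul_comm, P.g_symm]
      rfl
    have h3 : fderiv ℝ (fun u => chartMetric P p₀ u β α) (extChartAt (𝓡 m).tangent p₀ p) =
        fderiv ℝ (fun u => chartMetric P p₀ u α β) (extChartAt (𝓡 m).tangent p₀ p) :=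
      congrArg (fun f => fderiv ℝ f _) (funext fun u => P.metricMatrix_symm _ _ _ _)
    rw [h3] at h
    change ∑ τ, chartMetric P p₀ (extChartAt (𝓡 m).tangent p₀ p) σ τ * Γ τ = _
    rw [chartMetric_apply hp, ← h2]
    linarith
  exact congrFun (Matrix.mulVec_injective_iff_isUnit.2
    ((Matrix.isUnit_iff_isUnit_det _).2 hdet.isUnit) key) τ

/-- The trace of a bilinear form with respect to the metric can be computed in any chart. -/
lemma metricTrace_eq_sum (hp : p ∈ chartDomain p₀)
    {A : TangentSpace (𝓡 m).tangent p → TangentSpace (𝓡 m).tangent p → ℝ}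
    {a : Fin m ⊕ Fin m → Fin m ⊕ Fin m → ℝ}
    (hA : ∀ v w, A v w = ∑ α, ∑ β, coordCoef p₀ α p v * (coordCoef p₀ β p w * a α β)) :
    metricTrace P p A = ∑ α, ∑ β, (metricMatrix P p₀ p)⁻¹ α β * a α β := by
  -- the transition matrix between the two frames
  let S : Matrix (Fin m ⊕ Fin m) (Fin m ⊕ Fin m) ℝ :=
    Matrix.of fun α τ => coordCoef p₀ α p (coordVec p τ p)
  let S' : Matrix (Fin m ⊕ Fin m) (Fin m ⊕ Fin m) ℝ :=
    Matrix.of fun τ α => coordCoef p τ p (coordVec p₀ α p)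
  have hSS : S * S' = 1 := by
    ext α β
    rw [Matrix.mul_apply, Matrix.one_apply, ← coordCoef_coordVec hp α β]
    conv_rhs => rw [eq_sum_coordCoef (mem_chartDomain p) (coordVec p₀ β p)]
    rw [map_sum]
    refine Finset.sum_congr rfl fun τ _ => ?_
    rw [map_smul, smul_eq_mul, mul_comm]
    rfl
  have hS : IsUnit S.det := (Matrix.isUnit_iff_isUnit_det _).1 (.of_mul_eq_one S' hSS)
  have hG : (Matrix.of fun a b => P.g p (frame p a) (frame p b)) =
      S.transpose * (metricMatrix P p₀ p * S) := by
    ext α β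
    rw [Matrix.mul_apply, Matrix.of_apply, ← coordVec_self, ← coordVec_self,
      eq_sum_tensor2 hp P.g]
    refine Finset.sum_congr rfl fun σ _ => ?_
    rw [Matrix.mul_apply, Finset.mul_sum]
    refine Finset.sum_congr rfl fun τ _ => ?_
    change _ = S σ α * (P.g p (coordVec p₀ σ p) (coordVec p₀ τ p) * S τ β)
    rw [mul_comm (P.g p _ _)]
    rfl
  -- the inverse metric transforms contragrediently
  have hinv : S * (S.transpose * (metricMatrix P p₀ p * S))⁻¹ * S.transpose =
      (metricMatrix P p₀ p)⁻¹ := by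
    have hST : IsUnit S.transpose.det := by rwa [Matrix.det_transpose]
    rw [Matrix.mul_inv_rev, Matrix.mul_inv_rev, Matrix.mul_assoc, Matrix.mul_assoc,
      Matrix.mul_assoc, Matrix.nonsing_inv_mul _ hST, Matrix.mul_one, ← Matrix.mul_assoc,
      Matrix.mul_nonsing_inv _ hS, Matrix.one_mul]
  unfold metricTrace
  rw [hG, ← hinv]
  set B := (S.transpose * (metricMatrix P p₀ p * S))⁻¹
  have hl (α β) : B α β * A (frame p α) (frame p β) =
      ∑ σ, ∑ τ, S σ α * B α β * S τ β * a σ τ := by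
    rw [hA, Finset.mul_sum, ← coordVec_self, ← coordVec_self]
    refine Finset.sum_congr rfl fun σ _ => ?_
    rw [Finset.mul_sum]
    refine Finset.sum_congr rfl fun τ _ => ?_
    change B α β * (S σ α * (S τ β * a σ τ)) = _
    ring
  have hr (σ τ) : (S * B * S.transpose) σ τ * a σ τ =
      ∑ α, ∑ β, S σ α * B α β * S τ β * a σ τ := by
    rw [Matrix.mul_apply, Finset.sum_mul, Finset.sum_comm]
    refine Finset.sum_congr rfl fun β _ => ?_
    rw [Matrix.mul_apply, Finset.sum_mul, Finset.sum_mul]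
    rfl
  simp only [hl, hr]
  calc ∑ α, ∑ β, ∑ σ, ∑ τ, S σ α * B α β * S τ β * a σ τ
      = ∑ α, ∑ σ, ∑ β, ∑ τ, S σ α * B α β * S τ β * a σ τ :=
        Finset.sum_congr rfl fun α _ => Finset.sum_comm
    _ = ∑ σ, ∑ α, ∑ τ, ∑ β, S σ α * B α β * S τ β * a σ τ := by
        rw [Finset.sum_comm]
        exact Finset.sum_congr rfl fun σ _ => Finset.sum_congr rfl fun α _ => Finset.sum_comm
    _ = ∑ σ, ∑ τ, ∑ α, ∑ β, S σ α * B α β * S τ β * a σ τ :=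
        Finset.sum_congr rfl fun σ _ => Finset.sum_comm

lemma IsLeviCivita.coordRicci_eq (hD : IsLeviCivita P D) (hp : p ∈ chartDomain p₀)
    (α β : Fin m ⊕ Fin m) :
    coordRicci (modelBasis m) (chartSymbol D p₀ ∘ (extChartAt (𝓡 m).tangent p₀).symm)
        (extChartAt (𝓡 m).tangent p₀ p) α β =
      coordRicci (modelBasis m) (christoffel (modelBasis m) (chartMetric P p₀))
        (extChartAt (𝓡 m).tangent p₀ p) α β := by
  refine coordRicci_congr ?_ α β
  filter_upwards [eventually_chart_symm hp (Filter.Eventually.of_forall fun q => trivial)] with y hy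
  funext i j k
  rw [Function.comp_apply, hD.chartSymbol_eq hy.2.1, hy.2.2]

lemma contDiffAt_chartMetric_of_mem_target {u : Model m}
    (hu : u ∈ (extChartAt (𝓡 m).tangent p₀).target) (α β : Fin m ⊕ Fin m) :
    ContDiffAt ℝ ∞ (fun u => chartMetric P p₀ u α β) u := by
  have h := contDiffAt_chartMetric (P := P) (p₀ := p₀)
    ((extChartAt (𝓡 m).tangent p₀).map_target hu) α β
  rwa [(extChartAt (𝓡 m).tangent p₀).right_inv hu] at h

/-- The Ricci tensor of the Levi-Civita connection is symmetric. -/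
lemma coordRicci_chartMetric_symm (P : PhaseGeometry m V) (hp : p ∈ chartDomain p₀)
    (α β : Fin m ⊕ Fin m) :
    coordRicci (modelBasis m) (christoffel (modelBasis m) (chartMetric P p₀))
        (extChartAt (𝓡 m).tangent p₀ p) α β =
      coordRicci (modelBasis m) (christoffel (modelBasis m) (chartMetric P p₀))
        (extChartAt (𝓡 m).tangent p₀ p) β α := by
  have hG : ∀ᶠ y in 𝓝 (extChartAt (𝓡 m).tangent p₀ p), ∀ i j,
      ContDiffAt ℝ ∞ (fun y => chartMetric P p₀ y i j) y := by
    filter_upwards [(isOpen_extChartAt_target p₀).mem_nhds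
      ((extChartAt (𝓡 m).tangent p₀).map_source hp)] with y hy i j
    exact contDiffAt_chartMetric_of_mem_target hy i j
  have hs : ∀ᶠ y in 𝓝 (extChartAt (𝓡 m).tangent p₀ p), ∀ i j,
      chartMetric P p₀ y i j = chartMetric P p₀ y j i :=
    Filter.Eventually.of_forall fun y i j => P.metricMatrix_symm _ _ i j
  exact coordRicci_christoffel_symm hG hs (det_chartMetric_ne_zero hp) α β

variable [T2Space V]

lemma scalarCurvature_eq_sum (D : LinearConnection m V) (hp : p ∈ chartDomain p₀) :
    scalarCurvature P D p = ∑ α, ∑ β, (metricMatrix P p₀ p)⁻¹ α β *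
      coordRicci (modelBasis m) (chartSymbol D p₀ ∘ (extChartAt (𝓡 m).tangent p₀).symm)
        (extChartAt (𝓡 m).tangent p₀ p) α β :=
  metricTrace_eq_sum hp (ricci_eq_sum_coordRicci D hp)

lemma contMDiffAt_scalarCurvature (P : PhaseGeometry m V) (D : LinearConnection m V)
    (p : Phase m V) :
    ContMDiffAt (𝓡 m).tangent 𝓘(ℝ, ℝ) ∞ (scalarCurvature P D) p := by
  have hp := mem_chartDomain p
  have h1 : scalarCurvature P D =ᶠ[𝓝 p] fun q => ∑ α, ∑ β, (metricMatrix P p q)⁻¹ α β *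
      coordRicci (modelBasis m) (chartSymbol D p ∘ (extChartAt (𝓡 m).tangent p).symm)
        (extChartAt (𝓡 m).tangent p q) α β := by
    filter_upwards [eventually_mem_chartDomain hp] with q hq using scalarCurvature_eq_sum D hq
  refine ContMDiffAt.congr_of_eventuallyEq ?_ h1
  refine contMDiffAt_fintype_sum fun α => contMDiffAt_fintype_sum fun β =>
    (P.contMDiffAt_inv_metricMatrix hp α β).mul ?_
  have h2 := contDiffAt_coordRicci (b := modelBasis m)
    (Γ := chartSymbol D p ∘ (extChartAt (𝓡 m).tangent p).symm)
    (fun i j k => contDiffAt_comp_chart_symm hp (contMDiffAt_chartSymbol D hp i j k)) α β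
  exact h2.contMDiffAt.comp p (contMDiffAt_chart (n := ⊤) hp)

lemma IsLeviCivita.ricci_eq_sum (hD : IsLeviCivita P D) (hp : p ∈ chartDomain p₀)
    (v w : TangentSpace (𝓡 m).tangent p) :
    ricci D p v w = ∑ α, ∑ β, coordCoef p₀ α p v * (coordCoef p₀ β p w *
      coordRicci (modelBasis m) (christoffel (modelBasis m) (chartMetric P p₀))
        (extChartAt (𝓡 m).tangent p₀ p) α β) := by
  rw [ricci_eq_sum_coordRicci D hp]
  simp only [hD.coordRicci_eq hp]

lemma IsLeviCivita.ricci_symm (hD : IsLeviCivita P D) (v w : TangentSpace (𝓡 m).tangent p) :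
    ricci D p v w = ricci D p w v := by
  rw [hD.ricci_eq_sum (mem_chartDomain p), hD.ricci_eq_sum (mem_chartDomain p), Finset.sum_comm]
  refine Finset.sum_congr rfl fun α _ => Finset.sum_congr rfl fun β _ => ?_
  rw [coordRicci_chartMetric_symm P (mem_chartDomain p) α β]
  ring

/-- The Lagrangian density of the Levi-Civita connection is the coordinate Hilbert density. -/
lemma IsLeviCivita.sqrt_det_mul_scalarCurvature (hD : IsLeviCivita P D)
    (hp : p ∈ chartDomain p₀) :
    √|(metricMatrix P p₀ p).det| * scalarCurvature P D p =
      hilbertDensity (modelBasis m) (chartMetric P p₀) (extChartAt (𝓡 m).tangent p₀ p) := by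
  rw [scalarCurvature_eq_sum D hp, hilbertDensity, chartMetric_apply hp]
  simp only [hD.coordRicci_eq hp]

end ChartGeometry

/-! ### The first variation of the action -/

section Action

variable {m : ℕ} {V : Type*} [TopologicalSpace V] [ChartedSpace (EuclideanSpace ℝ (Fin m)) V]
  [IsManifold (𝓡 m) ∞ V] {P : PhaseGeometry m V} {p₀ p : Phase m V} {K : Set (Phase m V)}

lemma isCompact_image_chart (hK : IsCompact K) (hKp : K ⊆ chartDomain p₀) :
    IsCompact (extChartAt (𝓡 m).tangent p₀ '' K) :=
  hK.image_of_continuousOn ((continuousOn_extChartAt p₀).mono hKp)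

lemma measurableSet_image_chart (hK : IsCompact K) (hKp : K ⊆ chartDomain p₀) :
    MeasurableSet (extChartAt (𝓡 m).tangent p₀ '' K) :=
  (isCompact_image_chart hK hKp).isClosed.measurableSet

lemma image_chart_subset_target (hKp : K ⊆ chartDomain p₀) :
    extChartAt (𝓡 m).tangent p₀ '' K ⊆ (extChartAt (𝓡 m).tangent p₀).target := by
  rintro _ ⟨q, hq, rfl⟩
  exact (extChartAt (𝓡 m).tangent p₀).map_source (hKp hq)

lemma chartIntegral_eq (P : PhaseGeometry m V) (p₀ : Phase m V) (K : Set (Phase m V))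
    (f : Phase m V → ℝ) : chartIntegral P p₀ K f = ∫ u in extChartAt (𝓡 m).tangent p₀ '' K,
      √|(chartMetric P p₀ u).det| * f ((extChartAt (𝓡 m).tangent p₀).symm u) := rfl

lemma continuousOn_sqrt_det_mul (P : PhaseGeometry m V) {f : Phase m V → ℝ}
    (hf : ContinuousOn f (chartDomain p₀)) :
    ContinuousOn (fun u => √|(chartMetric P p₀ u).det| * f ((extChartAt (𝓡 m).tangent p₀).symm u))
      (extChartAt (𝓡 m).tangent p₀).target := by
  refine ContinuousOn.mul ?_ (hf.comp (continuousOn_extChartAt_symm p₀)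
    fun u hu => (extChartAt (𝓡 m).tangent p₀).map_target hu)
  intro u hu
  exact (Real.continuous_sqrt.continuousAt.comp (continuousAt_det fun i j =>
    (contDiffAt_chartMetric_of_mem_target hu i j).continuousAt).abs).continuousWithinAt

lemma integrableOn_sqrt_det_mul (P : PhaseGeometry m V) {f : Phase m V → ℝ}
    (hf : ContinuousOn f (chartDomain p₀)) (hK : IsCompact K) (hKp : K ⊆ chartDomain p₀) :
    IntegrableOn (fun u => √|(chartMetric P p₀ u).det| *
      f ((extChartAt (𝓡 m).tangent p₀).symm u)) (extChartAt (𝓡 m).tangent p₀ '' K) volume :=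
  ContinuousOn.integrableOn_compact (isCompact_image_chart hK hKp)
    ((continuousOn_sqrt_det_mul P hf).mono (image_chart_subset_target hKp))

lemma chartIntegral_add (P : PhaseGeometry m V) {f g : Phase m V → ℝ}
    (hf : ContinuousOn f (chartDomain p₀)) (hg : ContinuousOn g (chartDomain p₀))
    (hK : IsCompact K) (hKp : K ⊆ chartDomain p₀) :
    chartIntegral P p₀ K (fun p => f p + g p) =
      chartIntegral P p₀ K f + chartIntegral P p₀ K g := by
  rw [chartIntegral_eq, chartIntegral_eq, chartIntegral_eq,
    ← integral_add (integrableOn_sqrt_det_mul P hf hK hKp) (integrableOn_sqrt_det_mul P hg hK hKp)]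
  simp only [mul_add]

lemma chartIntegral_const_mul (P : PhaseGeometry m V) (c : ℝ) (f : Phase m V → ℝ) :
    chartIntegral P p₀ K (fun p => c * f p) = c * chartIntegral P p₀ K f := by
  rw [chartIntegral_eq, chartIntegral_eq, ← integral_const_mul]
  simp only [mul_left_comm]

lemma chartIntegral_congr (P : PhaseGeometry m V) {f g : Phase m V → ℝ} (hK : IsCompact K)
    (hKp : K ⊆ chartDomain p₀) (h : ∀ p ∈ K, f p = g p) :
    chartIntegral P p₀ K f = chartIntegral P p₀ K g := by
  rw [chartIntegral_eq, chartIntegral_eq]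
  refine setIntegral_congr_fun (measurableSet_image_chart hK hKp) ?_
  rintro _ ⟨q, hq, rfl⟩
  change _ * f _ = _ * g _
  rw [(extChartAt (𝓡 m).tangent p₀).left_inv (hKp hq), h q hq]

lemma chartIntegral_eq_setIntegral (P : PhaseGeometry m V) {f : Phase m V → ℝ} {F : Model m → ℝ}
    (hK : IsCompact K) (hKp : K ⊆ chartDomain p₀)
    (h : ∀ p ∈ K, √|(metricMatrix P p₀ p).det| * f p = F (extChartAt (𝓡 m).tangent p₀ p)) :
    chartIntegral P p₀ K f = ∫ u in extChartAt (𝓡 m).tangent p₀ '' K, F u := by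
  rw [chartIntegral_eq]
  refine setIntegral_congr_fun (measurableSet_image_chart hK hKp) ?_
  rintro _ ⟨q, hq, rfl⟩
  change _ * f _ = _
  rw [(extChartAt (𝓡 m).tangent p₀).left_inv (hKp hq), chartMetric_apply (hKp hq), h q hq]

variable (m) in
lemma isAddHaarMeasure_volume_model : (volume : Measure (Model m)).IsAddHaarMeasure :=
  inferInstanceAs (((volume : Measure (EuclideanSpace ℝ (Fin m))).prod
    (volume : Measure (EuclideanSpace ℝ (Fin m)))).IsAddHaarMeasure)

lemma Variation.contDiffAt_chartMetric (γ : Variation P K) (t : ℝ) {u : Model m}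
    (hu : u ∈ (extChartAt (𝓡 m).tangent p₀).target) (α β : Fin m ⊕ Fin m) :
    ContDiffAt ℝ ∞ (fun z : ℝ × Model m => chartMetric (γ.geom z.1) p₀ z.2 α β) (t, u) := by
  have hp := (extChartAt (𝓡 m).tangent p₀).map_target hu
  have h1 := γ.g_smooth t _ _ _ (smoothFieldAt_coordVec hp α) (smoothFieldAt_coordVec hp β)
  have h2 := contMDiffAt_chart_symm (n := ⊤) hp
  rw [(extChartAt (𝓡 m).tangent p₀).right_inv hu] at h2
  have h3 : ContMDiffAt 𝓘(ℝ, ℝ × Model m) (𝓘(ℝ, ℝ).prod (𝓡 m).tangent) ∞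
      (fun z : ℝ × Model m => (z.1, (extChartAt (𝓡 m).tangent p₀).symm z.2)) (t, u) := by
    refine ContMDiffAt.prodMk ?_ ?_
    · exact contDiffAt_fst.contMDiffAt
    · exact ContMDiffAt.comp (t, u) (g := (extChartAt (𝓡 m).tangent p₀).symm) h2
        contDiffAt_snd.contMDiffAt
  exact (ContMDiffAt.comp (t, u) (g := fun z : ℝ × Phase m V =>
    (γ.geom z.1).g z.2 (coordVec p₀ α z.2) (coordVec p₀ β z.2)) h1 h3).contDiffAt

lemma det_chartMetric_ne_zero_of_mem_target (P : PhaseGeometry m V) {u : Model m}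
    (hu : u ∈ (extChartAt (𝓡 m).tangent p₀).target) : (chartMetric P p₀ u).det ≠ 0 :=
  P.det_metricMatrix_ne_zero ((extChartAt (𝓡 m).tangent p₀).map_target hu)

lemma continuousOn_deltaInv (γ : Variation P K) (α β : Fin m ⊕ Fin m) :
    ContinuousOn (fun p => deltaInv γ p₀ p α β) (chartDomain p₀) := by
  have h1 : ContinuousOn (fun u => deriv (fun t => (chartMetric (γ.geom t) p₀ u)⁻¹ α β) 0)
      (extChartAt (𝓡 m).tangent p₀).target := by
    intro u hu
    exact (contDiffAt_slice_right
      (f := fun t u => deriv (fun s => (chartMetric (γ.geom s) p₀ u)⁻¹ α β) t)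
      (contDiffAt_partial_deriv (f := fun t u => (chartMetric (γ.geom t) p₀ u)⁻¹ α β)
        (contDiffAt_inv_apply (A := fun z : ℝ × Model m => chartMetric (γ.geom z.1) p₀ z.2)
          (fun i j => γ.contDiffAt_chartMetric 0 hu i j)
          (det_chartMetric_ne_zero_of_mem_target _ hu) α β))).continuousAt.continuousWithinAt
  refine (h1.comp (continuousOn_extChartAt p₀)
    fun p hp => (extChartAt (𝓡 m).tangent p₀).map_source hp).congr fun p hp => ?_
  simp only [deltaInv, Function.comp_apply, chartMetric_apply hp]

/-- The Euler–Lagrange tensor `(1 / 2ϰ) (R_{αβ} - ½ R g_{αβ}) - ½ T_{αβ}`. -/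
def eulerLagrange (ϰ : ℝ) (P : PhaseGeometry m V) (D : LinearConnection m V) (T : Tensor2 m V)
    (p : Phase m V) (v w : TangentSpace (𝓡 m).tangent p) : ℝ :=
  1 / (2 * ϰ) * (ricci D p v w - 1 / 2 * scalarCurvature P D p * P.g p v w) - 1 / 2 * T p v w

lemma continuousOn_tensor2 {T : Tensor2 m V}
    (hT : ∀ p X Y, SmoothFieldAt X p → SmoothFieldAt Y p →
      ContMDiffAt (𝓡 m).tangent 𝓘(ℝ, ℝ) ∞ (fun q => T q (X q) (Y q)) p) (α β : Fin m ⊕ Fin m) :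
    ContinuousOn (fun q => T q (coordVec p₀ α q) (coordVec p₀ β q)) (chartDomain p₀) :=
  fun p hp => (hT p _ _ (smoothFieldAt_coordVec hp α)
    (smoothFieldAt_coordVec hp β)).continuousAt.continuousWithinAt

variable [T2Space V]

lemma continuousOn_coordRicci (D : LinearConnection m V) (α β : Fin m ⊕ Fin m) :
    ContinuousOn (fun p => coordRicci (modelBasis m)
      (chartSymbol D p₀ ∘ (extChartAt (𝓡 m).tangent p₀).symm) (extChartAt (𝓡 m).tangent p₀ p) α β)
      (chartDomain p₀) := by
  intro p hp
  have h2 := contDiffAt_coordRicci (b := modelBasis m)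
    (Γ := chartSymbol D p₀ ∘ (extChartAt (𝓡 m).tangent p₀).symm)
    (fun i j k => contDiffAt_comp_chart_symm hp (contMDiffAt_chartSymbol D hp i j k)) α β
  exact (h2.contMDiffAt.comp p (contMDiffAt_chart (n := ⊤) hp)).continuousAt.continuousWithinAt

lemma ricci_coordVec (D : LinearConnection m V) (hp : p ∈ chartDomain p₀) (α β : Fin m ⊕ Fin m) :
    ricci D p (coordVec p₀ α p) (coordVec p₀ β p) = coordRicci (modelBasis m)
      (chartSymbol D p₀ ∘ (extChartAt (𝓡 m).tangent p₀).symm)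
        (extChartAt (𝓡 m).tangent p₀ p) α β := by
  rw [ricci_eq_sum_coordRicci D hp]
  simp only [coordCoef_coordVec hp]
  rw [Finset.sum_eq_single α, Finset.sum_eq_single β]
  · simp
  · intro b _ hb; rw [if_neg hb]; ring
  · intro h; exact absurd (Finset.mem_univ _) h
  · intro a _ ha; rw [if_neg ha]; simp only [zero_mul]; exact Finset.sum_const_zero
  · intro h; exact absurd (Finset.mem_univ _) h

lemma continuousOn_ricci (D : LinearConnection m V) (α β : Fin m ⊕ Fin m) :
    ContinuousOn (fun p => ricci D p (coordVec p₀ α p) (coordVec p₀ β p)) (chartDomain p₀) :=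
  (continuousOn_coordRicci D α β).congr fun _ hp => ricci_coordVec D hp α β

lemma continuous_scalarCurvature (P : PhaseGeometry m V) (D : LinearConnection m V) :
    Continuous (scalarCurvature P D) :=
  continuous_iff_continuousAt.2 fun p => (contMDiffAt_scalarCurvature P D p).continuousAt

lemma scalarCurvature_eq_add (P : PhaseGeometry m V) (D' D : LinearConnection m V)
    (p : Phase m V) : scalarCurvature P D' p =
      scalarCurvature P D p + metricTrace P p (distRicci D (distortion D' D) p) := by
  simp only [scalarCurvature, metricTrace, ricci_eq_add_distRicci D' D, mul_add,
    Finset.sum_add_distrib]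

/-- The total Lagrangian is the Hilbert Lagrangian of the Levi-Civita connection plus the distortion
and the matter Lagrangians. -/
lemma totalLagrangian_eq {ϰ : ℝ} {lc D : PhaseGeometry m V → LinearConnection m V}
    {Lm : Lagrangian m V} (P : PhaseGeometry m V) :
    totalLagrangian ϰ D Lm P = fun p => (1 / (2 * ϰ) * scalarCurvature P (lc P) p +
      distLagrangian ϰ lc D P p) + Lm P p := by
  funext p
  rw [totalLagrangian, scalarCurvature_eq_add P (D P) (lc P), distLagrangian]
  ring

/-- The distortion Lagrangian is continuous, being a multiple of the difference of two scalar
curvatures. -/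
lemma continuous_distLagrangian {ϰ : ℝ} {lc D : PhaseGeometry m V → LinearConnection m V}
    (P : PhaseGeometry m V) : Continuous (distLagrangian ϰ lc D P) := by
  have h : distLagrangian ϰ lc D P = fun p => 1 / (2 * ϰ) *
      (scalarCurvature P (D P) p - scalarCurvature P (lc P) p) := by
    funext p
    rw [distLagrangian, scalarCurvature_eq_add P (D P) (lc P), add_sub_cancel_left]
  rw [h]
  exact continuous_const.mul
    ((continuous_scalarCurvature P _).sub (continuous_scalarCurvature P _))

lemma actionOn_totalLagrangian {ϰ : ℝ} {lc D : PhaseGeometry m V → LinearConnection m V}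
    (hlc : ∀ P, IsLeviCivita P (lc P)) {Lm : Lagrangian m V} (hLm : ∀ P, Continuous (Lm P))
    (hK : IsCompact K) (hKp : K ⊆ chartDomain p₀) (P : PhaseGeometry m V) :
    actionOn (totalLagrangian ϰ D Lm) p₀ K P =
      1 / (2 * ϰ) * (∫ u in extChartAt (𝓡 m).tangent p₀ '' K,
        hilbertDensity (modelBasis m) (chartMetric P p₀) u) +
      actionOn (distLagrangian ϰ lc D) p₀ K P + actionOn Lm p₀ K P := by
  have hs := (continuous_scalarCurvature P (lc P)).continuousOn (s := chartDomain p₀)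
  have hd := (continuous_distLagrangian (ϰ := ϰ) (lc := lc) (D := D) P).continuousOn
    (s := chartDomain p₀)
  have hR : ContinuousOn (fun p => 1 / (2 * ϰ) * scalarCurvature P (lc P) p) (chartDomain p₀) :=
    continuousOn_const.mul hs
  have hRd : ContinuousOn (fun p => 1 / (2 * ϰ) * scalarCurvature P (lc P) p +
    distLagrangian ϰ lc D P p) (chartDomain p₀) := hR.add hd
  rw [actionOn, totalLagrangian_eq (lc := lc), chartIntegral_add P hRd (hLm P).continuousOn hK hKp,
    chartIntegral_add P hR hd hK hKp, chartIntegral_const_mul,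
    chartIntegral_eq_setIntegral P hK hKp fun q hq =>
      (hlc P).sqrt_det_mul_scalarCurvature (hKp hq)]
  rfl

/-- The first variation of the total action is the integral of the Euler–Lagrange tensor against the
variation of the inverse metric. -/
theorem hasDerivAt_actionOn_totalLagrangian {ϰ : ℝ}
    {lc D : PhaseGeometry m V → LinearConnection m V}
    (hlc : ∀ P, IsLeviCivita P (lc P)) {Lm : Lagrangian m V} (hLm : ∀ P, Continuous (Lm P))
    {Tm Tz : Tensor2 m V} (hTm : IsEnergyMomentum Lm P Tm)
    (hTz : IsEnergyMomentum (distLagrangian ϰ lc D) P Tz) (hK : IsCompact K)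
    (hKp : K ⊆ chartDomain p₀) (γ : Variation P K) :
    HasDerivAt (fun t => actionOn (totalLagrangian ϰ D Lm) p₀ K (γ.geom t))
      (chartIntegral P p₀ K fun p => ∑ α, ∑ β, eulerLagrange ϰ P (lc P) (Tm + Tz) p
        (coordVec p₀ α p) (coordVec p₀ β p) * deltaInv γ p₀ p α β) 0 := by
  have := isAddHaarMeasure_volume_model m
  have h1 := hasDerivAt_integral_hilbertDensity (b := modelBasis m) (μ := volume)
    (G := fun t => chartMetric (γ.geom t) p₀) (isOpen_extChartAt_target p₀)
    (isCompact_image_chart hK hKp) (image_chart_subset_target hKp)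
    (fun t u hu i j => γ.contDiffAt_chartMetric t hu i j)
    (fun u _ t α β => (γ.geom t).metricMatrix_symm _ _ α β)
    (fun t u hu => det_chartMetric_ne_zero_of_mem_target _ hu)
    (fun t u hu huK => by
      have hq : (extChartAt (𝓡 m).tangent p₀).symm u ∉ K := fun h => huK
        ⟨_, h, (extChartAt (𝓡 m).tangent p₀).right_inv hu⟩
      ext i j
      change (γ.geom t).g _ _ _ = (γ.geom 0).g _ _ _
      rw [γ.g_eq t _ hq, γ.g_eq 0 _ hq])
  have h2 := hTz.variation p₀ K hK hKp γ
  have h3 := hTm.variation p₀ K hK hKp γ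
  have h4 := ((h1.const_mul (1 / (2 * ϰ))).fun_add h2).fun_add h3
  simp only [actionOn_totalLagrangian hlc hLm hK hKp]
  refine h4.congr_deriv ?_
  have hδ := fun α β => continuousOn_deltaInv (p₀ := p₀) γ α β
  have cT {T : Tensor2 m V} (hT : ∀ p X Y, SmoothFieldAt X p → SmoothFieldAt Y p →
      ContMDiffAt (𝓡 m).tangent 𝓘(ℝ, ℝ) ∞ (fun q => T q (X q) (Y q)) p) :
      ContinuousOn (fun p => -(1 / 2) * ∑ α, ∑ β, T p (coordVec p₀ α p) (coordVec p₀ β p) *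
        deltaInv γ p₀ p α β) (chartDomain p₀) :=
    continuousOn_const.mul (continuousOn_finsetSum _ fun α _ => continuousOn_finsetSum _ fun β _ =>
      (continuousOn_tensor2 hT α β).mul (hδ α β))
  have cR : ContinuousOn (fun p => 1 / (2 * ϰ) * ∑ α, ∑ β,
      (ricci (lc P) p (coordVec p₀ α p) (coordVec p₀ β p) - 1 / 2 * scalarCurvature P (lc P) p *
        P.g p (coordVec p₀ α p) (coordVec p₀ β p)) * deltaInv γ p₀ p α β) (chartDomain p₀) :=
    continuousOn_const.mul (continuousOn_finsetSum _ fun α _ => continuousOn_finsetSum _ fun β _ =>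
      ((continuousOn_ricci _ α β).sub ((continuousOn_const.mul
        (continuous_scalarCurvature P _).continuousOn).mul
          (continuousOn_tensor2 P.g_smooth α β))).mul (hδ α β))
  -- the Hilbert part of the variation, written on the manifold
  have h5 : (∫ u in extChartAt (𝓡 m).tangent p₀ '' K, √|(chartMetric (γ.geom 0) p₀ u).det| *
      (∑ α, ∑ β, (coordRicci (modelBasis m) (christoffel (modelBasis m)
        (chartMetric (γ.geom 0) p₀)) u α β - 1 / 2 *
          (∑ μ, ∑ ν, (chartMetric (γ.geom 0) p₀ u)⁻¹ μ ν *
            coordRicci (modelBasis m) (christoffel (modelBasis m)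
          (chartMetric (γ.geom 0) p₀)) u μ ν) * chartMetric (γ.geom 0) p₀ u α β)
          * deriv (fun t => (chartMetric (γ.geom t) p₀ u)⁻¹ α β) 0)) =
      chartIntegral P p₀ K fun p => ∑ α, ∑ β,
      (ricci (lc P) p (coordVec p₀ α p) (coordVec p₀ β p) - 1 / 2 * scalarCurvature P (lc P) p *
        P.g p (coordVec p₀ α p) (coordVec p₀ β p)) * deltaInv γ p₀ p α β := by
    rw [γ.geom_zero]
    refine (chartIntegral_eq_setIntegral P hK hKp fun q hq => ?_).symm
    have hq' := hKp hq
    simp only [chartMetric_apply hq', ricci_coordVec _ hq', (hlc P).coordRicci_eq hq',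
      scalarCurvature_eq_sum _ hq', deltaInv]
    rfl
  rw [h5, ← chartIntegral_const_mul, ← chartIntegral_const_mul, ← chartIntegral_const_mul,
    ← chartIntegral_add P cR (cT hTz.smooth) hK hKp,
    ← chartIntegral_add P (ContinuousOn.fun_add cR (cT hTz.smooth)) (cT hTm.smooth) hK hKp]
  refine chartIntegral_congr P hK hKp fun p _ => ?_
  simp only [Finset.mul_sum, ← Finset.sum_add_distrib]
  refine Finset.sum_congr rfl fun α _ => Finset.sum_congr rfl fun β _ => ?_
  change _ = (1 / (2 * ϰ) * (_ - _) - 1 / 2 * (Tm p _ _ + Tz p _ _)) * _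
  ring

end Action

/-! ### Vertical vectors in charts -/

section Vertical

variable {m : ℕ} {V : Type*} [TopologicalSpace V] [ChartedSpace (EuclideanSpace ℝ (Fin m)) V]
  [IsManifold (𝓡 m) ∞ V] {P : PhaseGeometry m V} {p₀ p : Phase m V}

lemma mfderiv_extChartAt_eq_sum (hp : p ∈ chartDomain p₀) (X : TangentSpace (𝓡 m).tangent p) :
    mfderiv (𝓡 m).tangent 𝓘(ℝ, Model m) (extChartAt (𝓡 m).tangent p₀) p X =
      ∑ α, coordCoef p₀ α p X • modelBasis m α := by
  conv_lhs => rw [eq_sum_coordCoef hp X]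
  refine (map_sum _ _ _).trans (Finset.sum_congr rfl fun α _ => ?_)
  refine (map_smul _ _ _).trans ?_
  exact congrArg _ (mfderiv_extChartAt_coordVec hp α)

/-- Vertical vectors are those without base component in the chart. -/
lemma isVertical_iff_fst (hp : p ∈ chartDomain p₀) (X : TangentSpace (𝓡 m).tangent p) :
    IsVertical X ↔ (mfderiv (𝓡 m).tangent 𝓘(ℝ, Model m) (extChartAt (𝓡 m).tangent p₀) p X :
      Model m).1 = 0 := by
  have hproj : MDifferentiableAt (𝓡 m).tangent (𝓡 m) (fun q : Phase m V => q.proj) p :=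
    (Bundle.contMDiff_proj (IB := 𝓡 m) (n := 1) (TangentSpace (𝓡 m) : V → Type _)).mdifferentiableAt
      (by simp)
  have hpb : p.proj ∈ (extChartAt (𝓡 m) p₀.proj).source := by
    rw [chartDomain, FiberBundle.extChartAt] at hp
    exact hp.2.1
  have hchart : MDifferentiableAt (𝓡 m) 𝓘(ℝ, EuclideanSpace ℝ (Fin m))
      (extChartAt (𝓡 m) p₀.proj) p.proj := by
    rw [extChartAt_source] at hpb
    exact mdifferentiableAt_extChartAt hpb
  have h1 := hchart.hasMFDerivAt.comp p hproj.hasMFDerivAt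
  have h2 := (ContinuousLinearMap.fst ℝ (EuclideanSpace ℝ (Fin m))
    (EuclideanSpace ℝ (Fin m))).hasMFDerivAt (x := extChartAt (𝓡 m).tangent p₀ p) |>.comp p
      ((contMDiffAt_chart (n := 1) hp).mdifferentiableAt (by simp)).hasMFDerivAt
  have h3 := hasMFDerivAt_unique h1 h2
  have h4 := congrArg (fun L => L X) h3
  obtain ⟨e, he⟩ := isInvertible_mfderiv_extChartAt hpb
  rw [← he] at h4
  constructor
  · intro h
    refine h4.symm.trans ?_
    exact (congrArg e h).trans (map_zero e)
  · intro h
    exact e.injective (h4.trans (h.trans (map_zero e).symm))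

/-- In a chart, the vertical vectors are the combinations of the `∂/∂yᵃ`. -/
lemma isVertical_iff_coordCoef (hp : p ∈ chartDomain p₀) (X : TangentSpace (𝓡 m).tangent p) :
    IsVertical X ↔ ∀ i, coordCoef p₀ (Sum.inl i) p X = 0 := by
  rw [isVertical_iff_fst hp, mfderiv_extChartAt_eq_sum hp]
  have h (i : Fin m) : (∑ α, coordCoef p₀ α p X • modelBasis m α : Model m).1 i =
      coordCoef p₀ (Sum.inl i) p X := by
    rw [Fintype.sum_sum_type]
    simp only [modelBasis, Module.Basis.prod_apply, Sum.elim_inl, Sum.elim_inr, Function.comp_apply]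
    simp [Prod.fst_sum, Finset.sum_apply, Pi.single_apply]
  constructor
  · intro h0 i
    rw [← h i]
    exact congrArg (fun x : EuclideanSpace ℝ (Fin m) => x i) h0
  · intro h0
    ext i
    exact (h i).trans (h0 i)

lemma isVertical_coordVec (hp : p ∈ chartDomain p₀) (a : Fin m) :
    IsVertical (coordVec p₀ (Sum.inr a) p) := by
  rw [isVertical_iff_coordCoef hp]
  intro i
  rw [coordCoef_coordVec hp, if_neg (by simp)]

lemma IsVertical.add {X Y : TangentSpace (𝓡 m).tangent p} (hX : IsVertical X)
    (hY : IsVertical Y) : IsVertical (X + Y) := by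
  rw [isVertical_iff_coordCoef (mem_chartDomain p)] at *
  intro i
  rw [map_add, hX, hY, add_zero]

lemma IsVertical.smul {X : TangentSpace (𝓡 m).tangent p} (hX : IsVertical X) (c : ℝ) :
    IsVertical (c • X) := by
  rw [isVertical_iff_coordCoef (mem_chartDomain p)] at *
  intro i
  rw [map_smul, hX, smul_zero]

/-- The pointwise linear algebra behind the equivalence of the variational and the field equations:
a symmetric form `E` vanishes as soon as all components of `E g⁻¹` other than the mixed ones
`(inl i, inr a)` vanish. -/
lemma eq_zero_of_sum_mul_inv_eq_zero (P : PhaseGeometry m V) (hp : p ∈ chartDomain p₀)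
    {E : Fin m ⊕ Fin m → Fin m ⊕ Fin m → ℝ} (hE : ∀ α β, E α β = E β α)
    (h : ∀ α β, (α.isRight ∨ β.isLeft) → ∑ ν, E α ν * (metricMatrix P p₀ p)⁻¹ ν β = 0)
    (α β : Fin m ⊕ Fin m) : E α β = 0 := by
  have hdet := (P.det_metricMatrix_ne_zero hp).isUnit
  have hEG (α ν) : E α ν = ∑ β, (∑ κ, E α κ * (metricMatrix P p₀ p)⁻¹ κ β) *
      metricMatrix P p₀ p β ν := by
    have h1 : Matrix.of E = (Matrix.of E * (metricMatrix P p₀ p)⁻¹) * metricMatrix P p₀ p := by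
      rw [Matrix.mul_assoc, Matrix.nonsing_inv_mul _ hdet, Matrix.mul_one]
    exact congrFun (congrFun h1 α) ν
  -- the rows `inr a` of `E g⁻¹` vanish entirely, hence so do those of `E`
  have hr (a : Fin m) (ν) : E (Sum.inr a) ν = 0 := by
    rw [hEG]
    exact Finset.sum_eq_zero fun β _ => by rw [h _ β (Or.inl rfl), zero_mul]
  -- the mixed components of `E g⁻¹` are those of a vertical vector orthogonal to everything
  have hM (i a : Fin m) : ∑ κ, E (Sum.inl i) κ * (metricMatrix P p₀ p)⁻¹ κ (Sum.inr a) = 0 := by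
    set M : Fin m → ℝ := fun a => ∑ κ, E (Sum.inl i) κ * (metricMatrix P p₀ p)⁻¹ κ (Sum.inr a)
      with hMdef
    have hc (c : Fin m) : P.g p (∑ b, M b • coordVec p₀ (Sum.inr b) p)
        (coordVec p₀ (Sum.inr c) p) = 0 := by
      have h1 := hEG (Sum.inl i) (Sum.inr c)
      rw [hE, hr, Fintype.sum_sum_type] at h1
      have h2 : ∑ j : Fin m, (∑ κ, E (Sum.inl i) κ * (metricMatrix P p₀ p)⁻¹ κ (Sum.inl j)) *
          metricMatrix P p₀ p (Sum.inl j) (Sum.inr c) = 0 :=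
        Finset.sum_eq_zero fun j _ => by rw [h _ _ (Or.inr rfl), zero_mul]
      rw [h2, zero_add] at h1
      rw [map_sum (P.g p), FunLike.coe_sum, Finset.sum_apply, h1]
      refine Finset.sum_congr rfl fun b _ => ?_
      rw [map_smul (P.g p), FunLike.coe_smul, Pi.smul_apply, smul_eq_mul]
      rfl
    have hv : IsVertical (∑ b, M b • coordVec p₀ (Sum.inr b) p) := by
      rw [isVertical_iff_coordCoef hp]
      intro j
      rw [map_sum]
      refine Finset.sum_eq_zero fun b _ => ?_
      rw [map_smul, coordCoef_coordVec hp, if_neg (by simp), smul_zero]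
    -- it is orthogonal to the vertical vectors by `hc`, to the horizontal ones by adaptedness
    have h0 : ∑ b, M b • coordVec p₀ (Sum.inr b) p = 0 := by
      refine P.g_nondeg p _ fun Y => ?_
      have hY : Y = P.h p Y + (Y - P.h p Y) := (add_sub_cancel _ _).symm
      have hvY : P.g p (∑ b, M b • coordVec p₀ (Sum.inr b) p) (Y - P.h p Y) = 0 := by
        have h3 := (isVertical_iff_coordCoef hp _).1 (P.isVertical_sub Y)
        rw [eq_sum_coordCoef hp (Y - P.h p Y), Fintype.sum_sum_type]
        simp only [h3, zero_smul, Finset.sum_const_zero, zero_add]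
        rw [map_sum]
        refine Finset.sum_eq_zero fun c _ => ?_
        rw [map_smul, hc, smul_zero]
      rw [hY, map_add, hvY, add_zero, P.g_symm]
      exact P.g_adapted p _ _ hv
    have h1 := congrArg (coordCoef p₀ (Sum.inr a) p) h0
    rw [map_sum, map_zero] at h1
    simp only [map_smul, coordCoef_coordVec hp, Sum.inr.injEq, smul_eq_mul, mul_ite, mul_one,
      mul_zero] at h1
    rw [Finset.sum_ite_eq, if_pos (Finset.mem_univ a)] at h1
    exact h1
  rcases α with i | a
  · rw [hEG]
    refine Finset.sum_eq_zero fun β _ => ?_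
    rcases β with j | b
    · rw [h _ _ (Or.inr rfl), zero_mul]
    · rw [hM, zero_mul]
  · exact hr a β

end Vertical

/-! ### Deformations of geometric data -/

section Shear

variable {m : ℕ} {V : Type*} [TopologicalSpace V] [ChartedSpace (EuclideanSpace ℝ (Fin m)) V]
  [IsManifold (𝓡 m) ∞ V]

/-- The components of a tangent vector in a chart, as continuous linear forms. -/
def coordForm (p₀ : Phase m V) (β : Fin m ⊕ Fin m) (q : Phase m V) :
    TangentSpace (𝓡 m).tangent q →L[ℝ] ℝ :=
  ⟨coordCoef p₀ β q, let L : Model m →ₗ[ℝ] ℝ := coordCoef p₀ β q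
    L.continuous_of_finiteDimensional⟩

variable (m V) in
/-- Cut-off functions on the phase space, with values in `[0, 1]` and compact support in the domain
of the chart around `p₀`. -/
structure CutOff (p₀ : Phase m V) where
  /-- the function -/
  toFun : Phase m V → ℝ
  smooth : ContMDiff (𝓡 m).tangent 𝓘(ℝ, ℝ) ∞ toFun
  nonneg : ∀ q, 0 ≤ toFun q
  le_one : ∀ q, toFun q ≤ 1
  isCompact : IsCompact (tsupport toFun)
  subset : tsupport toFun ⊆ chartDomain p₀

variable {p₀ q p : Phase m V} (ρ : CutOff m V p₀) (α β : Fin m ⊕ Fin m) (P : PhaseGeometry m V)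

/-- The field of endomorphisms `ρ ∂_α ⊗ du^β`. -/
def shear (q : Phase m V) : TangentSpace (𝓡 m).tangent q →L[ℝ] TangentSpace (𝓡 m).tangent q :=
  ρ.toFun q • (coordForm p₀ β q).smulRight (coordVec p₀ α q)

lemma shear_apply (X : TangentSpace (𝓡 m).tangent q) :
    shear ρ α β q X = (ρ.toFun q * coordCoef p₀ β q X) • coordVec p₀ α q := by
  rw [← smul_smul]
  rfl

lemma CutOff.mem_or_eq_zero (q : Phase m V) : q ∈ chartDomain p₀ ∨ ρ.toFun q = 0 := by
  by_cases h : q ∈ tsupport ρ.toFun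
  · exact Or.inl (ρ.subset h)
  · exact Or.inr (image_eq_zero_of_notMem_tsupport h)

/-- The trace of `ρ ∂_α ⊗ du^β`. -/
def shearTrace (q : Phase m V) : ℝ := if β = α then ρ.toFun q else 0

lemma shear_shear (X : TangentSpace (𝓡 m).tangent q) :
    shear ρ α β q (shear ρ α β q X) = shearTrace ρ α β q • shear ρ α β q X := by
  simp only [shear_apply, map_smul, smul_smul]
  congr 1
  rcases ρ.mem_or_eq_zero q with hq | hq
  · rw [coordCoef_coordVec hq, shearTrace]
    split_ifs <;> ring
  · rw [hq]; ring

lemma shearTrace_nonneg : 0 ≤ shearTrace ρ α β q := by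
  unfold shearTrace; split_ifs
  exacts [ρ.nonneg q, le_rfl]

lemma shearTrace_le_one : shearTrace ρ α β q ≤ 1 := by
  unfold shearTrace; split_ifs
  exacts [ρ.le_one q, zero_le_one]

lemma contMDiff_shearTrace : ContMDiff (𝓡 m).tangent 𝓘(ℝ, ℝ) ∞ (shearTrace ρ α β) := by
  unfold shearTrace
  by_cases h : β = α
  · simpa only [h, if_true] using ρ.smooth
  · simpa only [h, if_false] using contMDiff_const

lemma smoothFieldAt_shear {X : VField m V} (hX : SmoothFieldAt X p) :
    SmoothFieldAt (fun q => shear ρ α β q (X q)) p := by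
  by_cases hp : p ∈ tsupport ρ.toFun
  · have hp' := ρ.subset hp
    refine (SmoothFieldAt.smul (f := fun q => ρ.toFun q * coordCoef p₀ β q (X q))
      (ρ.smooth.contMDiffAt.mul (contMDiffAt_coordCoef hp' hX β))
      (smoothFieldAt_coordVec hp' α)).congr (Filter.Eventually.of_forall fun q => ?_)
    rw [shear_apply]
    rfl
  · have hz : SmoothFieldAt (0 : VField m V) p :=
      (Bundle.contMDiff_zeroSection ℝ
        (TangentSpace (𝓡 m).tangent : Phase m V → Type _)).contMDiffAt
    refine hz.congr ?_
    filter_upwards [(isClosed_tsupport ρ.toFun).isOpen_compl.mem_nhds hp] with y hy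
    rw [shear_apply, image_eq_zero_of_notMem_tsupport hy, zero_mul, zero_smul]
    rfl

/-- The amplitude `s = sin t / 2` of the deformation at time `t`. It is bounded by `1 / 2`, so that
`1 + s ρ` is positive at all times, and has nonzero derivative at `t = 0`. -/
def amplitude (t : ℝ) : ℝ := Real.sin t / 2

/-- The amplitude `s / (1 + s tr B)` of the inverse `1 - s / (1 + s tr B) • B` of `1 + s • B`, where
`B = ρ ∂_α ⊗ du^β`. -/
def invAmplitude (t : ℝ) (q : Phase m V) : ℝ :=
  amplitude t / (1 + amplitude t * shearTrace ρ α β q)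

lemma one_add_amplitude_mul_pos (t : ℝ) : 0 < 1 + amplitude t * shearTrace ρ α β q := by
  have h0 := shearTrace_nonneg ρ α β (q := q)
  have h1 := shearTrace_le_one ρ α β (q := q)
  have h2 := Real.neg_one_le_sin t
  unfold amplitude
  nlinarith

lemma amplitude_eq (t : ℝ) :
    amplitude t = invAmplitude ρ α β t q * (1 + amplitude t * shearTrace ρ α β q) :=
  (div_mul_cancel₀ _ (one_add_amplitude_mul_pos ρ α β t).ne').symm

/-- The automorphisms `F = 1 + s B`, `B = ρ ∂_α ⊗ du^β`, of the tangent spaces, where `s` is the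
amplitude at time `t`. -/
def deform (t : ℝ) (q : Phase m V) :
    TangentSpace (𝓡 m).tangent q →L[ℝ] TangentSpace (𝓡 m).tangent q :=
  ContinuousLinearMap.id ℝ _ + amplitude t • shear ρ α β q

/-- The inverse of `deform`. -/
def deformInv (t : ℝ) (q : Phase m V) :
    TangentSpace (𝓡 m).tangent q →L[ℝ] TangentSpace (𝓡 m).tangent q :=
  ContinuousLinearMap.id ℝ _ - invAmplitude ρ α β t q • shear ρ α β q

lemma deform_apply (t : ℝ) (X : TangentSpace (𝓡 m).tangent q) :
    deform ρ α β t q X = X + amplitude t • shear ρ α β q X := rfl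

lemma deformInv_apply (t : ℝ) (X : TangentSpace (𝓡 m).tangent q) :
    deformInv ρ α β t q X = X - invAmplitude ρ α β t q • shear ρ α β q X := rfl

lemma deform_deformInv (t : ℝ) (X : TangentSpace (𝓡 m).tangent q) :
    deform ρ α β t q (deformInv ρ α β t q X) = X := by
  have h := amplitude_eq ρ α β t (q := q)
  rw [deform_apply, deformInv_apply, map_sub, map_smul, shear_shear, smul_smul, smul_sub, smul_smul]
  have h2 : amplitude t • shear ρ α β q X = (invAmplitude ρ α β t q +
      amplitude t * (invAmplitude ρ α β t q * shearTrace ρ α β q)) • shear ρ α β q X := by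
    congr 1
    linear_combination h
  rw [h2, add_smul]
  module

lemma deformInv_deform (t : ℝ) (X : TangentSpace (𝓡 m).tangent q) :
    deformInv ρ α β t q (deform ρ α β t q X) = X := by
  have h := amplitude_eq ρ α β t (q := q)
  rw [deform_apply, deformInv_apply, map_add, map_smul, shear_shear, smul_smul, smul_add, smul_smul]
  have h2 : amplitude t • shear ρ α β q X = (invAmplitude ρ α β t q +
      invAmplitude ρ α β t q * (amplitude t * shearTrace ρ α β q)) • shear ρ α β q X := by
    congr 1
    linear_combination h
  rw [h2, add_smul]
  module

lemma deform_of_notMem {t : ℝ} (hq : q ∉ tsupport ρ.toFun) (X : TangentSpace (𝓡 m).tangent q) :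
    deform ρ α β t q X = X := by
  rw [deform_apply, shear_apply, image_eq_zero_of_notMem_tsupport hq, zero_mul, zero_smul,
    smul_zero, add_zero]

lemma deformInv_of_notMem {t : ℝ} (hq : q ∉ tsupport ρ.toFun) (X : TangentSpace (𝓡 m).tangent q) :
    deformInv ρ α β t q X = X := by
  rw [deformInv_apply, shear_apply, image_eq_zero_of_notMem_tsupport hq, zero_mul, zero_smul,
    smul_zero, sub_zero]

section Vertical
variable {α β} {X : TangentSpace (𝓡 m).tangent q}

/-- The endomorphism `∂_α ⊗ du^β` preserves the vertical distribution if `∂_α` is vertical or `du^β`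
vanishes on vertical vectors. -/
lemma isVertical_shear (hαβ : α.isRight ∨ β.isLeft) (hX : IsVertical X) :
    IsVertical (shear ρ α β q X) := by
  have h0 : IsVertical ((0 : ℝ) • X) := hX.smul 0
  rw [zero_smul] at h0
  rw [shear_apply]
  rcases ρ.mem_or_eq_zero q with hq | hq
  · rcases hαβ with h | h
    · obtain ⟨a, rfl⟩ := Sum.isRight_iff.1 h
      exact (isVertical_coordVec hq a).smul _
    · obtain ⟨i, rfl⟩ := Sum.isLeft_iff.1 h
      rw [(isVertical_iff_coordCoef hq X).1 hX, mul_zero, zero_smul]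
      exact h0
  · rw [hq, zero_mul, zero_smul]
    exact h0

lemma isVertical_deform (hαβ : α.isRight ∨ β.isLeft) (t : ℝ) (hX : IsVertical X) :
    IsVertical (deform ρ α β t q X) :=
  hX.add ((isVertical_shear ρ hαβ hX).smul _)

lemma isVertical_deformInv (hαβ : α.isRight ∨ β.isLeft) (t : ℝ) (hX : IsVertical X) :
    IsVertical (deformInv ρ α β t q X) := by
  rw [deformInv_apply, sub_eq_add_neg, ← neg_smul]
  exact hX.add ((isVertical_shear ρ hαβ hX).smul _)

end Vertical

lemma ContMDiffAt.snd_comp {f : Phase m V → ℝ} {t : ℝ}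
    (hf : ContMDiffAt (𝓡 m).tangent 𝓘(ℝ, ℝ) ∞ f p) :
    ContMDiffAt (𝓘(ℝ, ℝ).prod (𝓡 m).tangent) 𝓘(ℝ, ℝ) ∞ (fun z : ℝ × Phase m V => f z.2) (t, p) :=
  ContMDiffAt.comp (t, p) (g := f) hf contMDiffAt_snd

lemma contMDiffAt_amplitude {t : ℝ} :
    ContMDiffAt (𝓘(ℝ, ℝ).prod (𝓡 m).tangent) 𝓘(ℝ, ℝ) ∞
      (fun z : ℝ × Phase m V => amplitude z.1) (t, p) := by
  have h : ContDiffAt ℝ ∞ amplitude t := (Real.contDiff_sin.div_const 2).contDiffAt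
  exact ContMDiffAt.comp (t, p) (g := amplitude) h.contMDiffAt contMDiffAt_fst

lemma contMDiffAt_invAmplitude {t : ℝ} :
    ContMDiffAt (𝓘(ℝ, ℝ).prod (𝓡 m).tangent) 𝓘(ℝ, ℝ) ∞
      (fun z : ℝ × Phase m V => invAmplitude ρ α β z.1 z.2) (t, p) := by
  unfold invAmplitude
  exact contMDiffAt_amplitude.div₀ (contMDiffAt_const.add (contMDiffAt_amplitude.mul
    (ContMDiffAt.snd_comp (contMDiff_shearTrace ρ α β).contMDiffAt)))
    (one_add_amplitude_mul_pos ρ α β t).ne'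

lemma contMDiffAt_g_deform {t : ℝ} {X Y : VField m V} (hX : SmoothFieldAt X p)
    (hY : SmoothFieldAt Y p) :
    ContMDiffAt (𝓘(ℝ, ℝ).prod (𝓡 m).tangent) 𝓘(ℝ, ℝ) ∞
      (fun z : ℝ × Phase m V => P.g z.2 (deform ρ α β z.1 z.2 (X z.2))
        (deform ρ α β z.1 z.2 (Y z.2))) (t, p) := by
  have hX' := smoothFieldAt_shear ρ α β hX
  have hY' := smoothFieldAt_shear ρ α β hY
  have h1 := ContMDiffAt.snd_comp (t := t) (P.g_smooth p _ _ hX hY)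
  have h2 := ContMDiffAt.snd_comp (t := t) (P.g_smooth p _ _ hX' hY)
  have h3 := ContMDiffAt.snd_comp (t := t) (P.g_smooth p _ _ hX hY')
  have h4 := ContMDiffAt.snd_comp (t := t) (P.g_smooth p _ _ hX' hY')
  refine ContMDiffAt.congr_of_eventuallyEq ((h1.add (contMDiffAt_amplitude.mul (h2.add h3))).add
    ((contMDiffAt_amplitude.mul contMDiffAt_amplitude).mul h4))
    (Filter.Eventually.of_forall fun z => ?_)
  simp only [deform_apply, map_add, map_smul, FunLike.coe_add, Pi.add_apply, FunLike.coe_smul,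
    Pi.smul_apply, smul_eq_mul, Pi.mul_apply]
  ring

lemma contMDiffAt_h_deform {t : ℝ} {X Y : VField m V} (hX : SmoothFieldAt X p)
    (hY : SmoothFieldAt Y p) :
    ContMDiffAt (𝓘(ℝ, ℝ).prod (𝓡 m).tangent) 𝓘(ℝ, ℝ) ∞
      (fun z : ℝ × Phase m V => P.g z.2 (deformInv ρ α β z.1 z.2
        (P.h z.2 (deform ρ α β z.1 z.2 (X z.2)))) (Y z.2)) (t, p) := by
  have hX1 := P.h_smooth p _ hX
  have hX2 := P.h_smooth p _ (smoothFieldAt_shear ρ α β hX)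
  have h1 := ContMDiffAt.snd_comp (t := t) (P.g_smooth p _ _ hX1 hY)
  have h2 := ContMDiffAt.snd_comp (t := t) (P.g_smooth p _ _ hX2 hY)
  have h3 := ContMDiffAt.snd_comp (t := t) (P.g_smooth p _ _ (smoothFieldAt_shear ρ α β hX1) hY)
  have h4 := ContMDiffAt.snd_comp (t := t) (P.g_smooth p _ _ (smoothFieldAt_shear ρ α β hX2) hY)
  refine ContMDiffAt.congr_of_eventuallyEq ((h1.add (contMDiffAt_amplitude.mul h2)).sub
    ((contMDiffAt_invAmplitude ρ α β).mul (h3.add (contMDiffAt_amplitude.mul h4))))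
    (Filter.Eventually.of_forall fun z => ?_)
  simp only [deform_apply, deformInv_apply, map_add, map_sub, map_smul, FunLike.coe_add,
    FunLike.coe_sub, Pi.sub_apply, Pi.add_apply, FunLike.coe_smul, Pi.smul_apply, smul_eq_mul,
    Pi.mul_apply]
  ring

lemma smoothFieldAt_deform {t : ℝ} {X : VField m V} (hX : SmoothFieldAt X p) :
    SmoothFieldAt (fun q => deform ρ α β t q (X q)) p :=
  hX.add (SmoothFieldAt.smul (f := fun _ => amplitude t) contMDiffAt_const
    (smoothFieldAt_shear ρ α β hX))

lemma smoothFieldAt_deformInv {t : ℝ} {X : VField m V} (hX : SmoothFieldAt X p) :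
    SmoothFieldAt (fun q => deformInv ρ α β t q (X q)) p := by
  refine hX.sub (SmoothFieldAt.smul (f := fun q => invAmplitude ρ α β t q) ?_
    (smoothFieldAt_shear ρ α β hX))
  exact contMDiffAt_const.div₀ (contMDiffAt_const.add (contMDiffAt_const.mul
    (contMDiff_shearTrace ρ α β).contMDiffAt)) (one_add_amplitude_mul_pos ρ α β t).ne'

variable {α β}

/-- The bilinear form `g(F X, F Y)`. -/
def pullbackForm (g : Tensor2 m V) (F : Π p : Phase m V, TangentSpace (𝓡 m).tangent p →L[ℝ]
    TangentSpace (𝓡 m).tangent p) : Tensor2 m V :=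
  fun q =>
    let g' : Model m →L[ℝ] Model m →L[ℝ] ℝ := g q
    let F' : Model m →L[ℝ] Model m := F q
    g'.bilinearComp F' F'

lemma contMDiffAt_pullbackForm_deform (t : ℝ) {X Y : VField m V} (hX : SmoothFieldAt X p)
    (hY : SmoothFieldAt Y p) : ContMDiffAt (𝓡 m).tangent 𝓘(ℝ, ℝ) ∞
      (fun q => pullbackForm P.g (deform ρ α β t) q (X q) (Y q)) p := by
  have h := P.g_smooth p (fun q => deform ρ α β t q (X q)) (fun q => deform ρ α β t q (Y q))
    (smoothFieldAt_deform ρ α β hX) (smoothFieldAt_deform ρ α β hY)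
  exact h

lemma smoothFieldAt_conj_deform (t : ℝ) {X : VField m V} (hX : SmoothFieldAt X p) :
    SmoothFieldAt (fun q => deformInv ρ α β t q (P.h q (deform ρ α β t q (X q)))) p := by
  have h := P.h_smooth p (fun q => deform ρ α β t q (X q)) (smoothFieldAt_deform ρ α β hX)
  exact smoothFieldAt_deformInv ρ α β h

/-- The geometric data pulled back by the automorphism `F = 1 + s B` of the tangent bundle: the
horizontal projection `F⁻¹ h F` and the metric `g(F X, F Y)`. The condition on `α` and `β` ensures
that `F` preserves the vertical distribution. -/
def deformGeometry (hαβ : α.isRight ∨ β.isLeft) (t : ℝ) : PhaseGeometry m V where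
  h q := (deformInv ρ α β t q).comp ((P.h q).comp (deform ρ α β t q))
  g := pullbackForm P.g (deform ρ α β t)
  h_idem q X := by
    change deformInv ρ α β t q (P.h q (deform ρ α β t q (deformInv ρ α β t q
      (P.h q (deform ρ α β t q X))))) = deformInv ρ α β t q (P.h q (deform ρ α β t q X))
    rw [deform_deformInv, P.h_idem]
  h_ker q X := by
    change deformInv ρ α β t q (P.h q (deform ρ α β t q X)) = 0 ↔ _
    constructor
    · intro h
      have h1 := congrArg (deform ρ α β t q) h
      rw [deform_deformInv, map_zero, P.h_ker] at h1
      rw [← deformInv_deform ρ α β t X]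
      exact isVertical_deformInv ρ hαβ t h1
    · intro h
      rw [(P.h_ker q _).2 (isVertical_deform ρ hαβ t h), map_zero]
  g_symm q X Y := P.g_symm q _ _
  g_nondeg q X h := by
    have h1 : deform ρ α β t q X = 0 := P.g_nondeg q _ fun Y => by
      have := h (deformInv ρ α β t q Y)
      change P.g q (deform ρ α β t q X) (deform ρ α β t q (deformInv ρ α β t q Y)) = 0 at this
      rwa [deform_deformInv] at this
    rw [← deformInv_deform ρ α β t X, h1, map_zero]
  g_adapted q X Y hY := by
    change P.g q (deform ρ α β t q (deformInv ρ α β t q (P.h q (deform ρ α β t q X))))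
      (deform ρ α β t q Y) = 0
    rw [deform_deformInv]
    exact P.g_adapted q _ _ (isVertical_deform ρ hαβ t hY)
  g_smooth _ _ _ hX hY := contMDiffAt_pullbackForm_deform ρ P t hX hY
  h_smooth _ _ hX := smoothFieldAt_conj_deform ρ P t hX

lemma deformGeometry_g (hαβ : α.isRight ∨ β.isLeft) (t : ℝ) (X Y : TangentSpace (𝓡 m).tangent q) :
    (deformGeometry ρ P hαβ t).g q X Y = P.g q (deform ρ α β t q X) (deform ρ α β t q Y) := rfl

lemma deformGeometry_h (hαβ : α.isRight ∨ β.isLeft) (t : ℝ) (X : TangentSpace (𝓡 m).tangent q) :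
    (deformGeometry ρ P hαβ t).h q X =
      deformInv ρ α β t q (P.h q (deform ρ α β t q X)) := rfl

lemma amplitude_zero : amplitude 0 = 0 := by simp [amplitude]

lemma invAmplitude_zero : invAmplitude ρ α β 0 q = 0 := by
  rw [invAmplitude, amplitude_zero, zero_div]

lemma PhaseGeometry.ext_of_apply {P P' : PhaseGeometry m V} (hh : ∀ p X, P.h p X = P'.h p X)
    (hg : ∀ p X Y, P.g p X Y = P'.g p X Y) : P = P' := by
  have h1 : P.h = P'.h := funext fun p => ContinuousLinearMap.ext fun X => hh p X
  have h2 : P.g = P'.g := funext fun p => ContinuousLinearMap.ext fun X =>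
    ContinuousLinearMap.ext fun Y => hg p X Y
  cases P
  cases P'
  cases h1
  cases h2
  rfl

/-- The variation of the geometric data by the automorphisms `1 + s(t) ρ ∂_α ⊗ du^β`. -/
def deformVariation (hαβ : α.isRight ∨ β.isLeft) : Variation P (tsupport ρ.toFun) where
  geom := deformGeometry ρ P hαβ
  geom_zero := PhaseGeometry.ext_of_apply
    (fun q X => by
      rw [deformGeometry_h, deform_apply, deformInv_apply, amplitude_zero, invAmplitude_zero,
        zero_smul, zero_smul, add_zero, sub_zero])
    (fun q X Y => by
      rw [deformGeometry_g, deform_apply, deform_apply, amplitude_zero, zero_smul, zero_smul,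
        add_zero, add_zero])
  g_eq t q hq := ContinuousLinearMap.ext fun X => ContinuousLinearMap.ext fun Y => by
    rw [deformGeometry_g, deform_of_notMem ρ α β hq, deform_of_notMem ρ α β hq]
  h_eq t q hq := ContinuousLinearMap.ext fun X => by
    rw [deformGeometry_h, deform_of_notMem ρ α β hq, deformInv_of_notMem ρ α β hq]
  g_smooth t p X Y hX hY := contMDiffAt_g_deform ρ α β P hX hY
  h_smooth t p X Y hX hY := contMDiffAt_h_deform ρ α β P hX hY

end Shear

/-! ### Vanishing of tensors that annihilate all variations -/

section FundamentalLemma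

variable {m : ℕ} {V : Type*} [TopologicalSpace V] [ChartedSpace (EuclideanSpace ℝ (Fin m)) V]
  [IsManifold (𝓡 m) ∞ V] {p₀ q p : Phase m V} (ρ : CutOff m V p₀) {α β : Fin m ⊕ Fin m}
  (P : PhaseGeometry m V)

lemma hasDerivAt_amplitude : HasDerivAt amplitude (1 / 2) 0 := by
  have h := (Real.hasDerivAt_sin 0).div_const 2
  rwa [Real.cos_zero] at h

lemma hasDerivAt_invAmplitude : HasDerivAt (fun t => invAmplitude ρ α β t q) (1 / 2) 0 := by
  have h := hasDerivAt_amplitude.fun_div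
    ((hasDerivAt_amplitude.mul_const (shearTrace ρ α β q)).const_add 1)
    (one_add_amplitude_mul_pos ρ α β 0).ne'
  refine h.congr_deriv ?_
  rw [amplitude_zero]
  ring

variable (α β) in
/-- The matrix of `ρ ∂_α ⊗ du^β` in the chart. -/
def shearMatrix (q : Phase m V) : Matrix (Fin m ⊕ Fin m) (Fin m ⊕ Fin m) ℝ :=
  Matrix.of fun μ ν => if μ = α ∧ ν = β then ρ.toFun q else 0

lemma shearMatrix_mul_apply (A : Matrix (Fin m ⊕ Fin m) (Fin m ⊕ Fin m) ℝ) (μ ν : Fin m ⊕ Fin m) :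
    (shearMatrix ρ α β q * A) μ ν = if μ = α then ρ.toFun q * A β ν else 0 := by
  rw [Matrix.mul_apply]
  simp only [shearMatrix, Matrix.of_apply]
  by_cases h : μ = α
  · simp only [h, true_and, if_true, ite_mul, zero_mul]
    rw [Finset.sum_ite_eq']
    simp
  · simp only [h, false_and, if_false, zero_mul]
    exact Finset.sum_const_zero

lemma mul_transpose_shearMatrix_apply (A : Matrix (Fin m ⊕ Fin m) (Fin m ⊕ Fin m) ℝ)
    (μ ν : Fin m ⊕ Fin m) :
    (A * (shearMatrix ρ α β q).transpose) μ ν = if ν = α then ρ.toFun q * A μ β else 0 := by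
  have h : (A * (shearMatrix ρ α β q).transpose) =
      (shearMatrix ρ α β q * A.transpose).transpose := by
    rw [Matrix.transpose_mul, Matrix.transpose_transpose]
  rw [h, Matrix.transpose_apply, shearMatrix_mul_apply]
  rfl

lemma shearMatrix_mul_self :
    shearMatrix ρ α β q * shearMatrix ρ α β q = shearTrace ρ α β q • shearMatrix ρ α β q := by
  ext μ ν
  rw [shearMatrix_mul_apply, Matrix.smul_apply, shearMatrix, Matrix.of_apply, Matrix.of_apply,
    shearTrace, smul_eq_mul]
  split_ifs <;> simp_all

lemma deform_coordVec (t : ℝ) (μ : Fin m ⊕ Fin m) (hq : q ∈ chartDomain p₀) :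
    deform ρ α β t q (coordVec p₀ μ q) =
      ∑ ν, (1 + amplitude t • shearMatrix ρ α β q) ν μ • coordVec p₀ ν q := by
  have h (ν) : (1 + amplitude t • shearMatrix ρ α β q) ν μ • coordVec p₀ ν q =
      (if ν = μ then coordVec p₀ ν q else 0) +
      if ν = α then (amplitude t * (if β = μ then ρ.toFun q else 0)) • coordVec p₀ ν q else 0 := by
    rw [Matrix.add_apply, add_smul, Matrix.one_apply, Matrix.smul_apply, shearMatrix,
      Matrix.of_apply, smul_eq_mul]
    congr 1
    · split_ifs
      · exact one_smul _ _
      · exact zero_smul _ _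
    · by_cases h1 : ν = α <;> by_cases h2 : β = μ <;> simp [h1, h2, eq_comm (a := μ)]
  rw [Finset.sum_congr rfl fun ν _ => h ν, Finset.sum_add_distrib, Finset.sum_ite_eq',
    Finset.sum_ite_eq', if_pos (Finset.mem_univ _), if_pos (Finset.mem_univ _), deform_apply,
    shear_apply, coordCoef_coordVec hq, smul_smul]
  congr 2
  split_ifs <;> ring

lemma metricMatrix_deform (hαβ : α.isRight ∨ β.isLeft) (t : ℝ) (hq : q ∈ chartDomain p₀) :
    metricMatrix (deformGeometry ρ P hαβ t) p₀ q =
      (1 + amplitude t • shearMatrix ρ α β q).transpose *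
        (metricMatrix P p₀ q * (1 + amplitude t • shearMatrix ρ α β q)) := by
  ext μ ν
  rw [Matrix.mul_apply]
  change (deformGeometry ρ P hαβ t).g q (coordVec p₀ μ q) (coordVec p₀ ν q) = _
  rw [deformGeometry_g, deform_coordVec ρ t μ hq, deform_coordVec ρ t ν hq, map_sum (P.g q),
    FunLike.coe_sum, Finset.sum_apply]
  refine Finset.sum_congr rfl fun σ _ => ?_
  rw [map_smul (P.g q), FunLike.coe_smul, Pi.smul_apply, smul_eq_mul, map_sum, Matrix.mul_apply]
  congr 1
  refine Finset.sum_congr rfl fun τ _ => ?_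
  rw [map_smul, smul_eq_mul, mul_comm]
  rfl

lemma inv_metricMatrix_deform (hαβ : α.isRight ∨ β.isLeft) (t : ℝ) (hq : q ∈ chartDomain p₀) :
    (metricMatrix (deformGeometry ρ P hαβ t) p₀ q)⁻¹ =
      (1 - invAmplitude ρ α β t q • shearMatrix ρ α β q) * ((metricMatrix P p₀ q)⁻¹ *
        (1 - invAmplitude ρ α β t q • shearMatrix ρ α β q).transpose) := by
  have hdet := (P.det_metricMatrix_ne_zero hq).isUnit
  have h := amplitude_eq ρ α β t (q := q)
  have hFF : (1 + amplitude t • shearMatrix ρ α β q) *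
      (1 - invAmplitude ρ α β t q • shearMatrix ρ α β q) = 1 := by
    rw [add_mul, mul_sub, mul_sub, Matrix.one_mul, Matrix.one_mul, Matrix.mul_one,
      smul_mul_smul_comm, shearMatrix_mul_self, smul_smul]
    have h2 : amplitude t • shearMatrix ρ α β q = (invAmplitude ρ α β t q +
      amplitude t * invAmplitude ρ α β t q * shearTrace ρ α β q) • shearMatrix ρ α β q := by
      congr 1
      linear_combination h
    rw [h2, add_smul]
    abel
  refine Matrix.inv_eq_right_inv ?_
  rw [metricMatrix_deform ρ P hαβ t hq]
  set F := 1 + amplitude t • shearMatrix ρ α β q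
  set F' := 1 - invAmplitude ρ α β t q • shearMatrix ρ α β q
  calc F.transpose * (metricMatrix P p₀ q * F) * (F' * ((metricMatrix P p₀ q)⁻¹ * F'.transpose))
      = F.transpose * (metricMatrix P p₀ q * (F * F') * (metricMatrix P p₀ q)⁻¹) *
          F'.transpose := by
        simp only [Matrix.mul_assoc]
    _ = (F' * F).transpose := by
        rw [hFF, Matrix.mul_one, Matrix.mul_nonsing_inv _ hdet, Matrix.mul_one,
          Matrix.transpose_mul]
    _ = 1 := by rw [mul_eq_one_comm.1 hFF, Matrix.transpose_one]

/-- The inverse metric varies by `-½ (B g⁻¹ + g⁻¹ Bᵀ)`. -/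
lemma deltaInv_deformVariation (hαβ : α.isRight ∨ β.isLeft) (hq : q ∈ chartDomain p₀)
    (μ ν : Fin m ⊕ Fin m) : deltaInv (deformVariation ρ P hαβ) p₀ q μ ν =
      -(1 / 2) * ((if μ = α then ρ.toFun q * (metricMatrix P p₀ q)⁻¹ β ν else 0) +
        if ν = α then ρ.toFun q * (metricMatrix P p₀ q)⁻¹ μ β else 0) := by
  set B := shearMatrix ρ α β q with hB
  set G := (metricMatrix P p₀ q)⁻¹ with hG
  have h1 (t : ℝ) : (metricMatrix ((deformVariation ρ P hαβ).geom t) p₀ q)⁻¹ μ ν =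
      G μ ν - invAmplitude ρ α β t q * ((B * G) μ ν + (G * B.transpose) μ ν)
        + invAmplitude ρ α β t q * invAmplitude ρ α β t q * (B * (G * B.transpose)) μ ν := by
    have h2 : (1 - invAmplitude ρ α β t q • B) * (G * (1 - invAmplitude ρ α β t q • B).transpose) =
        G - invAmplitude ρ α β t q • (B * G + G * B.transpose) +
          (invAmplitude ρ α β t q * invAmplitude ρ α β t q) • (B * (G * B.transpose)) := by
      rw [Matrix.transpose_sub, Matrix.transpose_one, Matrix.transpose_smul, mul_sub, sub_mul,
        Matrix.mul_one, Matrix.one_mul, mul_sub, Matrix.mul_smul,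
        Matrix.smul_mul, smul_mul_smul_comm, smul_add]
      abel
    exact (congrFun (congrFun ((inv_metricMatrix_deform ρ P hαβ t hq).trans h2) μ) ν)
  have hr := hasDerivAt_invAmplitude ρ (α := α) (β := β) (q := q)
  have h2 := ((hr.mul_const ((B * G) μ ν + (G * B.transpose) μ ν)).const_sub (G μ ν)).fun_add
    ((hr.fun_mul hr).mul_const ((B * (G * B.transpose)) μ ν))
  unfold deltaInv
  rw [funext h1, h2.deriv, invAmplitude_zero, shearMatrix_mul_apply,
    mul_transpose_shearMatrix_apply]
  ring

/-- The first variation of a symmetric tensor density along `deformVariation` is a component of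
`E g⁻¹`. -/
lemma sum_mul_deltaInv_deformVariation (hαβ : α.isRight ∨ β.isLeft) (hq : q ∈ chartDomain p₀)
    {E : Fin m ⊕ Fin m → Fin m ⊕ Fin m → ℝ} (hE : ∀ μ ν, E μ ν = E ν μ) :
    ∑ μ, ∑ ν, E μ ν * deltaInv (deformVariation ρ P hαβ) p₀ q μ ν =
      -(ρ.toFun q * ∑ ν, E α ν * (metricMatrix P p₀ q)⁻¹ ν β) := by
  simp only [deltaInv_deformVariation ρ P hαβ hq, mul_add, Finset.sum_add_distrib, mul_ite,
    mul_zero]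
  rw [Finset.sum_comm]
  simp only [Finset.sum_ite_eq', Finset.mem_univ, if_true]
  rw [← Finset.sum_add_distrib, Finset.mul_sum, ← Finset.sum_neg_distrib]
  refine Finset.sum_congr rfl fun ν _ => ?_
  rw [hE ν α, P.inv_metricMatrix_symm p₀ q β ν]
  ring

variable [T2Space V]

lemma exists_cutOff {U : Set (Phase m V)} (hU : U ∈ 𝓝 p₀) :
    ∃ ρ : CutOff m V p₀, ρ.toFun p₀ = 1 ∧ tsupport ρ.toFun ⊆ U := by
  obtain ⟨f, -, hf⟩ := (SmoothBumpFunction.nhds_basis_tsupport (I := (𝓡 m).tangent) p₀).mem_iff.1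
    (Filter.inter_mem hU ((isOpen_chartDomain p₀).mem_nhds (mem_chartDomain p₀)))
  exact ⟨⟨f, f.contMDiff, fun _ => f.nonneg, fun _ => f.le_one, f.hasCompactSupport,
    fun q hq => (hf hq).2⟩, f.eq_one, fun q hq => (hf hq).1⟩

/-- The fundamental lemma of the calculus of variations: a continuous function whose integrals
against all cut-off functions vanish is zero. -/
lemma eq_zero_of_chartIntegral_cutOff {w : Phase m V → ℝ} (hw : ContinuousOn w (chartDomain p₀))
    (h : ∀ ρ : CutOff m V p₀,
      chartIntegral P p₀ (tsupport ρ.toFun) (fun q => ρ.toFun q * w q) = 0) :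
    w p₀ = 0 := by
  by_contra hne
  have hO : ∀ᶠ q in 𝓝 p₀, 0 < w p₀ * w q := by
    have hc : ContinuousAt w p₀ :=
      hw.continuousAt ((isOpen_chartDomain p₀).mem_nhds (mem_chartDomain p₀))
    exact (continuousAt_const.mul hc).eventually (lt_mem_nhds (mul_self_pos.2 hne))
  -- choose the cut-off with support in the neighbourhood where `w` has the sign of `w p₀`
  obtain ⟨ρ, hρ1, hρ⟩ := exists_cutOff hO
  have hρc : Continuous ρ.toFun := ρ.smooth.continuous
  have h1 : chartIntegral P p₀ (tsupport ρ.toFun) (fun q => w p₀ * (ρ.toFun q * w q)) = 0 := by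
    rw [chartIntegral_const_mul, h ρ, mul_zero]
  rw [chartIntegral_eq] at h1
  refine absurd h1 (ne_of_gt ?_)
  have := isAddHaarMeasure_volume_model m
  rw [setIntegral_pos_iff_support_of_nonneg_ae]
  · -- the integrand is positive where the cut-off function is
    have hopen : IsOpen ((extChartAt (𝓡 m).tangent p₀).target ∩
        (extChartAt (𝓡 m).tangent p₀).symm ⁻¹' {q | 0 < ρ.toFun q}) :=
      (continuousOn_extChartAt_symm p₀).isOpen_inter_preimage (isOpen_extChartAt_target p₀)
        (isOpen_lt continuous_const hρc)
    refine (hopen.measure_pos volume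
      ⟨extChartAt (𝓡 m).tangent p₀ p₀, mem_extChartAt_target p₀, ?_⟩).trans_le (measure_mono ?_)
    · change 0 < ρ.toFun ((extChartAt (𝓡 m).tangent p₀).symm (extChartAt (𝓡 m).tangent p₀ p₀))
      rw [extChartAt_to_inv, hρ1]
      exact one_pos
    · rintro u ⟨hu, hu'⟩
      have hus : (extChartAt (𝓡 m).tangent p₀).symm u ∈ tsupport ρ.toFun :=
        subset_tsupport _ (ne_of_gt hu')
      refine ⟨ne_of_gt ?_, _, hus, (extChartAt (𝓡 m).tangent p₀).right_inv hu⟩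
      refine mul_pos (Real.sqrt_pos.2 (abs_pos.2 (det_chartMetric_ne_zero_of_mem_target P hu))) ?_
      rw [mul_left_comm]
      exact mul_pos hu' (hρ hus)
  · refine (ae_restrict_iff' (measurableSet_image_chart ρ.isCompact ρ.subset)).2
      (Filter.Eventually.of_forall ?_)
    rintro _ ⟨q, hq, rfl⟩
    refine mul_nonneg (Real.sqrt_nonneg _) ?_
    rw [(extChartAt (𝓡 m).tangent p₀).left_inv (ρ.subset hq), mul_left_comm]
    exact mul_nonneg (ρ.nonneg q) (hρ hq).le
  · exact integrableOn_sqrt_det_mul P (continuousOn_const.mul (hρc.continuousOn.mul hw))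
      ρ.isCompact ρ.subset

/-- A symmetric tensor which annihilates all variations of the inverse metric vanishes. The
variations `deformVariation` already suffice. -/
theorem eq_zero_of_forall_variation
    {E : Π p : Phase m V, TangentSpace (𝓡 m).tangent p → TangentSpace (𝓡 m).tangent p → ℝ}
    (hE : ∀ p v w, E p v w = E p w v)
    (hEc : ∀ α β, ContinuousOn (fun p => E p (coordVec p₀ α p) (coordVec p₀ β p)) (chartDomain p₀))
    (h : ∀ K : Set (Phase m V), IsCompact K → K ⊆ chartDomain p₀ → ∀ γ : Variation P K,
      chartIntegral P p₀ K (fun p => ∑ α, ∑ β, E p (coordVec p₀ α p) (coordVec p₀ β p) *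
        deltaInv γ p₀ p α β) = 0) (α β : Fin m ⊕ Fin m) :
    E p₀ (coordVec p₀ α p₀) (coordVec p₀ β p₀) = 0 := by
  refine eq_zero_of_sum_mul_inv_eq_zero P (mem_chartDomain p₀)
    (E := fun α β => E p₀ (coordVec p₀ α p₀) (coordVec p₀ β p₀)) (fun α β => hE _ _ _)
    (fun α β hαβ => ?_) α β
  refine eq_zero_of_chartIntegral_cutOff P (p₀ := p₀) (w := fun p => ∑ ν,
    E p (coordVec p₀ α p) (coordVec p₀ ν p) * (metricMatrix P p₀ p)⁻¹ ν β) ?_ fun ρ => ?_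
  · exact continuousOn_finsetSum _ fun ν _ => (hEc α ν).mul fun p hp =>
      (P.contMDiffAt_inv_metricMatrix hp ν β).continuousAt.continuousWithinAt
  · have h1 := h _ ρ.isCompact ρ.subset (deformVariation ρ P hαβ)
    rw [chartIntegral_congr P ρ.isCompact ρ.subset fun q hq =>
      sum_mul_deltaInv_deformVariation ρ P hαβ (ρ.subset hq) (E := fun α β =>
        E q (coordVec p₀ α q) (coordVec p₀ β q)) fun μ ν => hE _ _ _] at h1
    have h2 := chartIntegral_const_mul (K := tsupport ρ.toFun) (p₀ := p₀) P (-1)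
      (fun q => ρ.toFun q *
      ∑ ν, E q (coordVec p₀ α q) (coordVec p₀ ν q) * (metricMatrix P p₀ q)⁻¹ ν β)
    simp only [neg_one_mul] at h2
    rw [h1] at h2
    exact neg_eq_zero.1 h2.symm

end FundamentalLemma

/-! ### The field equations -/

section FieldEquations

variable {m : ℕ} {V : Type*} [TopologicalSpace V] [ChartedSpace (EuclideanSpace ℝ (Fin m)) V]
  [IsManifold (𝓡 m) ∞ V] {P : PhaseGeometry m V} {p₀ p : Phase m V} {ϰ : ℝ}

/-- The trace of the metric is the dimension `2m` of the phase space. -/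
lemma metricTrace_g (P : PhaseGeometry m V) (p : Phase m V) :
    metricTrace P p (fun a b => P.g p a b) = 2 * m := by
  have hdet := (P.det_metricMatrix_ne_zero (mem_chartDomain p)).isUnit
  rw [metricTrace_eq_sum (mem_chartDomain p) (eq_sum_tensor2 (mem_chartDomain p) P.g)]
  have h (α : Fin m ⊕ Fin m) : ∑ β, (metricMatrix P p p)⁻¹ α β *
      P.g p (coordVec p α p) (coordVec p β p) = 1 := by
    have h1 := congrFun (congrFun (Matrix.nonsing_inv_mul _ hdet) α) α
    rw [Matrix.mul_apply, Matrix.one_apply_eq] at h1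
    refine Eq.trans (Finset.sum_congr rfl fun β _ => ?_) h1
    rw [P.metricMatrix_symm p p β α]
    rfl
  rw [Finset.sum_congr rfl fun α _ => h α]
  simp
  ring

lemma metricTrace_sub_smul (P : PhaseGeometry m V) (p : Phase m V) (c a b : ℝ)
    (A B : TangentSpace (𝓡 m).tangent p → TangentSpace (𝓡 m).tangent p → ℝ) :
    metricTrace P p (fun v w => c * (a * A v w - b * B v w)) =
      c * (a * metricTrace P p A - b * metricTrace P p B) := by
  simp only [metricTrace, Finset.mul_sum, ← Finset.sum_sub_distrib]
  refine Finset.sum_congr rfl fun α _ => Finset.sum_congr rfl fun β _ => ?_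
  ring

/-- Trace reversal: in total dimension `2m ≠ 2`, the Euler–Lagrange tensor vanishes if and only if
the Ricci tensor equals the trace-reversed source. -/
lemma eulerLagrange_eq_zero_iff (hm : 2 ≤ m) (hϰ : ϰ ≠ 0) (P : PhaseGeometry m V)
    (D : LinearConnection m V) (T : Tensor2 m V) (p : Phase m V) :
    (∀ v w, eulerLagrange ϰ P D T p v w = 0) ↔ ∀ v w, ricci D p v w = matterSource ϰ P T p v w := by
  have hm1 : (m : ℝ) - 1 ≠ 0 := by
    have : (2 : ℝ) ≤ m := by exact_mod_cast hm
    linarith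
  have hm2 : 2 * (m : ℝ) - 2 ≠ 0 := by
    intro h; exact hm1 (by linarith)
  set τ := metricTrace P p (fun a b => T p a b) with hτ
  have h1 (v w) : eulerLagrange ϰ P D T p v w = 0 ↔
      ricci D p v w = ϰ * (1 * T p v w - -(scalarCurvature P D p / (2 * ϰ)) * P.g p v w) := by
    have h : eulerLagrange ϰ P D T p v w = 1 / (2 * ϰ) * (ricci D p v w -
        ϰ * (1 * T p v w - -(scalarCurvature P D p / (2 * ϰ)) * P.g p v w)) := by
      rw [eulerLagrange]
      field_simp
      ring
    rw [h, mul_eq_zero, sub_eq_zero, or_iff_right]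
    exact one_div_ne_zero (mul_ne_zero two_ne_zero hϰ)
  simp only [h1]
  -- both ways, take the trace of the hypothesis to express `R` by the trace of the source
  constructor
  · intro h v w
    have h2 : scalarCurvature P D p =
        ϰ * (1 * τ - -(scalarCurvature P D p / (2 * ϰ)) * (2 * m)) := by
      rw [hτ, ← metricTrace_g P p, ← metricTrace_sub_smul]
      exact congrArg (metricTrace P p) (funext fun v => funext fun w => h v w)
    have h3 : -(scalarCurvature P D p / (2 * ϰ)) = 1 / (2 * (m : ℝ) - 2) * τ := by
      field_simp at h2 ⊢
      linear_combination h2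
    rw [h v w, h3, one_mul]
    rfl
  · intro h v w
    have h2 : scalarCurvature P D p = ϰ * (1 * τ - (1 / (2 * (m : ℝ) - 2) * τ) * (2 * m)) := by
      have h3 := metricTrace_sub_smul P p ϰ 1 (1 / (2 * (m : ℝ) - 2) * τ) (fun a b => T p a b)
        (fun a b => P.g p a b)
      rw [metricTrace_g] at h3
      refine Eq.trans (congrArg (metricTrace P p) (funext fun v => funext fun w =>
        (h v w).trans ?_)) h3
      rw [matterSource, one_mul]
    have h3 : -(scalarCurvature P D p / (2 * ϰ)) = 1 / (2 * (m : ℝ) - 2) * τ := by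
      rw [h2]
      field_simp
      ring
    rw [h v w, h3, one_mul]
    rfl

lemma IsEnergyMomentum.add_symm {L L' : Lagrangian m V} {T T' : Tensor2 m V}
    (hT : IsEnergyMomentum L P T) (hT' : IsEnergyMomentum L' P T') (p : Phase m V)
    (v w : TangentSpace (𝓡 m).tangent p) : (T + T') p v w = (T + T') p w v := by
  change T p v w + T' p v w = T p w v + T' p w v
  rw [hT.symm, hT'.symm]

lemma IsEnergyMomentum.contMDiffAt_add {L L' : Lagrangian m V} {T T' : Tensor2 m V}
    (hT : IsEnergyMomentum L P T) (hT' : IsEnergyMomentum L' P T') (p : Phase m V)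
    (X Y : VField m V)
    (hX : SmoothFieldAt X p) (hY : SmoothFieldAt Y p) :
    ContMDiffAt (𝓡 m).tangent 𝓘(ℝ, ℝ) ∞ (fun q => (T + T') q (X q) (Y q)) p :=
  (hT.smooth p X Y hX hY).add (hT'.smooth p X Y hX hY)

variable [T2Space V]

lemma eulerLagrange_eq_sum (P : PhaseGeometry m V) (D : LinearConnection m V) (T : Tensor2 m V)
    (hp : p ∈ chartDomain p₀) (v w : TangentSpace (𝓡 m).tangent p) :
    eulerLagrange ϰ P D T p v w = ∑ α, ∑ β, coordCoef p₀ α p v * (coordCoef p₀ β p w *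
      eulerLagrange ϰ P D T p (coordVec p₀ α p) (coordVec p₀ β p)) := by
  have hR := ricci_eq_sum_coordRicci D hp v w
  simp only [← ricci_coordVec D hp] at hR
  have hg := eq_sum_tensor2 hp P.g v w
  have hT := eq_sum_tensor2 hp T v w
  rw [eulerLagrange, hR, hg, hT]
  simp only [Finset.mul_sum, ← Finset.sum_sub_distrib]
  refine Finset.sum_congr rfl fun α _ => Finset.sum_congr rfl fun β _ => ?_
  rw [eulerLagrange]
  ring

lemma continuousOn_eulerLagrange (D : LinearConnection m V) {T : Tensor2 m V}
    (hT : ∀ p X Y, SmoothFieldAt X p → SmoothFieldAt Y p →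
      ContMDiffAt (𝓡 m).tangent 𝓘(ℝ, ℝ) ∞ (fun q => T q (X q) (Y q)) p) (α β : Fin m ⊕ Fin m) :
    ContinuousOn (fun p => eulerLagrange ϰ P D T p (coordVec p₀ α p) (coordVec p₀ β p))
      (chartDomain p₀) :=
  (continuousOn_const.mul ((continuousOn_ricci D α β).sub ((continuousOn_const.mul
    (continuous_scalarCurvature P D).continuousOn).mul (continuousOn_tensor2 P.g_smooth α β)))).sub
    (continuousOn_const.mul (continuousOn_tensor2 hT α β))

/-- The stationary points of the total action are the zeros of the Euler–Lagrange tensor. -/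
theorem isActionStationary_iff_eulerLagrange {lc D : PhaseGeometry m V → LinearConnection m V}
    (hlc : ∀ P, IsLeviCivita P (lc P)) {Lm : Lagrangian m V} (hLm : ∀ P, Continuous (Lm P))
    {Tm Tz : Tensor2 m V} (hTm : IsEnergyMomentum Lm P Tm)
    (hTz : IsEnergyMomentum (distLagrangian ϰ lc D) P Tz) :
    IsActionStationary (totalLagrangian ϰ D Lm) P ↔
      ∀ p v w, eulerLagrange ϰ P (lc P) (Tm + Tz) p v w = 0 := by
  constructor
  · intro h p v w
    rw [eulerLagrange_eq_sum P _ _ (mem_chartDomain p)]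
    have h0 := eq_zero_of_forall_variation P (p₀ := p)
      (E := eulerLagrange ϰ P (lc P) (Tm + Tz))
      (fun p v w => by
        rw [eulerLagrange, eulerLagrange, (hlc P).ricci_symm, P.g_symm, hTm.add_symm hTz])
      (fun α β => continuousOn_eulerLagrange (lc P) (hTm.contMDiffAt_add hTz) α β)
      (fun K hK hKp γ => (hasDerivAt_actionOn_totalLagrangian hlc hLm hTm hTz hK hKp γ).unique
        (h p K hK hKp γ))
    refine Finset.sum_eq_zero fun α _ => Finset.sum_eq_zero fun β _ => ?_
    rw [h0, mul_zero, mul_zero]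
  · intro h p₀ K hK hKp γ
    refine (hasDerivAt_actionOn_totalLagrangian hlc hLm hTm hTz hK hKp γ).congr_deriv ?_
    simp only [h, zero_mul, Finset.sum_const_zero]
    simp [chartIntegral]

/-- The distortion terms cancel on the two sides of the modified Einstein equations. -/
lemma einsteinEq_effectiveSource_iff {lc D : PhaseGeometry m V → LinearConnection m V}
    (T : Tensor2 m V) : EinsteinEq (D P) (effectiveSource ϰ lc D P T) ↔
      EinsteinEq (lc P) (matterSource ϰ P T) := by
  unfold EinsteinEq effectiveSource
  simp only [ricci_eq_add_distRicci (D P) (lc P), add_left_inj]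

lemma einsteinEq_redefinedSource_iff (D D' : LinearConnection m V)
    (Υ : Π p : Phase m V, TangentSpace (𝓡 m).tangent p → TangentSpace (𝓡 m).tangent p → ℝ) :
    EinsteinEq D' (redefinedSource D D' Υ) ↔ EinsteinEq D Υ := by
  unfold EinsteinEq redefinedSource
  simp only [ricci_eq_add_distRicci D' D, add_left_inj]

lemma IsLeviCivita.ricci_eq {D D' : LinearConnection m V} (hD : IsLeviCivita P D)
    (hD' : IsLeviCivita P D') (v w : TangentSpace (𝓡 m).tangent p) :
    ricci D p v w = ricci D' p v w := by
  rw [hD.ricci_eq_sum (mem_chartDomain p), hD'.ricci_eq_sum (mem_chartDomain p)]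

/-- If `D'` is a Levi-Civita connection, the redefined effective source is the bare source. -/
lemma redefinedSource_effectiveSource {lc D : PhaseGeometry m V → LinearConnection m V}
    {D' : LinearConnection m V} (hlc : IsLeviCivita P (lc P)) (hD' : IsLeviCivita P D')
    (T : Tensor2 m V) (p : Phase m V) (v w : TangentSpace (𝓡 m).tangent p) :
    redefinedSource (D P) D' (effectiveSource ϰ lc D P T) p v w = matterSource ϰ P T p v w := by
  have h1 := ricci_eq_add_distRicci (D P) (lc P) p v w
  have h2 := ricci_eq_add_distRicci D' (D P) p v w
  have h3 := hD'.ricci_eq hlc v w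
  rw [redefinedSource, effectiveSource]
  linarith

end FieldEquations

end

end PhaseGravity

theorem mainTheorem7 {m : ℕ} (hm : 2 ≤ m) {V : Type*} [TopologicalSpace V] [T2Space V]
    [ChartedSpace (EuclideanSpace ℝ (Fin m)) V] [IsManifold (𝓡 m) ∞ V] :
    -- existence of the Levi-Civita connection and of the canonical d-connection
    (∀ P : PhaseGeometry m V, (∃ D, IsLeviCivita P D) ∧ ∃ D, IsCanonical P D) ∧
    ∀ (ϰ : ℝ), ϰ ≠ 0 →
    -- `lc` assigns to the data `(N, g)` the Levi-Civita connection, `D` a metric compatible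
    -- d-connection, `Lm` a matter Lagrange density
    ∀ lc : PhaseGeometry m V → LinearConnection m V, (∀ P, IsLeviCivita P (lc P)) →
    ∀ D : PhaseGeometry m V → LinearConnection m V,
      (∀ P, IsDConnection P (D P) ∧ IsMetricCompatible P (D P)) →
    ∀ Lm : Lagrangian m V, (∀ P, Continuous (Lm P)) →
    ∀ (P : PhaseGeometry m V) (Dhat : LinearConnection m V), IsCanonical P Dhat →
    -- energy-momentum d-tensors of matter and of the distortion `D = ∇ + Z`
    ∀ Tm Tz : Tensor2 m V,
      IsEnergyMomentum Lm P Tm → IsEnergyMomentum (distLagrangian ϰ lc D) P Tz →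
    -- the variational equations are the modified Einstein equations
    (IsActionStationary (totalLagrangian ϰ D Lm) P ↔
      EinsteinEq (D P) (effectiveSource ϰ lc D P (Tm + Tz))) ∧
    -- equivalent form for the canonical d-connection, with redefined source
    (EinsteinEq (D P) (effectiveSource ϰ lc D P (Tm + Tz)) ↔
      EinsteinEq Dhat (redefinedSource (D P) Dhat (effectiveSource ϰ lc D P (Tm + Tz)))) ∧
    -- zero torsion conditions and Levi-Civita configurations
    (Dhat.cov.torsion = 0 ↔
      ∀ (p : Phase m V) (Y : VField m V), DiffFieldAt Y p → Dhat.cov Y p = (lc P).cov Y p) ∧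
    (Dhat.cov.torsion = 0 →
      (∀ p v w, redefinedSource (D P) Dhat (effectiveSource ϰ lc D P (Tm + Tz)) p v w =
        matterSource ϰ P (Tm + Tz) p v w) ∧
      (EinsteinEq Dhat (redefinedSource (D P) Dhat (effectiveSource ϰ lc D P (Tm + Tz))) ↔
        EinsteinEq (lc P) (matterSource ϰ P (Tm + Tz)))) := by
  refine ⟨fun P => ⟨⟨_, isLeviCivita_koszul P⟩, ⟨_, isCanonical_canonicalKoszul P⟩⟩, ?_⟩
  intro ϰ hϰ lc hlc D _ Lm hLm P Dhat hDhat Tm Tz hTm hTz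
  -- a torsion-free canonical d-connection is a Levi-Civita connection
  have hLC (h : Dhat.cov.torsion = 0) : IsLeviCivita P Dhat := ⟨hDhat.metric, h⟩
  have hsource (h : Dhat.cov.torsion = 0) (p : Phase m V) (v w) :
      redefinedSource (D P) Dhat (effectiveSource ϰ lc D P (Tm + Tz)) p v w =
        matterSource ϰ P (Tm + Tz) p v w :=
    redefinedSource_effectiveSource (hlc P) (hLC h) _ p v w
  refine ⟨?_, (einsteinEq_redefinedSource_iff _ _ _).symm, ⟨?_, ?_⟩, fun h => ⟨hsource h, ?_⟩⟩
  · rw [isActionStationary_iff_eulerLagrange hlc hLm hTm hTz, einsteinEq_effectiveSource_iff]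
    exact forall_congr' fun p => eulerLagrange_eq_zero_iff hm hϰ P (lc P) (Tm + Tz) p
  · intro h p Y hY
    exact (hLC h).cov_eq (hlc P) hY
  · intro h
    exact (torsion_eq_of_cov_eq h).trans (hlc P).2
  · rw [einsteinEq_redefinedSource_iff, einsteinEq_effectiveSource_iff]
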